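/- An abstract polytope of rank $n$ is a partially ordered set $\mathcal P$ (its elements are called faces) with a least and a greatest face such that: every flag (maximal chain) consists of exactly $n+2$ faces, so that $\mathcal P$ is graded; whenever $F<G$ are faces whose ranks differ by $2$, there are exactly two faces strictly between them; and for all faces $F<G$ whose ranks differ by at least $3$, any two faces strictly between $F$ and $G$ are joined by a finite sequence of faces strictly between $F$ and $G$ in which consecutive faces are comparable. The polytope $\mathcal P$ is chiral if its automorphism group (the group of order automorphisms) has exactly two orbits on flags and any two adjacent flags (flags differing in exactly one face) lie in different orbits. For $q$ a prime power let $\mathrm{PSL}(3,q)$ be the quotient of $\mathrm{SL}(3,\mathbb F_q)$ by its centre, and let $\mathrm{PSU}(3,q)$ be the quotient by its centre of the special unitary group $\mathrm{SU}(3,q)=\{A\in\mathrm{SL}(3,\mathbb F_{q^2}) : A\,\overline{A}^{\,T}=I\}$, where $\overline{A}$ is obtained from $A$ by raising every entry to the power $q$. **Theorem.** Let $q\ge 2$ be a prime power. 1. If $\mathcal P$ is a chiral polytope of rank greater than $5$, then the automorphism group of $\mathcal P$ is isomorphic neither to $\mathrm{PSL}(3,q)$ nor to $\mathrm{PSU}(3,q)$.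 2. If $\mathcal P$ is a chiral polytope of rank $6$, then the automorphism group of $\mathcal P$ is not isomorphic to any subgroup of $\mathrm{PSL}(3,q)$. -/

import Mathlib

/-- `IsAbstractPolytope P n`: the bounded partially ordered set `P` is an abstract polytope of
rank `n`. The least face `⊥` has rank `-1` and the greatest face `⊤` has rank `n`, so that a flag
(maximal chain) has `n + 2` faces. Because all flags have the same finite size, `P` is graded:
the faces `F ≤ G` have ranks differing by `2` exactly when `F ⋖ H ⋖ G` for some `H`, and by at
least `3` exactly when the open interval between them contains two faces `A < B`. -/
structure IsAbstractPolytope (P : Type*) [PartialOrder P] [BoundedOrder P] (n : ℕ) : Prop where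
  /-- Every flag consists of exactly `n + 2` faces. -/
  flag_ncard : ∀ Φ : Flag P, (Φ : Set P).ncard = n + 2
  /-- Diamond condition: between two incident faces whose ranks differ by two there are exactly
  two faces. -/
  diamond : ∀ F H G : P, F ⋖ H → H ⋖ G → (Set.Ioo F G).ncard = 2
  /-- Strong connectedness: in every section `G / F` of rank at least two, any two proper faces
  are joined by a finite sequence of proper faces of the section, consecutive ones incident. -/
  strongly_connected : ∀ F G : P,
    (∃ A ∈ Set.Ioo F G, ∃ B ∈ Set.Ioo F G, A < B) →
    ∀ A ∈ Set.Ioo F G, ∀ B ∈ Set.Ioo F G,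
      Relation.ReflTransGen (fun X Y => Y ∈ Set.Ioo F G ∧ (X ≤ Y ∨ Y ≤ X)) A B

/-- Two flags are adjacent if they differ in exactly one face. -/
def Flag.IsAdjacent {P : Type*} [PartialOrder P] (Φ Ψ : Flag P) : Prop :=
  ((Φ : Set P) \ (Ψ : Set P)).ncard = 1 ∧ ((Ψ : Set P) \ (Φ : Set P)).ncard = 1

/-- Two flags are in the same orbit of the automorphism group `P ≃o P`. -/
def Flag.SameOrbit {P : Type*} [PartialOrder P] (Φ Ψ : Flag P) : Prop :=
  ∃ e : P ≃o P, Flag.map e Φ = Ψ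

/-- `IsChiralPolytope P n`: `P` is a chiral polytope of rank `n`, i.e. an abstract polytope whose
automorphism group has exactly two orbits on the flags, adjacent flags always lying in
different orbits. -/
structure IsChiralPolytope (P : Type*) [PartialOrder P] [BoundedOrder P] (n : ℕ) : Prop
    extends IsAbstractPolytope P n where
  /-- The flags form exactly two orbits. -/
  two_orbits : ∃ Φ Ψ : Flag P, ¬ Φ.SameOrbit Ψ ∧
    ∀ X : Flag P, Φ.SameOrbit X ∨ Ψ.SameOrbit X
  /-- Adjacent flags lie in different orbits. -/
  adjacent : ∀ Φ Ψ : Flag P, Φ.IsAdjacent Ψ → ¬ Φ.SameOrbit Ψ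

/-- The projective special unitary group: the special unitary group (of the standard Hermitian
form `∑ xᵢ * star yᵢ`) modulo its centre. For `K` the field with `q ^ 2` elements and
`star x = x ^ q` this is the finite group `PSU(n, q)`. -/
abbrev ProjectiveSpecialUnitaryGroup (n : Type*) [DecidableEq n] [Fintype n]
    (K : Type*) [CommRing K] [StarRing K] : Type _ :=
  Matrix.specialUnitaryGroup n K ⧸ Subgroup.center (Matrix.specialUnitaryGroup n K)

/-! ### Splicing of flags and the rank function -/

namespace Flag

variable {P : Type*} [PartialOrder P]

/-! Write `s_i` for the exchange of the proper face of rank `i` in a flag. In a chiral polytope no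
automorphism carries a flag to an adjacent one, but for each product `s_i s_j` a unique automorphism
`g i j` has the same effect on a fixed base flag. These automorphisms obey the rules of even words
in reflections: they telescope, `g i j` is an involution for distinct non-neighbouring indices,
neighbouring exchanges do not commute (`exchange_not_comm`), and certain subgroups satisfy an
intersection property. Chirality becomes the statement that no homomorphism inverts all `g 0 i`.
`IsRotationSystem` records this in a form that passes through injective homomorphisms, so it
suffices that no `PSL(3, F)` contains a rotation system of rank at least `6`. The unitary groups are
covered because `PSU(3, q)` embeds in `PSL(3, q ^ 2)`.

An involution of `PSL(3, F)` lifts uniquely to an involution `v ⊗ f - 1` of `SL(3, F)` with `f(v) =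
2` (`exists_isMirror`): up to sign a reflection, or in characteristic two a transvection with centre
`v` and axis `f`. Distinct ones given by `v, f` and `w, g` commute exactly when `f(w) = g(v) = 0`
(`IsMirror.comm_iff`), so commutation relations turn into linear algebra in dimension three.

Rank at least `7`: outside characteristic two, `g 0 2`, `g 0 4`, `g 0 6`, `g 2 4` would be four
pairwise orthogonal reflections in dimension three. In characteristic two, commuting transvections
share their centre or their axis, and five of them cannot commute like the nodes of a path
(`false_of_path_five`).

Rank `6`: in characteristic two a path of four transvections allows two dual patterns, both refuted
by the commutation of `g 0 1` with `g 5 4`. Otherwise `g 0 5`, `g 0 2`, `g 2 5` can be made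
diagonal, and the lifts `x`, `y` of `g 0 1`, `g 5 4` satisfy `x y = r y x` with `r ^ 3 = 1`. If `r =
1`, then up to duality all elements preserve a plane, and inverting part of the translations inverts
every `g 0 i` (`false_of_translations`). If `r ≠ 1`, all `g 0 i` are self-adjoint for one diagonal
form, so the contragredient inverts them (`false_of_self_adjoint`). Both contradict chirality. -/

theorem mem_of_forall_comparable (Φ : Flag P) {x : P} (h : ∀ y ∈ Φ, x ≤ y ∨ y ≤ x) : x ∈ Φ := by
  have hc : IsChain (· ≤ ·) (insert x (Φ : Set P)) :=
    Φ.chain_le.insert fun y hy _ => h y hy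
  have := Φ.max_chain' hc (Set.subset_insert _ _)
  change x ∈ Φ.carrier
  rw [this]
  exact Set.mem_insert _ _

/-- The flag that agrees with `Φ` below a common face `a` and with `Ψ` above it. -/
def splice (Φ Ψ : Flag P) (a : P) (hΦ : a ∈ Φ) (hΨ : a ∈ Ψ) : Flag P where
  carrier := {x | x ∈ Φ ∧ x < a} ∪ {x | x ∈ Ψ ∧ a ≤ x}
  Chain' := by
    rintro x (⟨hx, hxa⟩ | ⟨hx, hxa⟩) y (⟨hy, hya⟩ | ⟨hy, hya⟩) _
    · exact Φ.le_or_le hx hy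
    · exact Or.inl (hxa.le.trans hya)
    · exact Or.inr (hya.le.trans hxa)
    · exact Ψ.le_or_le hx hy
  max_chain' := by
    intro s hs hsub
    refine Set.Subset.antisymm hsub fun x hx => ?_
    have ha : a ∈ s := hsub (Or.inr ⟨hΨ, le_rfl⟩)
    have hcomp : ∀ y ∈ s, x ≤ y ∨ y ≤ x := fun y hy => hs.total hx hy
    by_cases hax : a ≤ x
    · refine Or.inr ⟨Ψ.mem_of_forall_comparable fun y hy => ?_, hax⟩
      rcases Ψ.le_or_le hΨ hy with h | h
      · exact hcomp y (hsub (Or.inr ⟨hy, h⟩))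
      · exact Or.inr (h.trans hax)
    · have hxa : x < a := lt_of_le_of_ne ((hcomp a ha).resolve_right hax)
        (fun h => hax (h ▸ le_rfl))
      refine Or.inl ⟨Φ.mem_of_forall_comparable fun y hy => ?_, hxa⟩
      rcases Φ.le_or_le hΦ hy with h | h
      · exact Or.inl (hxa.le.trans h)
      · rcases h.lt_or_eq with h | rfl
        · exact hcomp y (hsub (Or.inl ⟨hy, h⟩))
        · exact Or.inl hxa.le

end Flag

/-- A rank function of a bounded poset whose flags have `n + 2` faces, normalised to take the
values `0` on the least face and `n + 1` on the greatest face. -/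
structure IsRankFunction {P : Type*} [PartialOrder P] [BoundedOrder P] (n : ℕ) (rk : P → ℕ) :
    Prop where
  lt : ∀ {a b : P}, a < b → rk a < rk b
  covBy : ∀ {a b : P}, a ⋖ b → rk b = rk a + 1
  bot : rk ⊥ = 0
  top : rk ⊤ = n + 1

namespace IsAbstractPolytope

variable {P : Type*} [PartialOrder P] [BoundedOrder P] {n : ℕ}

theorem finite_flag (hP : IsAbstractPolytope P n) (Φ : Flag P) : (Φ : Set P).Finite :=
  Set.finite_of_ncard_pos (by rw [hP.flag_ncard]; omega)

/-- The left side counts the faces of the spliced flag. Keeping `Ψ` and varying `Φ` shows that all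
flags through `a` have equally many faces below `a`, which makes the rank well defined. -/
theorem ncard_below_add (hP : IsAbstractPolytope P n) (Φ Ψ : Flag P) {a : P} (hΦ : a ∈ Φ)
    (hΨ : a ∈ Ψ) : {x | x ∈ Φ ∧ x < a}.ncard + {x | x ∈ Ψ ∧ a ≤ x}.ncard = n + 2 := by
  rw [← hP.flag_ncard (Φ.splice Ψ a hΦ hΨ)]
  symm
  refine Set.ncard_union_eq ?_ ((hP.finite_flag Φ).subset fun x hx => hx.1)
    ((hP.finite_flag Ψ).subset fun x hx => hx.1)
  rw [Set.disjoint_left]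
  rintro x ⟨_, hx⟩ ⟨_, hx'⟩
  exact absurd hx' (not_le_of_gt hx)

theorem exists_rank (hP : IsAbstractPolytope P n) : ∃ rk : P → ℕ, IsRankFunction n rk := by
  choose Φ hΦ using fun a : P => Flag.exists_mem a
  have key : ∀ (a : P) (Ψ : Flag P), a ∈ Ψ →
      {x | x ∈ Φ a ∧ x < a}.ncard = {x | x ∈ Ψ ∧ x < a}.ncard := by
    intro a Ψ ha
    have h1 := hP.ncard_below_add (Φ a) Ψ (hΦ a) ha
    have h2 := hP.ncard_below_add Ψ Ψ ha ha
    omega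
  have hfin : ∀ (Ψ : Flag P) (a : P), {x | x ∈ Ψ ∧ x < a}.Finite := fun Ψ a =>
    (hP.finite_flag Ψ).subset fun x hx => hx.1
  refine ⟨fun a => {x | x ∈ Φ a ∧ x < a}.ncard, ?_, ?_, ?_, ?_⟩
  · intro a b hab
    obtain ⟨Ψ, ha, hb⟩ := Flag.exists_mem_mem hab.le
    rw [key a Ψ ha, key b Ψ hb]
    refine Set.ncard_lt_ncard ⟨fun x hx => ⟨hx.1, hx.2.trans hab⟩, fun h => ?_⟩ (hfin Ψ b)
    exact lt_irrefl a (h ⟨ha, hab⟩).2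
  · intro a b hab
    obtain ⟨Ψ, ha, hb⟩ := Flag.exists_mem_mem hab.le
    rw [key a Ψ ha, key b Ψ hb]
    have : {x | x ∈ Ψ ∧ x < b} = insert a {x | x ∈ Ψ ∧ x < a} := by
      ext x
      constructor
      · rintro ⟨hx, hxb⟩
        rcases Ψ.le_or_le hx ha with h | h
        · rcases h.lt_or_eq with h | h
          · exact Or.inr ⟨hx, h⟩
          · exact Or.inl h
        · rcases h.lt_or_eq with h | h
          · exact absurd hxb (hab.2 h)
          · exact Or.inl h.symm
      · rintro (rfl | ⟨hx, hxa⟩)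
        · exact ⟨ha, hab.lt⟩
        · exact ⟨hx, hxa.trans hab.lt⟩
    rw [this, Set.ncard_insert_of_notMem (fun h => lt_irrefl a h.2) (hfin Ψ a)]
  · have : {x | x ∈ Φ (⊥ : P) ∧ x < ⊥} = ∅ := by
      ext x
      simp
    change Set.ncard _ = 0
    rw [this, Set.ncard_empty]
  · have h := hP.ncard_below_add (Φ ⊤) (Φ ⊤) (hΦ (⊤ : P)) (hΦ ⊤)
    have h2 : {x | x ∈ Φ (⊤ : P) ∧ ⊤ ≤ x} = {⊤} := by
      ext x
      simp only [Set.mem_ofPred_eq, top_le_iff, Set.mem_singleton_iff]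
      exact ⟨fun h => h.2, fun h => h ▸ ⟨hΦ _, rfl⟩⟩
    rw [h2, Set.ncard_singleton] at h
    change Set.ncard _ = n + 1
    omega

end IsAbstractPolytope

namespace IsRankFunction

variable {P : Type*} [PartialOrder P] [BoundedOrder P] {n : ℕ} {rk : P → ℕ}

theorem mono (hrk : IsRankFunction n rk) {a b : P} (h : a ≤ b) : rk a ≤ rk b := by
  rcases h.lt_or_eq with h | rfl
  · exact (hrk.lt h).le
  · rfl

theorem le_top (hrk : IsRankFunction n rk) (a : P) : rk a ≤ n + 1 :=
  hrk.top ▸ hrk.mono _root_.le_top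

theorem eq_of_le (hrk : IsRankFunction n rk) {a b : P} (h : a ≤ b) (h' : rk b ≤ rk a) : a = b := by
  by_contra hne
  have := hrk.lt (lt_of_le_of_ne h hne)
  omega

theorem exists_covBy (hrk : IsRankFunction n rk) {a b : P} (h : a < b) : ∃ c, a ⋖ c ∧ c ≤ b := by
  classical
  have hex : ∃ k, ∃ c, a < c ∧ c ≤ b ∧ rk c = k := ⟨_, b, h, le_rfl, rfl⟩
  obtain ⟨c, hac, hcb, hc⟩ := Nat.find_spec hex
  refine ⟨c, ⟨hac, fun d had hdc => ?_⟩, hcb⟩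
  have := Nat.find_min hex (m := rk d) (hc ▸ hrk.lt hdc)
  exact this ⟨d, had, hdc.le.trans hcb, rfl⟩

/-- The path is indexed by absolute rank, so that it can be spliced into a flag without reindexing.
-/
theorem exists_path (hrk : IsRankFunction n rk) {a b : P} (h : a ≤ b) :
    ∃ f : ℕ → P, f (rk a) = a ∧ f (rk b) = b ∧ ∀ i, rk a ≤ i → i < rk b → f i ⋖ f (i + 1) := by
  induction hd : rk b - rk a generalizing a with
  | zero =>
    have := hrk.eq_of_le h (by omega)
    subst this
    exact ⟨fun _ => a, rfl, rfl, fun i h1 h2 => by omega⟩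
  | succ d ih =>
    have hab : a < b := lt_of_le_of_ne h (by rintro rfl; omega)
    obtain ⟨c, hac, hcb⟩ := hrk.exists_covBy hab
    have hc := hrk.covBy hac
    obtain ⟨f, hf1, hf2, hf3⟩ := ih hcb (by omega)
    have := hrk.mono hcb
    refine ⟨fun i => if i ≤ rk a then a else f i, by simp, ?_, fun i h1 h2 => ?_⟩
    · simp only
      rw [if_neg (by omega), hf2]
    · simp only
      rw [if_neg (by omega : ¬ i + 1 ≤ rk a)]
      by_cases hi : i ≤ rk a
      · rw [if_pos hi]
        obtain rfl : i = rk a := by omega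
        rwa [← hc, hf1]
      · rw [if_neg hi]
        exact hf3 i (by omega) h2

end IsRankFunction

/-! ### Flags as sequences of faces -/

/-- A flag of a poset of rank `n`, listed as a sequence of faces; the face of index `i` has
rank `i - 1`. -/
@[ext]
structure FaceSeq (P : Type*) [PartialOrder P] [BoundedOrder P] (n : ℕ) where
  /-- The sequence of faces. -/
  face : ℕ → P
  face_zero : face 0 = ⊥
  covBy : ∀ i ≤ n, face i ⋖ face (i + 1)
  face_top : ∀ i, n < i → face i = ⊤

namespace FaceSeq

variable {P : Type*} [PartialOrder P] [BoundedOrder P] {n : ℕ} {rk : P → ℕ}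

theorem rank_face (hrk : IsRankFunction n rk) (φ : FaceSeq P n) {i : ℕ} (hi : i ≤ n + 1) :
    rk (φ.face i) = i := by
  induction i with
  | zero => rw [φ.face_zero, hrk.bot]
  | succ i ih => rw [hrk.covBy (φ.covBy i (by omega)), ih (by omega)]

theorem face_le (φ : FaceSeq P n) {i j : ℕ} (h : i ≤ j) : φ.face i ≤ φ.face j := by
  induction j, h using Nat.le_induction with
  | base => exact le_rfl
  | succ j _ ih =>
    refine ih.trans ?_
    by_cases hj : j ≤ n
    · exact (φ.covBy j hj).le
    · rw [φ.face_top (j + 1) (by omega)]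
      exact le_top

theorem face_lt (φ : FaceSeq P n) {i j : ℕ} (h : i < j) (hj : j ≤ n + 1) :
    φ.face i < φ.face j :=
  (φ.covBy i (by omega)).lt.trans_le (φ.face_le h)

theorem ext_of_le {φ ψ : FaceSeq P n} (h : ∀ i, 1 ≤ i → i ≤ n → φ.face i = ψ.face i) : φ = ψ := by
  ext i
  rcases Nat.eq_zero_or_pos i with rfl | hi
  · rw [φ.face_zero, ψ.face_zero]
  · by_cases hn : i ≤ n
    · exact h i hi hn
    · rw [φ.face_top i (by omega), ψ.face_top i (by omega)]

/-- Every saturated chain between two faces of a flag can be spliced into the flag. -/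
theorem exists_splice (φ : FaceSeq P n) (f : ℕ → P) {i j : ℕ} (hij : i ≤ j) (hj : j ≤ n + 1)
    (hi : f i = φ.face i) (hfj : f j = φ.face j) (hf : ∀ k, i ≤ k → k < j → f k ⋖ f (k + 1)) :
    ∃ ψ : FaceSeq P n, (∀ k, k ≤ i ∨ j ≤ k → ψ.face k = φ.face k) ∧
      ∀ k, i ≤ k → k ≤ j → ψ.face k = f k := by
  have hF : ∀ k, k ≤ i ∨ j ≤ k → (if i ≤ k ∧ k ≤ j then f k else φ.face k) = φ.face k := by
    intro k hk
    split_ifs with h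
    · rcases hk with hk | hk
      · obtain rfl : k = i := by omega
        exact hi
      · obtain rfl : k = j := by omega
        exact hfj
    · rfl
  have hF' : ∀ k, i ≤ k → k ≤ j → (if i ≤ k ∧ k ≤ j then f k else φ.face k) = f k :=
    fun k h1 h2 => if_pos ⟨h1, h2⟩
  refine ⟨⟨fun k => if i ≤ k ∧ k ≤ j then f k else φ.face k, ?_, ?_, ?_⟩, hF, hF'⟩
  · rw [hF 0 (by omega), φ.face_zero]
  · intro k hk
    by_cases h : i ≤ k ∧ k < j
    · rw [hF' k h.1 h.2.le, hF' (k + 1) (by omega) h.2]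
      exact hf k h.1 h.2
    · rw [hF k (by omega), hF (k + 1) (by omega)]
      exact φ.covBy k hk
  · intro k hk
    rw [hF k (by omega), φ.face_top k hk]

theorem nonempty (hrk : IsRankFunction n rk) : Nonempty (FaceSeq P n) := by
  obtain ⟨f, h0, h1, hf⟩ := hrk.exists_path (bot_le : (⊥ : P) ≤ ⊤)
  rw [hrk.bot] at h0 hf
  rw [hrk.top] at h1 hf
  refine ⟨⟨fun k => if k ≤ n then f k else ⊤, by simp [h0], fun i hi => ?_, fun i hi => ?_⟩⟩
  · simp only [if_pos hi]
    split_ifs with h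
    · exact hf i (by omega) (by omega)
    · obtain rfl : i = n := by omega
      rw [← h1]
      exact hf i (by omega) (by omega)
  · rw [if_neg (by omega)]

/-- Between two faces of a flag one can insert any intermediate chain of two faces. -/
theorem exists_through (hrk : IsRankFunction n rk) (φ : FaceSeq P n) {a b : ℕ} (hab : a ≤ b)
    (hb : b ≤ n + 1) {X Y : P} (hX : φ.face a ≤ X) (hXY : X ≤ Y) (hY : Y ≤ φ.face b) :
    ∃ ψ : FaceSeq P n, (∀ k, k ≤ a ∨ b ≤ k → ψ.face k = φ.face k) ∧
      ψ.face (rk X) = X ∧ ψ.face (rk Y) = Y := by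
  have ra := φ.rank_face hrk (i := a) (by omega)
  have rb := φ.rank_face hrk hb
  have h1 := hrk.mono hX
  have h2 := hrk.mono hXY
  have h3 := hrk.mono hY
  rw [ra] at h1
  rw [rb] at h3
  obtain ⟨f1, f1a, f1X, f1c⟩ := hrk.exists_path hX
  obtain ⟨f2, f2X, f2Y, f2c⟩ := hrk.exists_path hXY
  obtain ⟨f3, f3Y, f3b, f3c⟩ := hrk.exists_path hY
  rw [ra] at f1a f1c
  rw [rb] at f3b f3c
  -- Three saturated chains, up to `X`, from `X` to `Y`, and on from `Y`, are glued by rank. The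
  -- case distinctions below are the junctions, including the degenerate ones where ranks coincide.
  obtain ⟨ψ, hψ, hψ'⟩ := φ.exists_splice
    (fun k => if k ≤ rk X then f1 k else if k ≤ rk Y then f2 k else f3 k) hab hb
    (by simp only [if_pos h1, f1a])
    (by
      split_ifs with h h'
      · have e : rk X = b := by omega
        have eXY := hrk.eq_of_le hXY (by omega)
        have eYb := hrk.eq_of_le hY (by omega)
        rw [← e, f1X, e, eXY, eYb]
      · have e : rk Y = b := by omega
        have eYb := hrk.eq_of_le hY (by omega)
        rw [← e, f2Y, e, eYb]
      · exact f3b)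
    (by
      intro k hk1 hk2
      by_cases hA : k + 1 ≤ rk X
      · rw [if_pos (by omega), if_pos hA]
        exact f1c k hk1 (by omega)
      rw [if_neg hA]
      by_cases hB : k + 1 ≤ rk Y
      · rw [if_pos hB]
        have : (if k ≤ rk X then f1 k else if k ≤ rk Y then f2 k else f3 k) = f2 k := by
          split_ifs with h h'
          · obtain rfl : k = rk X := by omega
            rw [f1X, f2X]
          · rfl
          · omega
        rw [this]
        exact f2c k (by omega) (by omega)
      rw [if_neg hB]
      have : (if k ≤ rk X then f1 k else if k ≤ rk Y then f2 k else f3 k) = f3 k := by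
        split_ifs with h h'
        · obtain rfl : k = rk X := by omega
          have eXY := hrk.eq_of_le hXY (by omega)
          rw [f1X]
          conv_rhs => rw [eXY, f3Y]
          exact eXY
        · obtain rfl : k = rk Y := by omega
          rw [f2Y, f3Y]
        · rfl
      rw [this]
      exact f3c k (by omega) (by omega))
  refine ⟨ψ, hψ, ?_, ?_⟩
  · rw [hψ' _ h1 (by omega), if_pos le_rfl, f1X]
  · rw [hψ' _ (by omega) h3]
    split_ifs with h
    · have eXY := hrk.eq_of_le hXY h
      rw [← eXY, f1X]
    · exact f2Y
    · omega

theorem exists_face_face (hrk : IsRankFunction n rk) {X Y : P} (hXY : X ≤ Y) :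
    ∃ ψ : FaceSeq P n, ψ.face (rk X) = X ∧ ψ.face (rk Y) = Y := by
  obtain ⟨φ⟩ := nonempty (P := P) hrk
  obtain ⟨ψ, _, h⟩ := φ.exists_through hrk (a := 0) (b := n + 1) (by omega) le_rfl
    (X := X) (Y := Y) (by rw [φ.face_zero]; exact bot_le) hXY
    (by rw [φ.face_top _ (by omega)]; exact le_top)
  exact ⟨ψ, h⟩

end FaceSeq

/-! ### Exchanges of faces and connectedness of the flags -/

namespace FaceSeq

variable {P : Type*} [PartialOrder P] [BoundedOrder P] {n : ℕ} {rk : P → ℕ}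

open Classical in
/-- The flag that differs from `φ` exactly in the face of index `i`; it is `φ` itself if there is
no such flag. -/
noncomputable def exchange (i : ℕ) (φ : FaceSeq P n) : FaceSeq P n :=
  if h : ∃ ψ : FaceSeq P n, (∀ k, k ≠ i → ψ.face k = φ.face k) ∧ ψ.face i ≠ φ.face i
  then h.choose else φ

theorem exchange_face (i : ℕ) (φ : FaceSeq P n) {k : ℕ} (hk : k ≠ i) :
    (exchange i φ).face k = φ.face k := by
  unfold exchange
  split_ifs with h
  · exact h.choose_spec.1 k hk
  · rfl

theorem exchange_of_notMem (φ : FaceSeq P n) {i : ℕ} (hi : ¬ (1 ≤ i ∧ i ≤ n)) :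
    exchange i φ = φ :=
  ext_of_le fun _ h1 h2 => exchange_face i φ (by rintro rfl; exact hi ⟨h1, h2⟩)

theorem mem_Ioo_of_face_eq {φ ψ : FaceSeq P n} {i : ℕ} (hi : i + 1 ≤ n)
    (h1 : ψ.face i = φ.face i) (h2 : ψ.face (i + 2) = φ.face (i + 2)) :
    ψ.face (i + 1) ∈ Set.Ioo (φ.face i) (φ.face (i + 2)) := by
  rw [← h1, ← h2]
  exact ⟨(ψ.covBy i (by omega)).lt, (ψ.covBy (i + 1) hi).lt⟩

section

variable (hP : IsAbstractPolytope P n)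
include hP

theorem eq_of_ne_of_mem_Ioo {φ : FaceSeq P n} {i : ℕ} (hi : i + 1 ≤ n) {x y : P}
    (hx : x ∈ Set.Ioo (φ.face i) (φ.face (i + 2))) (hy : y ∈ Set.Ioo (φ.face i) (φ.face (i + 2)))
    (hxφ : x ≠ φ.face (i + 1)) (hyφ : y ≠ φ.face (i + 1)) : x = y := by
  have h := hP.diamond _ _ _ (φ.covBy i (by omega)) (φ.covBy (i + 1) hi)
  obtain ⟨u, v, -, huv⟩ := Set.ncard_eq_two.1 h
  have hm : φ.face (i + 1) ∈ Set.Ioo (φ.face i) (φ.face (i + 2)) :=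
    ⟨(φ.covBy i (by omega)).lt, (φ.covBy (i + 1) hi).lt⟩
  rw [huv] at hx hy hm
  simp only [Set.mem_insert_iff, Set.mem_singleton_iff] at hx hy hm
  grind

theorem exists_exchange (φ : FaceSeq P n) {i : ℕ} (h1 : 1 ≤ i) (h2 : i ≤ n) :
    ∃ ψ : FaceSeq P n, (∀ k, k ≠ i → ψ.face k = φ.face k) ∧ ψ.face i ≠ φ.face i := by
  obtain ⟨rk, hrk⟩ := hP.exists_rank
  obtain ⟨i, rfl⟩ : ∃ j, i = j + 1 := ⟨i - 1, by omega⟩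
  have h := hP.diamond _ _ _ (φ.covBy i (by omega)) (φ.covBy (i + 1) h2)
  obtain ⟨x, hx, hne⟩ := Set.exists_ne_of_one_lt_ncard
    (by omega : 1 < (Set.Ioo (φ.face i) (φ.face (i + 1 + 1))).ncard) (φ.face (i + 1))
  obtain ⟨ψ, hψ, hψx, -⟩ := φ.exists_through hrk (a := i) (b := i + 2) (by omega) (by omega)
    hx.1.le le_rfl hx.2.le
  have hlt := hrk.lt hx.1
  have hlt' := hrk.lt hx.2
  rw [φ.rank_face hrk (by omega)] at hlt hlt'
  have hr : rk x = i + 1 := by omega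
  rw [hr] at hψx
  exact ⟨ψ, fun k hk => hψ k (by omega), by rwa [hψx]⟩

theorem exchange_face_ne (φ : FaceSeq P n) {i : ℕ} (h1 : 1 ≤ i) (h2 : i ≤ n) :
    (exchange i φ).face i ≠ φ.face i := by
  unfold exchange
  rw [dif_pos (exists_exchange hP φ h1 h2)]
  exact (exists_exchange hP φ h1 h2).choose_spec.2

/-- By the diamond condition the new face is the only other element between the neighbouring faces,
so it depends on three consecutive faces only. Commutation of distant exchanges follows from this
locality. -/
theorem exchange_face_congr {φ ψ : FaceSeq P n} {i : ℕ}
    (h : ∀ k, i ≤ k + 1 → k ≤ i + 1 → φ.face k = ψ.face k) :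
    (exchange i φ).face i = (exchange i ψ).face i := by
  by_cases hi : 1 ≤ i ∧ i ≤ n
  · obtain ⟨h1, h2⟩ := hi
    obtain ⟨i, rfl⟩ : ∃ j, i = j + 1 := ⟨i - 1, by omega⟩
    refine eq_of_ne_of_mem_Ioo hP (φ := φ) h2 (mem_Ioo_of_face_eq h2 ?_ ?_)
      (mem_Ioo_of_face_eq h2 ?_ ?_) (exchange_face_ne hP φ h1 h2) ?_
    · exact exchange_face _ _ (by omega)
    · exact exchange_face _ _ (by omega)
    · rw [exchange_face _ _ (by omega), h i (by omega) (by omega)]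
    · rw [exchange_face _ _ (by omega), h (i + 2) (by omega) (by omega)]
    · rw [h (i + 1) (by omega) (by omega)]
      exact exchange_face_ne hP ψ h1 h2
  · rw [exchange_of_notMem φ hi, exchange_of_notMem ψ hi]
    exact h i (by omega) (by omega)

theorem eq_exchange {φ ψ : FaceSeq P n} {i : ℕ} (h : ∀ k, k ≠ i → ψ.face k = φ.face k)
    (hi : ψ.face i ≠ φ.face i) : ψ = exchange i φ := by
  have hin : 1 ≤ i ∧ i ≤ n := by
    by_contra hc
    apply hi
    rcases Nat.eq_zero_or_pos i with rfl | h0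
    · rw [φ.face_zero, ψ.face_zero]
    · rw [φ.face_top i (by omega), ψ.face_top i (by omega)]
  obtain ⟨h1, h2⟩ := hin
  obtain ⟨i, rfl⟩ : ∃ j, i = j + 1 := ⟨i - 1, by omega⟩
  ext k
  by_cases hk : k = i + 1
  · subst hk
    refine eq_of_ne_of_mem_Ioo hP (φ := φ) h2 (mem_Ioo_of_face_eq h2 ?_ ?_)
      (mem_Ioo_of_face_eq h2 ?_ ?_) hi (exchange_face_ne hP φ h1 h2)
    · exact h _ (by omega)
    · exact h _ (by omega)
    · exact exchange_face _ _ (by omega)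
    · exact exchange_face _ _ (by omega)
  · rw [h k hk, exchange_face _ _ hk]

theorem exchange_exchange (i : ℕ) (φ : FaceSeq P n) : exchange i (exchange i φ) = φ := by
  by_cases hi : 1 ≤ i ∧ i ≤ n
  · refine (eq_exchange hP (fun k hk => ?_) ?_).symm
    · rw [exchange_face _ _ hk]
    · exact (exchange_face_ne hP φ hi.1 hi.2).symm
  · rw [exchange_of_notMem _ hi, exchange_of_notMem _ hi]

theorem exchange_comm {i j : ℕ} (hij : i + 2 ≤ j) (φ : FaceSeq P n) :
    exchange i (exchange j φ) = exchange j (exchange i φ) := by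
  ext k
  by_cases hki : k = i
  · subst hki
    rw [exchange_face j _ (by omega)]
    exact exchange_face_congr hP fun l _ _ => exchange_face _ _ (by omega)
  by_cases hkj : k = j
  · subst hkj
    rw [exchange_face i _ hki]
    exact exchange_face_congr hP fun l _ _ => (exchange_face _ _ (by omega)).symm
  · simp only [exchange_face _ _ hki, exchange_face _ _ hkj]

end

/-- `Conn S φ ψ`: the flag `ψ` arises from `φ` by exchanging faces with index in `S`. -/
def Conn (S : Set ℕ) : FaceSeq P n → FaceSeq P n → Prop :=
  Relation.ReflTransGen fun φ ψ => ∃ i ∈ S, ψ = exchange i φ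

theorem Conn.mono {S T : Set ℕ} (h : S ⊆ T) {φ ψ : FaceSeq P n} (hc : Conn S φ ψ) : Conn T φ ψ := by
  induction hc with
  | refl => exact Relation.ReflTransGen.refl
  | tail _ hstep ih =>
    obtain ⟨i, hi, rfl⟩ := hstep
    exact ih.tail ⟨i, h hi, rfl⟩

theorem Conn.refl (S : Set ℕ) (φ : FaceSeq P n) : Conn S φ φ := Relation.ReflTransGen.refl

theorem Conn.trans {S : Set ℕ} {φ ψ χ : FaceSeq P n} (h : Conn S φ ψ) (h' : Conn S ψ χ) :
    Conn S φ χ := Relation.ReflTransGen.trans h h'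

theorem Conn.single {S : Set ℕ} {i : ℕ} (hi : i ∈ S) (φ : FaceSeq P n) :
    Conn S φ (exchange i φ) := Relation.ReflTransGen.single ⟨i, hi, rfl⟩

theorem Conn.face_eq {S : Set ℕ} {φ ψ : FaceSeq P n} (h : Conn S φ ψ) {k : ℕ} (hk : k ∉ S) :
    ψ.face k = φ.face k := by
  induction h with
  | refl => rfl
  | tail _ hstep ih =>
    obtain ⟨i, hi, rfl⟩ := hstep
    rw [exchange_face _ _ (by rintro rfl; exact hk hi), ih]

/-- Induction on `b - a`. Flags sharing one more face strictly in between are joined through a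
spliced flag (`meet`). In general, strong connectedness gives a chain of faces from `φ.face (a + 1)`
to `ψ.face (a + 1)`, and consecutive faces of it lie on a common flag. -/
theorem conn_of_face_eq (hP : IsAbstractPolytope P n) {a b : ℕ} (hab : a ≤ b) (hb : b ≤ n + 1)
    {φ ψ : FaceSeq P n} (h : ∀ k, k ≤ a ∨ b ≤ k → ψ.face k = φ.face k) :
    Conn (Set.Ioo a b) φ ψ := by
  obtain ⟨rk, hrk⟩ := hP.exists_rank
  induction hd : b - a using Nat.strong_induction_on generalizing a b φ ψ with
  | _ d ih =>
  by_cases hd1 : b ≤ a + 1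
  · have : ψ = φ := by
      ext k
      exact h k (by omega)
    rw [this]
    exact Conn.refl _ _
  by_cases hd2 : b = a + 2
  · subst hd2
    by_cases he : ψ.face (a + 1) = φ.face (a + 1)
    · have : ψ = φ := by
        ext k
        by_cases hk : k = a + 1
        · rw [hk, he]
        · exact h k (by omega)
      rw [this]
      exact Conn.refl _ _
    · have : ψ = exchange (a + 1) φ := eq_exchange hP (fun k hk => h k (by omega)) he
      rw [this]
      exact Conn.single (Set.mem_Ioo.2 ⟨by omega, by omega⟩) _
  have meet : ∀ (χ χ' : FaceSeq P n) (m : ℕ), a < m → m < b →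
      (∀ k, k ≤ a ∨ b ≤ k → χ'.face k = χ.face k) → χ'.face m = χ.face m →
      Conn (Set.Ioo a b) χ χ' := by
    intro χ χ' m ham hmb hχ hm
    obtain ⟨θ, hθ, hθ'⟩ := χ.exists_splice χ'.face (i := a) (j := m) ham.le (by omega)
      (hχ a (by omega)) hm (fun k _ _ => χ'.covBy k (by omega))
    refine Conn.trans (ψ := θ) ?_ ?_
    · exact (ih (m - a) (by omega) ham.le (by omega) hθ rfl).mono
        fun k hk => Set.mem_Ioo.2 ⟨hk.1, hk.2.trans hmb⟩
    · refine (ih (b - m) (by omega) hmb.le hb (fun k hk => ?_) rfl).mono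
        fun k hk => Set.mem_Ioo.2 ⟨ham.trans hk.1, hk.2⟩
      by_cases hak : a ≤ k ∧ k ≤ m
      · rw [hθ' k hak.1 hak.2]
      · rw [hθ k (by omega), hχ k (by omega)]
  have hA : φ.face (a + 1) ∈ Set.Ioo (φ.face a) (φ.face b) :=
    ⟨φ.face_lt (by omega) (by omega), φ.face_lt (by omega) (by omega)⟩
  have hA2 : φ.face (a + 2) ∈ Set.Ioo (φ.face a) (φ.face b) :=
    ⟨φ.face_lt (by omega) (by omega), φ.face_lt (by omega) (by omega)⟩
  have hB : ψ.face (a + 1) ∈ Set.Ioo (φ.face a) (φ.face b) := by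
    rw [← h a (by omega), ← h b (by omega)]
    exact ⟨ψ.face_lt (by omega) (by omega), ψ.face_lt (by omega) (by omega)⟩
  have hsc := hP.strongly_connected _ _
    ⟨_, hA, _, hA2, φ.face_lt (by omega) (by omega)⟩ _ hA _ hB
  have ra := φ.rank_face hrk (i := a) (by omega)
  have rb := φ.rank_face hrk hb
  have main : ∀ X, Relation.ReflTransGen (fun X Y => Y ∈ Set.Ioo (φ.face a) (φ.face b) ∧
      (X ≤ Y ∨ Y ≤ X)) (φ.face (a + 1)) X → X ∈ Set.Ioo (φ.face a) (φ.face b) ∧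
      ∀ χ : FaceSeq P n, (∀ k, k ≤ a ∨ b ≤ k → χ.face k = φ.face k) → χ.face (rk X) = X →
      Conn (Set.Ioo a b) φ χ := by
    intro X hX
    induction hX with
    | refl =>
      refine ⟨hA, fun χ hχ hχX => meet φ χ (a + 1) (by omega) (by omega) hχ ?_⟩
      rwa [φ.rank_face hrk (by omega)] at hχX
    | @tail X Y _ hstep ihX =>
      obtain ⟨hY, hXY⟩ := hstep
      obtain ⟨hX, ihX⟩ := ihX
      refine ⟨hY, fun χ hχ hχY => ?_⟩
      obtain ⟨χ', hχ', hX', hY'⟩ : ∃ χ' : FaceSeq P n,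
          (∀ k, k ≤ a ∨ b ≤ k → χ'.face k = φ.face k) ∧ χ'.face (rk X) = X ∧
          χ'.face (rk Y) = Y := by
        rcases hXY with hXY | hXY
        · exact φ.exists_through hrk hab hb hX.1.le hXY hY.2.le
        · obtain ⟨χ', h1, h2, h3⟩ := φ.exists_through hrk hab hb hY.1.le hXY hX.2.le
          exact ⟨χ', h1, h3, h2⟩
      refine (ihX χ' hχ' hX').trans (meet χ' χ (rk Y) ?_ ?_ (fun k hk => ?_) ?_)
      · rw [← ra]
        exact hrk.lt hY.1
      · rw [← rb]
        exact hrk.lt hY.2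
      · rw [hχ k hk, hχ' k hk]
      · rw [hχY, hY']
  refine (main _ hsc).2 ψ h ?_
  rw [ψ.rank_face hrk (by omega)]

/-- Flags sharing the faces of index `a` and `b` are connected by exchanges of other faces. -/
theorem conn_compl_pair (hP : IsAbstractPolytope P n) {a b : ℕ} (hab : a ≤ b) (hb : b ≤ n + 1)
    {φ ψ : FaceSeq P n} (ha' : ψ.face a = φ.face a) (hb' : ψ.face b = φ.face b) :
    Conn {k | k ≠ a ∧ k ≠ b} φ ψ := by
  obtain ⟨θ, hθ, hθ'⟩ := φ.exists_splice ψ.face (i := 0) (j := a) (by omega) (by omega)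
    (by rw [φ.face_zero, ψ.face_zero]) ha' (fun k _ _ => ψ.covBy k (by omega))
  have ea : θ.face a = ψ.face a := hθ' a (by omega) le_rfl
  have eb : θ.face b = ψ.face b := by rw [hθ b (by omega), hb']
  obtain ⟨η, hη, hη'⟩ := θ.exists_splice ψ.face (i := a) (j := b) hab hb
    ea.symm eb.symm (fun k _ _ => ψ.covBy k (by omega))
  have h1 := conn_of_face_eq hP (by omega) (by omega) hθ
  have h2 := conn_of_face_eq hP hab hb hη
  have h3 : Conn (Set.Ioo b (n + 1)) η ψ := by
    refine conn_of_face_eq hP hb le_rfl fun k hk => ?_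
    rcases hk with hk | hk
    · by_cases hak : a ≤ k
      · rw [hη' k hak hk]
      · rw [hη k (by omega), hθ' k (by omega) (by omega)]
    · rcases hk.lt_or_eq with hk | rfl
      · rw [ψ.face_top k (by omega), η.face_top k (by omega)]
      · rw [ψ.face_top _ (by omega), η.face_top _ (by omega)]
  refine ((h1.mono ?_).trans (h2.mono ?_)).trans (h3.mono ?_)
  · exact fun k hk => ⟨by have := hk.2; omega, by have := hk.2; omega⟩
  · exact fun k hk => ⟨by have := hk.1; omega, by have := hk.2; omega⟩
  · exact fun k hk => ⟨by have := hk.1; omega, by have := hk.1; omega⟩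

theorem conn_univ (hP : IsAbstractPolytope P n) (φ ψ : FaceSeq P n) :
    Conn (Set.Icc 1 n) φ ψ := by
  have := conn_of_face_eq hP (a := 0) (b := n + 1) (by omega) le_rfl (φ := φ) (ψ := ψ)
    fun k hk => by
      rcases hk with hk | hk
      · obtain rfl : k = 0 := by omega
        rw [φ.face_zero, ψ.face_zero]
      · rw [φ.face_top k (by omega), ψ.face_top k (by omega)]
  exact this.mono fun k hk => Set.mem_Icc.2 ⟨hk.1, by have := hk.2; omega⟩

end FaceSeq

/-! ### Automorphisms acting on flags -/

namespace FaceSeq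

variable {P : Type*} [PartialOrder P] [BoundedOrder P] {n : ℕ} {rk : P → ℕ}

/-- The image of a flag under an automorphism. -/
def map (e : P ≃o P) (φ : FaceSeq P n) : FaceSeq P n where
  face i := e (φ.face i)
  face_zero := by rw [φ.face_zero, map_bot]
  covBy i hi := (apply_covBy_apply_iff e).2 (φ.covBy i hi)
  face_top i hi := by rw [φ.face_top i hi, map_top]

@[simp]
theorem map_face (e : P ≃o P) (φ : FaceSeq P n) (i : ℕ) : (map e φ).face i = e (φ.face i) := rfl

theorem map_mul (e e' : P ≃o P) (φ : FaceSeq P n) : map (e * e') φ = map e (map e' φ) := rfl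

theorem map_one (φ : FaceSeq P n) : map 1 φ = φ := rfl

theorem map_inv_map (e : P ≃o P) (φ : FaceSeq P n) : map e⁻¹ (map e φ) = φ := by
  rw [← map_mul, inv_mul_cancel, map_one]

theorem map_exchange (hP : IsAbstractPolytope P n) (e : P ≃o P) (i : ℕ) (φ : FaceSeq P n) :
    map e (exchange i φ) = exchange i (map e φ) := by
  by_cases hi : 1 ≤ i ∧ i ≤ n
  · refine eq_exchange hP (fun k hk => ?_) fun h => ?_
    · rw [map_face, map_face, exchange_face _ _ hk]
    · exact exchange_face_ne hP φ hi.1 hi.2 (e.injective h)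
  · rw [exchange_of_notMem _ hi, exchange_of_notMem _ hi]

/-- Automorphisms commute with exchanges, so one that fixes a flag fixes all flags connected to it,
hence every face. -/
theorem eq_one_of_map_eq (hP : IsAbstractPolytope P n) {e : P ≃o P} {φ : FaceSeq P n}
    (h : map e φ = φ) : e = 1 := by
  have hall : ∀ ψ : FaceSeq P n, map e ψ = ψ := by
    intro ψ
    have hc := conn_univ hP φ ψ
    induction hc with
    | refl => exact h
    | tail _ hstep ih =>
      obtain ⟨i, _, rfl⟩ := hstep
      rw [map_exchange hP, ih]
  obtain ⟨rk, hrk⟩ := hP.exists_rank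
  ext x
  obtain ⟨ψ, hψ, -⟩ := exists_face_face (n := n) hrk (le_refl x)
  have := congrArg (fun χ => χ.face (rk x)) (hall ψ)
  simp only [map_face, hψ] at this
  exact this

theorem map_injective (hP : IsAbstractPolytope P n) {e e' : P ≃o P} {φ : FaceSeq P n}
    (h : map e φ = map e' φ) : e = e' := by
  have : map (e'⁻¹ * e) φ = φ := by rw [map_mul, h, map_inv_map]
  exact (inv_mul_eq_one.1 (eq_one_of_map_eq hP this)).symm

/-- The flag consisting of the faces of a sequence. -/
def toFlag (hrk : IsRankFunction n rk) (φ : FaceSeq P n) : Flag P where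
  carrier := Set.range φ.face
  Chain' := by
    rintro _ ⟨i, rfl⟩ _ ⟨j, rfl⟩ _
    exact (le_total i j).imp φ.face_le φ.face_le
  max_chain' := by
    intro s hs hsub
    refine Set.Subset.antisymm hsub fun x hx => ⟨rk x, ?_⟩
    have hr := φ.rank_face hrk (hrk.le_top x)
    rcases hs.total hx (hsub ⟨rk x, rfl⟩) with h | h
    · exact (hrk.eq_of_le h hr.le).symm
    · exact hrk.eq_of_le h hr.ge

theorem coe_toFlag (hrk : IsRankFunction n rk) (φ : FaceSeq P n) :
    (toFlag hrk φ : Set P) = Set.range φ.face := rfl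

theorem map_toFlag (hrk : IsRankFunction n rk) (e : P ≃o P) (φ : FaceSeq P n) :
    Flag.map e (toFlag hrk φ) = toFlag hrk (map e φ) := by
  apply Flag.ext
  rw [Flag.coe_map, coe_toFlag, coe_toFlag, ← Set.range_comp]
  rfl

theorem face_eq_of_mem (hrk : IsRankFunction n rk) {φ ψ : FaceSeq P n} {i : ℕ} (hi : i ≤ n + 1)
    (h : φ.face i ∈ Set.range ψ.face) : φ.face i = ψ.face i := by
  obtain ⟨j, hj⟩ := h
  by_cases hjn : j ≤ n + 1
  · have := ψ.rank_face hrk hjn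
    rw [hj, φ.rank_face hrk hi] at this
    rw [← hj, this]
  · have hr := φ.rank_face hrk hi
    rw [← hj, ψ.face_top j (by omega), hrk.top] at hr
    rw [← hj, ψ.face_top j (by omega), ψ.face_top i (by omega)]

theorem toFlag_injective (hrk : IsRankFunction n rk) {φ ψ : FaceSeq P n}
    (h : toFlag hrk φ = toFlag hrk ψ) : φ = ψ := by
  have h' : Set.range φ.face = Set.range ψ.face := by rw [← coe_toFlag hrk, h, coe_toFlag]
  exact ext_of_le fun i _ hi => face_eq_of_mem hrk (by omega) (h' ▸ ⟨i, rfl⟩)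

theorem range_diff_exchange (hrk : IsRankFunction n rk)
    {φ ψ : FaceSeq P n} {i : ℕ} (h : ∀ k, k ≠ i → ψ.face k = φ.face k)
    (hi : ψ.face i ≠ φ.face i) : (Set.range φ.face \ Set.range ψ.face).ncard = 1 := by
  have hin : i ≤ n + 1 := by
    by_contra hc
    exact hi (by rw [φ.face_top i (by omega), ψ.face_top i (by omega)])
  rw [Set.ncard_eq_one]
  refine ⟨φ.face i, ?_⟩
  ext x
  constructor
  · rintro ⟨⟨k, rfl⟩, hx⟩
    by_cases hk : k = i
    · rw [hk]
      rfl
    · exact absurd ⟨k, h k hk⟩ hx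
  · intro hx
    rw [Set.mem_singleton_iff.1 hx]
    exact ⟨⟨i, rfl⟩, fun hc => hi (face_eq_of_mem hrk hin hc).symm⟩

theorem isAdjacent_exchange (hP : IsAbstractPolytope P n) (hrk : IsRankFunction n rk)
    (φ : FaceSeq P n) {i : ℕ} (h1 : 1 ≤ i) (h2 : i ≤ n) :
    (toFlag hrk φ).IsAdjacent (toFlag hrk (exchange i φ)) := by
  have hne := exchange_face_ne hP φ h1 h2
  have h := fun k (hk : k ≠ i) => exchange_face i φ hk
  exact ⟨range_diff_exchange hrk h hne,
    range_diff_exchange hrk (fun k hk => (h k hk).symm) hne.symm⟩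

theorem map_ne_exchange (hC : IsChiralPolytope P n) (e : P ≃o P) (φ : FaceSeq P n) {i : ℕ}
    (h1 : 1 ≤ i) (h2 : i ≤ n) : map e φ ≠ exchange i φ := by
  obtain ⟨rk, hrk⟩ := hC.toIsAbstractPolytope.exists_rank
  intro h
  refine hC.adjacent _ _ (isAdjacent_exchange hC.toIsAbstractPolytope hrk φ h1 h2) ⟨e, ?_⟩
  rw [map_toFlag, h]

/-- Each exchange switches between the two orbits, so two exchanges lead back to the first one. -/
theorem exists_map_eq (hC : IsChiralPolytope P n) (φ : FaceSeq P n) {i j : ℕ}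
    (hi1 : 1 ≤ i) (hi2 : i ≤ n) (hj1 : 1 ≤ j) (hj2 : j ≤ n) :
    ∃ e : P ≃o P, map e φ = exchange j (exchange i φ) := by
  obtain ⟨rk, hrk⟩ := hC.toIsAbstractPolytope.exists_rank
  have hrefl : ∀ X Y : Flag P, X.SameOrbit Y → Y.SameOrbit X := by
    rintro X _ ⟨e, rfl⟩
    exact ⟨e.symm, by apply Flag.ext; rw [Flag.coe_map, Flag.coe_map, OrderIso.symm_image_image]⟩
  have htrans : ∀ X Y Z : Flag P, X.SameOrbit Y → Y.SameOrbit Z → X.SameOrbit Z := by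
    rintro X _ _ ⟨e, rfl⟩ ⟨e', rfl⟩
    refine ⟨e.trans e', ?_⟩
    apply Flag.ext
    rw [Flag.coe_map, Flag.coe_map, Flag.coe_map, Set.image_image]
    rfl
  obtain ⟨A, B, -, hAB⟩ := hC.two_orbits
  have n1 := hC.adjacent _ _ (isAdjacent_exchange hC.toIsAbstractPolytope hrk φ hi1 hi2)
  have n2 := hC.adjacent _ _
    (isAdjacent_exchange hC.toIsAbstractPolytope hrk (exchange i φ) hj1 hj2)
  have : (toFlag hrk φ).SameOrbit (toFlag hrk (exchange j (exchange i φ))) := by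
    rcases hAB (toFlag hrk φ) with a | a <;> rcases hAB (toFlag hrk (exchange i φ)) with b | b <;>
      rcases hAB (toFlag hrk (exchange j (exchange i φ))) with c | c
    · exact absurd (htrans _ _ _ (hrefl _ _ a) b) n1
    · exact absurd (htrans _ _ _ (hrefl _ _ a) b) n1
    · exact htrans _ _ _ (hrefl _ _ a) c
    · exact absurd (htrans _ _ _ (hrefl _ _ b) c) n2
    · exact absurd (htrans _ _ _ (hrefl _ _ b) c) n2
    · exact htrans _ _ _ (hrefl _ _ a) c
    · exact absurd (htrans _ _ _ (hrefl _ _ a) b) n1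
    · exact absurd (htrans _ _ _ (hrefl _ _ a) b) n1
  obtain ⟨e, he⟩ := this
  refine ⟨e, toFlag_injective hrk ?_⟩
  rw [← map_toFlag, he]

/-- Exchanges of two consecutive ranks never commute on the flags of a chiral polytope: otherwise
every face of lower rank would be incident with every face of higher rank, and an automorphism
could be restricted to the faces of lower rank. -/
theorem exchange_not_comm (hC : IsChiralPolytope P n) {m : ℕ} (hm1 : 1 ≤ m) (hmn : m + 1 ≤ n)
    (hcomm : ∀ φ : FaceSeq P n, exchange m (exchange (m + 1) φ) =
      exchange (m + 1) (exchange m φ)) : False := by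
  have hP := hC.toIsAbstractPolytope
  obtain ⟨rk, hrk⟩ := hP.exists_rank
  obtain ⟨φ⟩ := nonempty (P := P) hrk
  -- Exchanges of index at most `m` commute with the higher ones, so the former alone lead from `χ'`
  -- to a flag with the lower faces of `χ`; they leave the upper faces of `χ'` in place.
  have hlow : ∀ χ χ' : FaceSeq P n, ∃ ψ, Conn (Set.Icc 1 m) χ' ψ ∧
      ∀ k ≤ m, ψ.face k = χ.face k := by
    intro χ χ'
    have hc := conn_univ hP χ χ'
    induction hc with
    | refl => exact ⟨χ, Conn.refl _ _, fun _ _ => rfl⟩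
    | @tail χ₁ χ₂ _ hstep ih =>
      obtain ⟨j, _, rfl⟩ := hstep
      obtain ⟨ψ, hψ, hψ'⟩ := ih
      by_cases hj : 1 ≤ j ∧ j ≤ m
      · refine ⟨ψ, Conn.trans ?_ hψ, hψ'⟩
        have := Conn.single (S := Set.Icc 1 m) (Set.mem_Icc.2 hj) (exchange j χ₁)
        rwa [exchange_exchange hP] at this
      by_cases hj0 : j = 0
      · rw [exchange_of_notMem χ₁ (by omega)]
        exact ⟨ψ, hψ, hψ'⟩
      refine ⟨exchange j ψ, ?_, fun k hk => ?_⟩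
      · clear hψ'
        induction hψ with
        | refl => exact Conn.refl _ _
        | @tail η₁ η₂ _ hstep ih =>
          obtain ⟨i, hi, rfl⟩ := hstep
          have hi' := Set.mem_Icc.1 hi
          refine ih.trans ?_
          have : exchange j (exchange i η₁) = exchange i (exchange j η₁) := by
            by_cases hij : i + 2 ≤ j
            · exact (exchange_comm hP hij η₁).symm
            · obtain rfl : i = m := by omega
              obtain rfl : j = i + 1 := by omega
              exact (hcomm η₁).symm
          rw [this]
          exact Conn.single hi _
      · rw [exchange_face _ _ (by omega), hψ' k hk]
  have hlt : ∀ X Y : P, rk X ≤ m → m < rk Y → X < Y := by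
    intro X Y hX hY
    obtain ⟨χ, hχ, -⟩ := exists_face_face (n := n) hrk (le_refl X)
    obtain ⟨χ', hχ', -⟩ := exists_face_face (n := n) hrk (le_refl Y)
    obtain ⟨ψ, hψ, hψ'⟩ := hlow χ χ'
    have h1 : ψ.face (rk X) = X := by rw [hψ' _ hX, hχ]
    have h2 : ψ.face (rk Y) = Y := by
      rw [hψ.face_eq (fun h => by have := (Set.mem_Icc.1 h).2; omega), hχ']
    rw [← h1, ← h2]
    exact ψ.face_lt (by omega) (hrk.le_top Y)
  obtain ⟨e, he⟩ := exists_map_eq hC φ (i := 1) (j := n) le_rfl (by omega) (by omega) le_rfl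
  have hrke : ∀ (e : P ≃o P) (X : P), rk (e X) = rk X := by
    intro e X
    obtain ⟨χ, hχ, -⟩ := exists_face_face (n := n) hrk (le_refl X)
    have := (map e χ).rank_face hrk (hrk.le_top X)
    rwa [map_face, hχ] at this
  have hmono : ∀ (e : P ≃o P) (X Y : P), X ≤ Y →
      (if rk X ≤ m then e X else X) ≤ (if rk Y ≤ m then e Y else Y) := by
    intro e X Y hXY
    have := hrk.mono hXY
    split_ifs with h h'
    · exact e.monotone hXY
    · exact (hlt _ _ (by rwa [hrke]) (by omega)).le
    · omega
    · exact hXY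
  have hinv : ∀ (e : P ≃o P) (X : P), (if rk (if rk X ≤ m then e X else X) ≤ m then
      e.symm (if rk X ≤ m then e X else X) else (if rk X ≤ m then e X else X)) = X := by
    intro e X
    by_cases h : rk X ≤ m
    · simp [h, hrke]
    · simp [h]
  -- The map acts as `e` on the lower faces and trivially above. On the base flag the exchange of
  -- index `n > m` contained in `e` is thereby cut off, and only the exchange of index `1` remains.
  let e' : P ≃o P :=
    { toFun := fun X => if rk X ≤ m then e X else X
      invFun := fun X => if rk X ≤ m then e.symm X else X
      left_inv := hinv e
      right_inv := hinv e.symm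
      map_rel_iff' := by
        intro X Y
        refine ⟨fun h => ?_, hmono e X Y⟩
        have := hmono e.symm _ _ h
        exact (hinv e X).symm.le.trans (this.trans (hinv e Y).le) }
  refine map_ne_exchange hC e' φ (i := 1) le_rfl (by omega) ?_
  refine ext_of_le fun k hk1 hk2 => ?_
  change (if rk (φ.face k) ≤ m then e (φ.face k) else φ.face k) = _
  rw [φ.rank_face hrk (by omega)]
  split_ifs with h
  · rw [← map_face, he, exchange_face _ _ (by omega)]
  · rw [exchange_face _ _ (by omega)]

end FaceSeq

/-! ### Rotation systems -/

/-- The subgroup generated by the elements `g i j` with indices in `S`. -/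
def rotationSubgroup {Γ : Type*} [Group Γ] (g : ℕ → ℕ → Γ) (S : Set ℕ) : Subgroup Γ :=
  Subgroup.closure {γ | ∃ i ∈ S, ∃ j ∈ S, γ = g i j}

/-- The properties of the elements `g i j = s_i s_j` of the automorphism group of a chiral
polytope of rank `n` that are used here. -/
structure IsRotationSystem {Γ : Type*} [Group Γ] (n : ℕ) (g : ℕ → ℕ → Γ) : Prop where
  mul : ∀ i j k, i < n → j < n → k < n → g i j * g j k = g i k
  symm : ∀ i j, i + 2 ≤ j → j < n → g i j = g j i
  -- The first element moves the face of index `i + 1` of the base flag, the second one fixes it.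
  sep : ∀ i j k l, i < n → j < n → k < n → l < n → i ≠ j → i ≠ k → i ≠ l → g i j ≠ g k l
  nondeg : ∀ i, i + 1 < n → g i (i + 1) ≠ g (i + 1) i
  inter : ∀ a b, a < b → b < n → ∀ z, z ∈ rotationSubgroup g {k | k < n ∧ k ≠ a} →
    z ∈ rotationSubgroup g {k | k < n ∧ k ≠ b} →
    z ∈ rotationSubgroup g {k | k < n ∧ k ≠ a ∧ k ≠ b}
  -- A subgroup without such a `z` would be the graph of a homomorphism inverting every `g 0 i`.
  -- Speaking of subgroups of pairs lets the property survive injective homomorphisms.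
  chiral : ∀ Δ : Subgroup (Γ × Γ), (∀ i < n, (g 0 i, g i 0) ∈ Δ) → ∃ z, (1, z) ∈ Δ ∧ z ≠ 1

namespace FaceSeq

variable {P : Type*} [PartialOrder P] [BoundedOrder P] {n : ℕ}

/-- The elements `g i j` map the base flag `φ` to the flag obtained by exchanging the faces of
ranks `i` and `j`. -/
def IsRotation (φ : FaceSeq P n) (g : ℕ → ℕ → P ≃o P) : Prop :=
  ∀ i j, i < n → j < n → map (g i j) φ = exchange (j + 1) (exchange (i + 1) φ)

section

variable (hP : IsAbstractPolytope P n) {φ : FaceSeq P n} {g : ℕ → ℕ → P ≃o P}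
  (hg : IsRotation φ g)
include hP hg

theorem IsRotation.mul {i j k : ℕ} (hi : i < n) (hj : j < n) (hk : k < n) :
    g i j * g j k = g i k := by
  apply map_injective hP (φ := φ)
  rw [map_mul, hg j k hj hk, hg i k hi hk, map_exchange hP, map_exchange hP, hg i j hi hj,
    exchange_exchange hP]

theorem IsRotation.map_exchange_left {i k : ℕ} (hi : i < n) (hk : k < n) :
    exchange (i + 1) φ = map (g i k) (exchange (k + 1) φ) := by
  rw [map_exchange hP, hg i k hi hk, exchange_exchange hP]

/-- Pairs of exchanges are absorbed by the subgroup; if one exchange is left over, it can be taken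
at the index `k₀`. -/
theorem IsRotation.exists_mem_of_conn {S : Set ℕ} (hS : ∀ k ∈ S, k < n) {k₀ : ℕ} (hk₀ : k₀ ∈ S)
    {ψ : FaceSeq P n} (h : Conn {k | ∃ i ∈ S, k = i + 1} φ ψ) :
    ∃ z ∈ rotationSubgroup g S, ψ = map z φ ∨ ψ = map z (exchange (k₀ + 1) φ) := by
  induction h with
  | refl => exact ⟨1, one_mem _, Or.inl rfl⟩
  | tail _ hstep ih =>
    obtain ⟨_, ⟨i, hi, rfl⟩, rfl⟩ := hstep
    obtain ⟨z, hz, rfl | rfl⟩ := ih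
    · refine ⟨z * g i k₀, mul_mem hz (Subgroup.subset_closure ⟨i, hi, k₀, hk₀, rfl⟩), Or.inr ?_⟩
      rw [← map_exchange hP, hg.map_exchange_left hP (hS i hi) (hS k₀ hk₀), map_mul]
    · refine ⟨z * g k₀ i, mul_mem hz (Subgroup.subset_closure ⟨k₀, hk₀, i, hi, rfl⟩), Or.inl ?_⟩
      rw [← map_exchange hP, map_mul, hg k₀ i (hS k₀ hk₀) (hS i hi)]

end

theorem IsRotation.face_eq_of_mem {φ : FaceSeq P n} {g : ℕ → ℕ → P ≃o P}
    (hg : IsRotation φ g) {a : ℕ} {z : P ≃o P}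
    (hz : z ∈ rotationSubgroup g {k | k < n ∧ k ≠ a}) :
    z (φ.face (a + 1)) = φ.face (a + 1) := by
  induction hz using Subgroup.closure_induction with
  | mem z hz =>
    obtain ⟨i, hi, j, hj, rfl⟩ := hz
    rw [← map_face, hg i j hi.1 hj.1, exchange_face _ _ (by have := hj.2; omega),
      exchange_face _ _ (by have := hi.2; omega)]
  | one => rfl
  | mul z w _ _ hz hw =>
    change z (w _) = _
    rw [hw, hz]
  | inv z _ hz =>
    change z.symm _ = _
    rw [OrderIso.symm_apply_eq, hz]

/-- The flag reached is the image, under the subgroup, of `φ` or of an adjacent flag. Chirality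
excludes the latter, and an automorphism is determined by the image of `φ`. -/
theorem IsRotation.mem_of_face_eq (hC : IsChiralPolytope P n) {φ : FaceSeq P n}
    {g : ℕ → ℕ → P ≃o P} (hg : IsRotation φ g) {S : Set ℕ} (hS : ∀ k ∈ S, k < n) {k₀ : ℕ}
    (hk₀ : k₀ ∈ S) {z : P ≃o P} (h : Conn {k | ∃ i ∈ S, k = i + 1} φ (map z φ)) :
    z ∈ rotationSubgroup g S := by
  have hP := hC.toIsAbstractPolytope
  obtain ⟨w, hw, h | h⟩ := hg.exists_mem_of_conn hP hS hk₀ h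
  · rwa [map_injective hP h]
  · refine absurd ?_ (map_ne_exchange hC (w⁻¹ * z) φ (i := k₀ + 1) (by omega) (hS k₀ hk₀))
    rw [map_mul, h, map_inv_map]

/-- An automorphism of the automorphism group that inverts `g 0 i` for all `i` would map the base
flag to an adjacent one. -/
theorem IsRotation.exists_ne_one (hC : IsChiralPolytope P n) (hn : 0 < n) {φ : FaceSeq P n}
    {g : ℕ → ℕ → P ≃o P} (hg : IsRotation φ g) (Δ : Subgroup ((P ≃o P) × (P ≃o P)))
    (hΔ : ∀ i < n, (g 0 i, g i 0) ∈ Δ) : ∃ z, (1, z) ∈ Δ ∧ z ≠ 1 := by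
  have hP := hC.toIsAbstractPolytope
  obtain ⟨rk, hrk⟩ := hP.exists_rank
  by_contra! hker
  set Δ₀ : Subgroup ((P ≃o P) × (P ≃o P)) :=
    Subgroup.closure {x | ∃ i < n, x = (g 0 i, g i 0)} with hΔ₀
  have hle : Δ₀ ≤ Δ := by
    rw [hΔ₀, Subgroup.closure_le]
    rintro _ ⟨i, hi, rfl⟩
    exact hΔ i hi
  have hgen : ∀ i < n, (g 0 i, g i 0) ∈ Δ₀ := fun i hi => Subgroup.subset_closure ⟨i, hi, rfl⟩
  have hone : ∀ i < n, g i i = 1 := fun i hi => by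
    have := hg.mul hP hi hi hi
    rwa [mul_eq_left] at this
  have hginv : ∀ i < n, ∀ j < n, (g i j)⁻¹ = g j i := fun i hi j hj => by
    rw [inv_eq_iff_mul_eq_one, hg.mul hP hi hj hi, hone i hi]
  have hgen' : ∀ i < n, (g i 0, g 0 i) ∈ Δ₀ := fun i hi => by
    have := inv_mem (hgen i hi)
    rwa [Prod.inv_mk, hginv 0 hn i hi, hginv i hi 0 hn] at this
  -- This symmetry makes the map of faces constructed below its own inverse.
  have hswap : ∀ x ∈ Δ₀, x.swap ∈ Δ₀ := by
    intro x hx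
    induction hx using Subgroup.closure_induction with
    | mem x hx =>
      obtain ⟨i, hi, rfl⟩ := hx
      exact hgen' i hi
    | one => exact one_mem _
    | mul x y _ _ hx hy => exact mul_mem hx hy
    | inv x _ hx => exact inv_mem hx
  have hfun : ∀ z w w', (z, w) ∈ Δ₀ → (z, w') ∈ Δ₀ → w = w' := by
    intro z w w' h h'
    have := hker (w⁻¹ * w') (hle (by simpa using mul_mem (inv_mem h) h'))
    exact (inv_mul_eq_one.1 this)
  -- the correspondence of flags induced by the correspondence of group elements
  let R : FaceSeq P n → FaceSeq P n → Prop := fun χ χ' => ∃ z z', (z, z') ∈ Δ₀ ∧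
    ((χ = map z φ ∧ χ' = map z' (exchange 1 φ)) ∨ (χ = map z (exchange 1 φ) ∧ χ' = map z' φ))
  have hRsymm : ∀ χ χ', R χ χ' → R χ' χ := by
    rintro χ χ' ⟨z, z', h, ⟨h1, h2⟩ | ⟨h1, h2⟩⟩
    · exact ⟨z', z, hswap _ h, Or.inr ⟨h2, h1⟩⟩
    · exact ⟨z', z, hswap _ h, Or.inl ⟨h2, h1⟩⟩
  have hne : ∀ z w : P ≃o P, map z φ ≠ map w (exchange 1 φ) := by
    intro z w h
    refine map_ne_exchange hC (w⁻¹ * z) φ (i := 1) le_rfl (by omega) ?_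
    rw [map_mul, h, map_inv_map]
  have hRfun : ∀ χ χ₁ χ₂, R χ χ₁ → R χ χ₂ → χ₁ = χ₂ := by
    rintro χ χ₁ χ₂ ⟨z, z', h, ⟨h1, h2⟩ | ⟨h1, h2⟩⟩ ⟨w, w', k, ⟨k1, k2⟩ | ⟨k1, k2⟩⟩
    · have e : z = w := map_injective hP (h1.symm.trans k1)
      subst e
      rw [h2, k2, hfun _ _ _ h k]
    · exact absurd (h1.symm.trans k1) (hne z w)
    · exact absurd (k1.symm.trans h1) (hne w z)
    · have e : z = w := map_injective hP (h1.symm.trans k1)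
      subst e
      rw [h2, k2, hfun _ _ _ h k]
  have hRex : ∀ χ χ' i, R χ χ' → R (exchange i χ) (exchange i χ') := by
    rintro χ χ' i ⟨z, z', h, hcase⟩
    by_cases hi : 1 ≤ i ∧ i ≤ n
    swap
    · rw [exchange_of_notMem _ hi, exchange_of_notMem _ hi]
      exact ⟨z, z', h, hcase⟩
    obtain ⟨j, rfl⟩ : ∃ j, i = j + 1 := ⟨i - 1, by omega⟩
    have hj : j < n := by omega
    have e1 := hg.map_exchange_left hP hj hn
    have e2 := hg 0 j hn hj
    rcases hcase with ⟨rfl, rfl⟩ | ⟨rfl, rfl⟩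
    · refine ⟨z * g j 0, z' * g 0 j, mul_mem h (hgen' j hj), Or.inr ⟨?_, ?_⟩⟩
      · rw [← map_exchange hP, e1, map_mul]
      · rw [← map_exchange hP, map_mul, e2]
    · refine ⟨z * g 0 j, z' * g j 0, mul_mem h (hgen j hj), Or.inl ⟨?_, ?_⟩⟩
      · rw [← map_exchange hP, map_mul, e2]
      · rw [← map_exchange hP, e1, map_mul]
  have hRbase : R φ (exchange 1 φ) := ⟨1, 1, one_mem _, Or.inl ⟨rfl, rfl⟩⟩
  have hRconn : ∀ (S : Set ℕ) (χ ψ χ' : FaceSeq P n), Conn S χ ψ → R χ χ' →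
      ∃ ψ', R ψ ψ' ∧ Conn S χ' ψ' := by
    intro S χ ψ χ' hc hR
    induction hc with
    | refl => exact ⟨χ', hR, Conn.refl _ _⟩
    | tail _ hstep ih =>
      obtain ⟨i, hi, rfl⟩ := hstep
      obtain ⟨ψ', h1, h2⟩ := ih
      exact ⟨exchange i ψ', hRex _ _ i h1, h2.trans (Conn.single hi _)⟩
  have hRtot : ∀ χ, ∃ χ', R χ χ' := fun χ => by
    obtain ⟨ψ', h, -⟩ := hRconn _ φ χ _ (conn_univ hP φ χ) hRbase
    exact ⟨ψ', h⟩
  choose Ψ hΨ using hRtot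
  choose F hF _ using fun x : P => exists_face_face (n := n) hrk (le_refl x)
  let e : P → P := fun x => (Ψ (F x)).face (rk x)
  -- The flag chosen through a face does not matter: flags sharing the face of index `k` are joined
  -- by exchanges avoiding `k`, and the same exchanges applied to the corresponding flags keep their
  -- face of index `k`.
  have he : ∀ χ χ' k, k ≤ n + 1 → R χ χ' → e (χ.face k) = χ'.face k := by
    intro χ χ' k hk hR
    have hr := χ.rank_face hrk hk
    have hface := hF (χ.face k)
    rw [hr] at hface
    have hc := conn_compl_pair hP le_rfl hk hface hface
    obtain ⟨ψ', h1, h2⟩ := hRconn _ _ _ _ hc hR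
    change (Ψ _).face (rk _) = _
    rw [hr, hRfun _ _ _ (hΨ (F (χ.face k))) h1]
    exact h2.face_eq fun h => h.1 rfl
  have hinv : ∀ x, e (e x) = x := by
    intro x
    have h1 := he _ _ (rk x) (hrk.le_top x) (hΨ (F x))
    have h2 := he _ _ (rk x) (hrk.le_top x) (hRsymm _ _ (hΨ (F x)))
    rw [hF x] at h1 h2
    rw [h1, h2]
  have hmono : Monotone e := by
    intro x y hxy
    obtain ⟨χ, hx, hy⟩ := exists_face_face (n := n) hrk hxy
    have h1 := he _ _ (rk x) (hrk.le_top x) (hΨ χ)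
    have h2 := he _ _ (rk y) (hrk.le_top y) (hΨ χ)
    rw [hx] at h1
    rw [hy] at h2
    rw [h1, h2]
    exact (Ψ χ).face_le (hrk.mono hxy)
  let e' : P ≃o P :=
    { toFun := e
      invFun := e
      left_inv := hinv
      right_inv := hinv
      map_rel_iff' := by
        intro x y
        refine ⟨fun h => ?_, fun h => hmono h⟩
        exact (hinv x).symm.le.trans ((hmono h).trans (hinv y).le) }
  refine map_ne_exchange hC e' φ (i := 1) le_rfl (by omega) (ext_of_le fun k _ hk => ?_)
  exact he _ _ k (by omega) hRbase

end FaceSeq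

open FaceSeq in
/-- The automorphism group of a chiral polytope has a rotation system. -/
theorem IsChiralPolytope.exists_rotationSystem {P : Type*} [PartialOrder P] [BoundedOrder P]
    {n : ℕ} (hn : 3 ≤ n) (hC : IsChiralPolytope P n) :
    ∃ g : ℕ → ℕ → P ≃o P, IsRotationSystem n g := by
  have hP := hC.toIsAbstractPolytope
  obtain ⟨rk, hrk⟩ := hP.exists_rank
  obtain ⟨φ⟩ := FaceSeq.nonempty (P := P) hrk
  have hex : ∀ i j, ∃ e : P ≃o P, i < n → j < n →
      map e φ = exchange (j + 1) (exchange (i + 1) φ) := by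
    intro i j
    by_cases h : i < n ∧ j < n
    · obtain ⟨e, he⟩ := exists_map_eq hC φ (i := i + 1) (j := j + 1) (by omega) (by omega)
        (by omega) (by omega)
      exact ⟨e, fun _ _ => he⟩
    · exact ⟨1, fun h1 h2 => absurd ⟨h1, h2⟩ h⟩
  choose g hg using hex
  have hg : IsRotation φ g := hg
  refine ⟨g, fun i j k hi hj hk => hg.mul hP hi hj hk, ?_, ?_, ?_, ?_,
    hg.exists_ne_one hC (by omega)⟩
  · intro i j hij hj
    apply map_injective hP (φ := φ)
    rw [hg i j (by omega) hj, hg j i hj (by omega),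
      exchange_comm hP (i := i + 1) (j := j + 1) (by omega)]
  · intro i j k l hi hj hk hl hij hik hil h
    have h1 : (map (g i j) φ).face (i + 1) = (map (g k l) φ).face (i + 1) := by rw [h]
    rw [hg i j hi hj, hg k l hk hl, exchange_face (j + 1) _ (by omega),
      exchange_face (l + 1) _ (by omega), exchange_face (k + 1) _ (by omega)] at h1
    exact exchange_face_ne hP φ (by omega) (by omega) h1
  · intro i hi h
    have hbase : exchange (i + 1) (exchange (i + 1 + 1) φ) =
        exchange (i + 1 + 1) (exchange (i + 1) φ) := by
      rw [← hg i (i + 1) (by omega) hi, ← hg (i + 1) i hi (by omega), h]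
    -- Every flag is an image of `φ` or of a flag adjacent to it, so exchanges that commute at `φ`
    -- commute everywhere.
    refine exchange_not_comm hC (m := i + 1) (by omega) (by omega) fun χ => ?_
    have hc := (conn_univ hP φ χ).mono (T := {k | ∃ i ∈ Set.Iio n, k = i + 1}) fun k hk =>
      ⟨k - 1, by have := Set.mem_Icc.1 hk; exact Set.mem_Iio.2 (by omega),
        by have := Set.mem_Icc.1 hk; omega⟩
    obtain ⟨z, -, rfl | rfl⟩ := hg.exists_mem_of_conn hP (fun k hk => Set.mem_Iio.1 hk)
      (k₀ := i) (Set.mem_Iio.2 (by omega)) hc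
    · simp only [← map_exchange hP, hbase]
    · simp only [← map_exchange hP]
      rw [exchange_exchange hP, ← hbase, exchange_exchange hP]
  · intro a b hab hb z ha hb'
    obtain ⟨k₀, hk₀⟩ : ∃ k₀, k₀ < n ∧ k₀ ≠ a ∧ k₀ ≠ b := by
      by_cases h0 : 0 ≠ a ∧ 0 ≠ b
      · exact ⟨0, by omega, h0⟩
      by_cases h1 : 1 ≠ a ∧ 1 ≠ b
      · exact ⟨1, by omega, h1⟩
      exact ⟨2, by omega, by omega, by omega⟩
    refine hg.mem_of_face_eq hC (fun k hk => hk.1) (k₀ := k₀) hk₀ ?_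
    have hc := conn_compl_pair hP (a := a + 1) (b := b + 1) (by omega) (by omega)
      (φ := φ) (ψ := map z φ) (hg.face_eq_of_mem ha) (hg.face_eq_of_mem hb')
    have hin : Conn {k | ∃ i ∈ {k | k < n ∧ k ≠ a ∧ k ≠ b}, k = i + 1} φ (map z φ) := by
      generalize map z φ = ψ at hc
      induction hc with
      | refl => exact Conn.refl _ _
      | @tail χ χ' _ hstep ih =>
        obtain ⟨i, hi, rfl⟩ := hstep
        by_cases hin : 1 ≤ i ∧ i ≤ n
        · have hmem : i ∈ {k | ∃ i ∈ {k | k < n ∧ k ≠ a ∧ k ≠ b}, k = i + 1} :=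
            ⟨i - 1, ⟨by omega, by have := hi.1; omega, by have := hi.2; omega⟩, by omega⟩
          exact ih.trans (Conn.single hmem _)
        · rwa [exchange_of_notMem _ hin]
    exact hin

/-! ### Involutions of `PSL(3, F)` as mirrors -/

section Mirrors

open Matrix

variable {F : Type*} [Field F]

/-- The entries of the adjugate are the `2 × 2` minors up to sign, so the matrix has rank at most
one. -/
theorem minor_eq_zero_of_adjugate_eq_zero {B : Matrix (Fin 3) (Fin 3) F} (h : B.adjugate = 0)
    (i j k l : Fin 3) : B i j * B k l = B i l * B k j := by
  rw [adjugate_fin_three] at h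
  have e := fun i j => congrFun (congrFun h i) j
  have e00 := e 0 0
  have e01 := e 0 1
  have e02 := e 0 2
  have e10 := e 1 0
  have e11 := e 1 1
  have e12 := e 1 2
  have e20 := e 2 0
  have e21 := e 2 1
  have e22 := e 2 2
  simp at e00 e01 e02 e10 e11 e12 e20 e21 e22
  have row01 : B 0 j * B 1 l = B 0 l * B 1 j := by
    fin_cases j <;> fin_cases l <;>
      first
      | rfl
      | (simp only [Fin.mk_one, Fin.reduceFinMk, Fin.zero_eta]
         first
         | linear_combination e02
         | linear_combination -e02
         | linear_combination e12
         | linear_combination -e12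
         | linear_combination e22
         | linear_combination -e22)
  have row02 : B 0 j * B 2 l = B 0 l * B 2 j := by
    fin_cases j <;> fin_cases l <;>
      first
      | rfl
      | (simp only [Fin.mk_one, Fin.reduceFinMk, Fin.zero_eta]
         first
         | linear_combination e01
         | linear_combination -e01
         | linear_combination e11
         | linear_combination -e11
         | linear_combination e21
         | linear_combination -e21)
  have row12 : B 1 j * B 2 l = B 1 l * B 2 j := by
    fin_cases j <;> fin_cases l <;>
      first
      | rfl
      | (simp only [Fin.mk_one, Fin.reduceFinMk, Fin.zero_eta]
         first
         | linear_combination e00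
         | linear_combination -e00
         | linear_combination e10
         | linear_combination -e10
         | linear_combination e20
         | linear_combination -e20)
  fin_cases i <;> fin_cases k
  · exact mul_comm _ _
  · exact row01
  · exact row02
  · exact (mul_comm _ _).trans (row01.symm.trans (mul_comm _ _))
  · exact mul_comm _ _
  · exact row12
  · exact (mul_comm _ _).trans (row02.symm.trans (mul_comm _ _))
  · exact (mul_comm _ _).trans (row12.symm.trans (mul_comm _ _))
  · exact mul_comm _ _

theorem exists_eq_vecMulVec {B : Matrix (Fin 3) (Fin 3) F} (hB : B ≠ 0) (h : B.adjugate = 0) :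
    ∃ v f : Fin 3 → F, v ≠ 0 ∧ f ≠ 0 ∧ B = vecMulVec v f := by
  obtain ⟨p, q, hpq⟩ : ∃ p q, B p q ≠ 0 := by
    by_contra! hc
    exact hB (Matrix.ext hc)
  refine ⟨fun i => B i q, fun j => B p j / B p q, fun hv => hpq (congrFun hv p), fun hf => ?_, ?_⟩
  · have := congrFun hf q
    simp [hpq] at this
  · ext i j
    rw [vecMulVec_apply]
    have := minor_eq_zero_of_adjugate_eq_zero h i j p q
    field_simp
    linear_combination this

/-- In any characteristic, a nontrivial involution of `SL(3, F)` is the negative of a reflection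
(or a transvection). -/
theorem exists_mirror_of_involution {A : Matrix (Fin 3) (Fin 3) F} (hdet : A.det = 1)
    (h2 : A * A = 1) (h1 : A ≠ 1) :
    ∃ v f : Fin 3 → F, v ≠ 0 ∧ f ≠ 0 ∧ f ⬝ᵥ v = 2 ∧ A = vecMulVec v f - 1 := by
  have hadj : A.adjugate = A := by
    have h3 := congrArg (A * ·) (A.mul_adjugate)
    simp only [hdet, one_smul, mul_one, ← mul_assoc, h2, one_mul] at h3
    exact h3
  -- In dimension three `adj (1 + A) = 1 + tr A - A + adj A`, and here `adj A = A⁻¹ = A`. Since `1 +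
  -- A` is singular but nonzero, the scalar `1 + tr A` must vanish, and `1 + A` has rank one.
  have hadj' : (1 + A).adjugate = (1 + A.trace) • (1 : Matrix (Fin 3) (Fin 3) F) := by
    have h4 := hadj
    rw [adjugate_fin_three] at h4
    have e := fun i j => congrFun (congrFun h4 i) j
    rw [adjugate_fin_three, trace_fin_three]
    ext i j
    have := e i j
    fin_cases i <;> fin_cases j <;> simp at this ⊢ <;> linear_combination this
  have hmul : (1 + A) * (1 - A) = 0 := by
    rw [add_mul, mul_sub, mul_sub, h2]
    simp
  have hne : (1 : Matrix (Fin 3) (Fin 3) F) - A ≠ 0 := fun h => h1 (sub_eq_zero.1 h).symm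
  have hd : (1 + A).det = 0 := by
    have h5 := congrArg ((1 + A).adjugate * ·) hmul
    simp only [← mul_assoc, adjugate_mul, mul_zero, smul_mul, one_mul] at h5
    exact (smul_eq_zero.1 h5).resolve_right hne
  have hB : 1 + A ≠ 0 := by
    intro h
    have hA : A = -1 := eq_neg_of_add_eq_zero_right h
    apply h1
    rw [hA] at hdet ⊢
    rw [det_neg, det_one] at hdet
    simp at hdet
    have hp : (1 : F) = -1 := by linear_combination (-1 : F) * hdet
    ext i j
    rw [neg_apply]
    by_cases hij : i = j
    · subst hij
      rw [one_apply_eq]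
      exact hp.symm
    · rw [one_apply_ne hij, neg_zero]
  have ht : 1 + A.trace = 0 := by
    have h6 := (1 + A).mul_adjugate
    rw [hd, hadj', zero_smul, Matrix.mul_smul, mul_one] at h6
    exact (smul_eq_zero.1 h6).resolve_right hB
  rw [ht, zero_smul] at hadj'
  obtain ⟨v, f, hv, hf, hvf⟩ := exists_eq_vecMulVec hB hadj'
  refine ⟨v, f, hv, hf, ?_, by rw [← hvf, add_sub_cancel_left]⟩
  have : (1 + A).trace = f ⬝ᵥ v := by rw [hvf, trace_vecMulVec, dotProduct_comm]
  rw [← this, trace_add, trace_one, Fintype.card_fin]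
  push_cast
  linear_combination ht

theorem mirror_mul_mirror (v f w g : Fin 3 → F) :
    (vecMulVec v f - 1) * (vecMulVec w g - 1) =
      (f ⬝ᵥ w) • vecMulVec v g - vecMulVec v f - vecMulVec w g + 1 := by
  rw [sub_mul, mul_sub, vecMulVec_mul_vecMulVec, vecMulVec_smul]
  simp only [mul_one, one_mul]
  abel

theorem mirror_mul_self {v f : Fin 3 → F} (h : f ⬝ᵥ v = 2) :
    (vecMulVec v f - 1) * (vecMulVec v f - 1) = 1 := by
  rw [mirror_mul_mirror, h]
  module

theorem mirror_comm {v f w g : Fin 3 → F} (h : f ⬝ᵥ w = 0) (h' : g ⬝ᵥ v = 0) :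
    (vecMulVec v f - 1) * (vecMulVec w g - 1) = (vecMulVec w g - 1) * (vecMulVec v f - 1) := by
  rw [mirror_mul_mirror, mirror_mul_mirror, h, h']
  module

/-- Commutation means `(f·w) v ⊗ g = (g·v) w ⊗ f`. If `f·w ≠ 0`, contraction with `g` and with `v`
gives `(f·w) g = 2 f` and `(f·w) v = 2 w`; hence `2 ≠ 0` and `v ⊗ f = w ⊗ g`. -/
theorem dotProduct_eq_zero_of_comm {v f w g : Fin 3 → F} (hv : v ≠ 0) (hg : g ≠ 0)
    (hfv : f ⬝ᵥ v = 2) (hgw : g ⬝ᵥ w = 2) (hne : vecMulVec v f ≠ vecMulVec w g)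
    (h : (vecMulVec v f - 1) * (vecMulVec w g - 1) =
      (vecMulVec w g - 1) * (vecMulVec v f - 1)) : f ⬝ᵥ w = 0 := by
  by_contra hc
  have key : ∀ i j, (f ⬝ᵥ w) * (v i * g j) = (g ⬝ᵥ v) * (w i * f j) := by
    intro i j
    rw [mirror_mul_mirror, mirror_mul_mirror] at h
    have := congrFun (congrFun h i) j
    simp only [Matrix.sub_apply, Matrix.add_apply, Matrix.smul_apply, vecMulVec_apply, smul_eq_mul]
      at this
    linear_combination this
  have hd : g ⬝ᵥ v ≠ 0 := by
    intro h0
    obtain ⟨i, hi⟩ := Function.ne_iff.1 hv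
    obtain ⟨j, hj⟩ := Function.ne_iff.1 hg
    have := key i j
    rw [h0, zero_mul] at this
    exact mul_ne_zero hc (mul_ne_zero hi hj) this
  simp only [dotProduct, Fin.sum_univ_three] at *
  have k1 : ∀ j, (f 0 * w 0 + f 1 * w 1 + f 2 * w 2) * g j = 2 * f j := by
    intro j
    apply mul_left_cancel₀ hd
    linear_combination g 0 * key 0 j + g 1 * key 1 j + g 2 * key 2 j +
      (g 0 * v 0 + g 1 * v 1 + g 2 * v 2) * f j * hgw
  have k2 : ∀ i, (f 0 * w 0 + f 1 * w 1 + f 2 * w 2) * v i = 2 * w i := by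
    intro i
    apply mul_left_cancel₀ hd
    linear_combination v 0 * key i 0 + v 1 * key i 1 + v 2 * key i 2 +
      (g 0 * v 0 + g 1 * v 1 + g 2 * v 2) * w i * hfv
  have h2 : (2 : F) ≠ 0 := by
    intro h2
    obtain ⟨i, hi⟩ := Function.ne_iff.1 hv
    have := k2 i
    rw [h2, zero_mul] at this
    exact mul_ne_zero hc hi this
  apply hne
  ext i j
  rw [vecMulVec_apply, vecMulVec_apply]
  apply mul_left_cancel₀ (mul_ne_zero hc h2)
  linear_combination 2 * f j * k2 i - 2 * w i * k1 j

/-- Vectors with a common annihilator of dimension two are proportional. -/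
theorem parallel_or_parallel {v w f g : Fin 3 → F} (hv : v ≠ 0) (hw : w ≠ 0) (hf : f ≠ 0)
    (hg : g ≠ 0) (hfv : f ⬝ᵥ v = 0) (hfw : f ⬝ᵥ w = 0) (hgv : g ⬝ᵥ v = 0) (hgw : g ⬝ᵥ w = 0) :
    (∃ c : F, c ≠ 0 ∧ w = c • v) ∨ ∃ c : F, c ≠ 0 ∧ g = c • f := by
  have par : ∀ {x y : Fin 3 → F}, x ≠ 0 → y ≠ 0 → crossProduct x y = 0 →
      ∃ c : F, c ≠ 0 ∧ y = c • x := by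
    intro x y hx hy h
    have hli : ¬ LinearIndependent F ![x, y] := fun hli =>
      (crossProduct_ne_zero_iff_linearIndependent.2 hli) h
    rw [LinearIndependent.pair_iff' hx] at hli
    push Not at hli
    obtain ⟨c, hc⟩ := hli
    exact ⟨c, by rintro rfl; exact hy (by rw [← hc, zero_smul]), hc.symm⟩
  by_cases h : crossProduct v w = 0
  · exact Or.inl (par hv hw h)
  · right
    -- Both `f` and `g` are orthogonal to the independent vectors `v`, `w`, hence multiples of their
    -- cross product.
    have hcross : ∀ x : Fin 3 → F, x ⬝ᵥ v = 0 → x ⬝ᵥ w = 0 →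
        crossProduct (crossProduct v w) x = 0 := by
      intro x h1 h2
      rw [cross_cross_eq_smul_sub_smul, dotProduct_comm v x, dotProduct_comm w x, h1, h2]
      simp
    obtain ⟨c, hc, rfl⟩ := par h hf (hcross f hfv hfw)
    obtain ⟨d, hd, rfl⟩ := par h hg (hcross g hgv hgw)
    exact ⟨d / c, div_ne_zero hd hc, by rw [smul_smul, div_mul_cancel₀ d hc]⟩

local notation "SL" => SpecialLinearGroup (Fin 3) F
local notation "PSL" => ProjectiveSpecialLinearGroup (Fin 3) F

theorem pow_three_eq_one_of_mem_center {z : SpecialLinearGroup (Fin 3) F}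
    (hz : z ∈ Subgroup.center (SpecialLinearGroup (Fin 3) F)) : z ^ 3 = 1 := by
  obtain ⟨r, hr, h⟩ := Matrix.SpecialLinearGroup.mem_center_iff.1 hz
  apply Subtype.ext
  rw [Fintype.card_fin] at hr
  rw [Matrix.SpecialLinearGroup.coe_pow, ← h, ← map_pow, hr, map_one,
    Matrix.SpecialLinearGroup.coe_one]

/-- A lift of an element of `PSL(3, F)` that is an involution if the element is one. -/
noncomputable def cubeLift (γ : PSL) : SL := γ.out ^ 3

/-- The square of a representative is central, so its cube is trivial: this is why the cube of a
representative squares to one. -/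
theorem cubeLift_mul_self {γ : PSL} (h : γ * γ = 1) : cubeLift γ * cubeLift γ = 1 := by
  have hc : γ.out ^ 2 ∈ Subgroup.center (SpecialLinearGroup (Fin 3) F) := by
    rw [← QuotientGroup.eq_one_iff, QuotientGroup.mk_pow, QuotientGroup.out_eq', pow_two, h]
  have := pow_three_eq_one_of_mem_center hc
  rw [cubeLift, ← pow_add, ← this, ← pow_mul]

theorem mk_cubeLift {γ : PSL} (h : γ * γ = 1) : (cubeLift γ : PSL) = γ := by
  rw [cubeLift, QuotientGroup.mk_pow, QuotientGroup.out_eq', pow_three, h, mul_one]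

/-- The two lifts differ by a central `z` satisfying both `z ^ 2 = 1` and `z ^ 3 = 1`. -/
theorem eq_of_mk_eq {h h' : SL} (hh : h * h = 1) (hh' : h' * h' = 1) (e : (h : PSL) = h') :
    h = h' := by
  have hz : h⁻¹ * h' ∈ Subgroup.center (SpecialLinearGroup (Fin 3) F) := QuotientGroup.eq.1 e
  have h3 := pow_three_eq_one_of_mem_center hz
  have hcomm := Subgroup.mem_center_iff.1 hz h
  have h2 : (h⁻¹ * h') ^ 2 = 1 := by
    have hz' : h' = h * (h⁻¹ * h') := by group
    have : h' * h' = h * h * (h⁻¹ * h') ^ 2 := by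
      conv_lhs => rw [hz']
      rw [pow_two, mul_assoc h, ← mul_assoc (h⁻¹ * h') h, ← hcomm]
      simp only [mul_assoc]
    rw [hh, hh', one_mul] at this
    exact this.symm
  rw [pow_succ, h2, one_mul] at h3
  exact inv_mul_eq_one.1 h3

/-- `h * h' * h⁻¹` and `h'` both square to one and have the same image, so they coincide. -/
theorem comm_of_mk_comm {h h' : SL} (hh : h * h = 1) (hh' : h' * h' = 1)
    (e : (h : PSL) * h' = h' * h) : h * h' = h' * h := by
  have hinv : h⁻¹ = h := inv_eq_of_mul_eq_one_left hh
  have hconj : h * h' * h⁻¹ = h' := by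
    refine eq_of_mk_eq ?_ hh' ?_
    · rw [show h * h' * h⁻¹ * (h * h' * h⁻¹) = h * (h' * h') * h⁻¹ by group, hh', mul_one,
        mul_inv_cancel]
    · rw [QuotientGroup.mk_mul, QuotientGroup.mk_mul, e, QuotientGroup.mk_inv, mul_assoc,
        mul_inv_cancel, mul_one]
  rwa [mul_inv_eq_iff_eq_mul] at hconj

/-- `IsMirror γ v f`: the element `γ` of `PSL(3, F)` is represented by the involution
`x ↦ f(x) v - x`. -/
structure IsMirror (γ : PSL) (v f : Fin 3 → F) : Prop where
  ne_vec : v ≠ 0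
  ne_covec : f ≠ 0
  dot : f ⬝ᵥ v = 2
  coe_lift : (cubeLift γ : Matrix (Fin 3) (Fin 3) F) = vecMulVec v f - 1
  mul_self : γ * γ = 1

theorem exists_isMirror {γ : PSL} (h : γ * γ = 1) (h1 : γ ≠ 1) : ∃ v f, IsMirror γ v f := by
  obtain ⟨v, f, hv, hf, hd, hvf⟩ := exists_mirror_of_involution (cubeLift γ).det_coe
    (congrArg (fun A : SL => (A : Matrix (Fin 3) (Fin 3) F)) (cubeLift_mul_self h))
    (fun hc => h1 (by
      rw [← mk_cubeLift h, show cubeLift γ = 1 from Subtype.ext hc]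
      rfl))
  exact ⟨v, f, hv, hf, hd, hvf, h⟩

theorem IsMirror.of_coe {h : SL} {v f : Fin 3 → F} (hv : v ≠ 0) (hf : f ≠ 0) (hd : f ⬝ᵥ v = 2)
    (hc : (h : Matrix (Fin 3) (Fin 3) F) = vecMulVec v f - 1) : IsMirror (h : PSL) v f := by
  have hh : h * h = 1 := by
    apply Subtype.ext
    rw [Matrix.SpecialLinearGroup.coe_mul, hc, mirror_mul_self hd,
      Matrix.SpecialLinearGroup.coe_one]
  have hm : (h : PSL) * h = 1 := by rw [← QuotientGroup.mk_mul, hh, QuotientGroup.mk_one]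
  have : cubeLift (h : PSL) = h := eq_of_mk_eq (cubeLift_mul_self hm) hh (mk_cubeLift hm)
  exact ⟨hv, hf, hd, by rw [this, hc], hm⟩

theorem IsMirror.comm_iff {γ δ : PSL} {v f w g : Fin 3 → F} (hγ : IsMirror γ v f)
    (hδ : IsMirror δ w g) (hne : γ ≠ δ) :
    γ * δ = δ * γ ↔ f ⬝ᵥ w = 0 ∧ g ⬝ᵥ v = 0 := by
  have e1 := mk_cubeLift hγ.mul_self
  have e2 := mk_cubeLift hδ.mul_self
  constructor
  · intro h
    have hc : cubeLift γ * cubeLift δ = cubeLift δ * cubeLift γ :=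
      comm_of_mk_comm (cubeLift_mul_self hγ.mul_self) (cubeLift_mul_self hδ.mul_self)
        (by rw [e1, e2, h])
    have hm := congrArg (fun A : SL => (A : Matrix (Fin 3) (Fin 3) F)) hc
    simp only [Matrix.SpecialLinearGroup.coe_mul, hγ.coe_lift, hδ.coe_lift] at hm
    have hne' : vecMulVec v f ≠ vecMulVec w g := by
      intro hvw
      apply hne
      rw [← e1, ← e2]
      congr 1
      apply Subtype.ext
      rw [hγ.coe_lift, hδ.coe_lift, hvw]
    exact ⟨dotProduct_eq_zero_of_comm hγ.ne_vec hδ.ne_covec hγ.dot hδ.dot hne' hm,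
      dotProduct_eq_zero_of_comm hδ.ne_vec hγ.ne_covec hδ.dot hγ.dot hne'.symm hm.symm⟩
  · rintro ⟨h1, h2⟩
    have hc : cubeLift γ * cubeLift δ = cubeLift δ * cubeLift γ := by
      apply Subtype.ext
      rw [Matrix.SpecialLinearGroup.coe_mul, Matrix.SpecialLinearGroup.coe_mul, hγ.coe_lift,
        hδ.coe_lift]
      exact mirror_comm h1 h2
    rw [← e1, ← e2, ← QuotientGroup.mk_mul, hc, QuotientGroup.mk_mul]

/-- In odd characteristic there are no four pairwise orthogonal reflections in dimension three. -/
theorem not_four_orthogonal (h2 : (2 : F) ≠ 0) (v f : Fin 4 → Fin 3 → F)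
    (hd : ∀ i, f i ⬝ᵥ v i = 2) (ho : ∀ i j, i ≠ j → f i ⬝ᵥ v j = 0) : False := by
  have hli : LinearIndependent F v := by
    rw [Fintype.linearIndependent_iff]
    intro c hc i
    have := congrArg (fun x => f i ⬝ᵥ x) hc
    simp only [dotProduct_sum, dotProduct_smul, dotProduct_zero, smul_eq_mul] at this
    rw [Finset.sum_eq_single i (fun j _ hj => by rw [ho i j hj.symm, mul_zero])
      (fun hi => absurd (Finset.mem_univ i) hi), hd] at this
    exact (mul_eq_zero.1 this).resolve_right h2
  have := hli.fintype_card_le_finrank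
  simp at this

end Mirrors

/-! ### Formal consequences of the axioms -/

namespace IsRotationSystem

variable {Γ : Type*} [Group Γ] {n : ℕ} {g : ℕ → ℕ → Γ}

theorem map {G : Type*} [Group G] (h : IsRotationSystem n g) (ι : Γ →* G)
    (hι : Function.Injective ι) : IsRotationSystem n fun i j => ι (g i j) := by
  have hsub : ∀ S, rotationSubgroup (fun i j => ι (g i j)) S = (rotationSubgroup g S).map ι := by
    intro S
    rw [rotationSubgroup, rotationSubgroup, MonoidHom.map_closure]
    congr 1
    ext x
    constructor
    · rintro ⟨i, hi, j, hj, rfl⟩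
      exact ⟨_, ⟨i, hi, j, hj, rfl⟩, rfl⟩
    · rintro ⟨_, ⟨i, hi, j, hj, rfl⟩, rfl⟩
      exact ⟨i, hi, j, hj, rfl⟩
  refine ⟨fun i j k hi hj hk => ?_, fun i j hij hj => congrArg ι (h.symm i j hij hj),
    fun i j k l hi hj hk hl h1 h2 h3 e => h.sep i j k l hi hj hk hl h1 h2 h3 (hι e),
    fun i hi e => h.nondeg i hi (hι e), ?_, ?_⟩
  · rw [← map_mul, h.mul i j k hi hj hk]
  · intro a b hab hb z hz hz'
    rw [hsub] at hz hz' ⊢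
    obtain ⟨x, hx, rfl⟩ := hz
    obtain ⟨y, hy, hyx⟩ := hz'
    rw [hι hyx] at hy
    exact ⟨x, h.inter a b hab hb x hx hy, rfl⟩
  · intro Δ hΔ
    obtain ⟨z, hz, hz1⟩ := h.chiral (Δ.comap (ι.prodMap ι)) fun i hi => hΔ i hi
    refine ⟨ι z, ?_, fun e => hz1 (hι (e.trans (map_one ι).symm))⟩
    have := Subgroup.mem_comap.1 hz
    simpa using this

theorem self (h : IsRotationSystem n g) {i : ℕ} (hi : i < n) : g i i = 1 := by
  have := h.mul i i i hi hi hi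
  rwa [mul_eq_left] at this

theorem inv (h : IsRotationSystem n g) {i j : ℕ} (hi : i < n) (hj : j < n) :
    (g i j)⁻¹ = g j i := by
  rw [inv_eq_iff_mul_eq_one, h.mul i j i hi hj hi, h.self hi]

theorem symm' (h : IsRotationSystem n g) {i j : ℕ} (hi : i < n) (hj : j < n)
    (hij : i + 2 ≤ j ∨ j + 2 ≤ i) : g i j = g j i := by
  rcases hij with hij | hij
  · exact h.symm i j hij hj
  · exact (h.symm j i hij hi).symm

theorem mul_self (h : IsRotationSystem n g) {i j : ℕ} (hi : i < n) (hj : j < n)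
    (hij : i + 2 ≤ j ∨ j + 2 ≤ i) : g i j * g i j = 1 := by
  conv_lhs => rw [h.symm' hi hj hij, h.symm' hj hi hij.symm]
  nth_rw 2 [h.symm' hi hj hij]
  rw [h.mul i j i hi hj hi, h.self hi]

theorem ne_one (h : IsRotationSystem n g) {i j : ℕ} (hi : i < n) (hj : j < n) (hij : i ≠ j) :
    g i j ≠ 1 := by
  rw [← h.self hj]
  exact h.sep i j j j hi hj hj hj hij hij hij

/-- In terms of `g i j = s_i s_j`, this says that the distant `s_m` and `s_i` commute. For indices
far from `m`, the elements `g m i` therefore commute or not just as the `s_i` do, and can stand in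
for these exchanges inside the group. -/
theorem star_mul (h : IsRotationSystem n g) {m i j : ℕ} (hm : m < n) (hi : i < n) (hj : j < n)
    (hmi : m + 2 ≤ i ∨ i + 2 ≤ m) : g m i * g m j = g i j := by
  rw [h.symm' hm hi hmi, h.mul i m j hi hm hj]

theorem star_comm (h : IsRotationSystem n g) {m i j : ℕ} (hm : m < n) (hi : i < n) (hj : j < n)
    (hmi : m + 2 ≤ i ∨ i + 2 ≤ m) (hmj : m + 2 ≤ j ∨ j + 2 ≤ m) (hij : i + 2 ≤ j ∨ j + 2 ≤ i) :
    g m i * g m j = g m j * g m i := by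
  rw [h.star_mul hm hi hj hmi, h.star_mul hm hj hi hmj, h.symm' hi hj hij]

theorem star_not_comm (h : IsRotationSystem n g) {m i : ℕ} (hm : m < n) (hi : i + 1 < n)
    (hmi : m + 2 ≤ i ∨ i + 3 ≤ m) : g m i * g m (i + 1) ≠ g m (i + 1) * g m i := by
  rw [h.star_mul hm (by omega) hi (by omega), h.star_mul hm hi (by omega) (by omega)]
  exact h.nondeg i hi

theorem star_ne (h : IsRotationSystem n g) {m i j : ℕ} (hm : m < n) (hi : i < n) (hj : j < n)
    (hmi : m + 2 ≤ i ∨ i + 2 ≤ m) (hij : i ≠ j) : g m i ≠ g m j := by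
  rw [h.symm' hm hi hmi]
  exact h.sep i m m j hi hm hm hj (by omega) (by omega) hij

end IsRotationSystem

/-! ### Paths of transvections; rank at least seven -/

section CharTwo

open Matrix

variable {F : Type*} [Field F]

/-- Two nonzero vectors are proportional. -/
def Proportional (v w : Fin 3 → F) : Prop := ∃ c : F, c ≠ 0 ∧ w = c • v

theorem Proportional.symm {v w : Fin 3 → F} (h : Proportional v w) : Proportional w v := by
  obtain ⟨c, hc, rfl⟩ := h
  exact ⟨c⁻¹, inv_ne_zero hc, by rw [smul_smul, inv_mul_cancel₀ hc, one_smul]⟩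

theorem Proportional.trans {u v w : Fin 3 → F} (h : Proportional u v) (h' : Proportional v w) :
    Proportional u w := by
  obtain ⟨c, hc, rfl⟩ := h
  obtain ⟨d, hd, rfl⟩ := h'
  exact ⟨d * c, mul_ne_zero hd hc, by rw [smul_smul]⟩

theorem Proportional.dot_eq_zero {v w f : Fin 3 → F} (h : Proportional v w) (hf : f ⬝ᵥ v = 0) :
    f ⬝ᵥ w = 0 := by
  obtain ⟨c, _, rfl⟩ := h
  rw [dotProduct_smul, hf, smul_zero]

theorem Proportional.dot_eq_zero' {f g v : Fin 3 → F} (h : Proportional f g) (hf : f ⬝ᵥ v = 0) :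
    g ⬝ᵥ v = 0 := by
  rw [dotProduct_comm] at hf ⊢
  exact h.dot_eq_zero hf

/-- For transvections indexed by `0, 1, 2, 3` that commute as the nodes of a path do, the centres
and axes alternate in one of two ways. -/
theorem proportional_of_path {v f : ℕ → Fin 3 → F} (hv : ∀ i, v i ≠ 0) (hf : ∀ i, f i ≠ 0)
    (hd : ∀ i, f i ⬝ᵥ v i = 0)
    (h02 : f 0 ⬝ᵥ v 2 = 0 ∧ f 2 ⬝ᵥ v 0 = 0) (h03 : f 0 ⬝ᵥ v 3 = 0 ∧ f 3 ⬝ᵥ v 0 = 0)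
    (h13 : f 1 ⬝ᵥ v 3 = 0 ∧ f 3 ⬝ᵥ v 1 = 0) (h01 : ¬ (f 0 ⬝ᵥ v 1 = 0 ∧ f 1 ⬝ᵥ v 0 = 0))
    (h23 : ¬ (f 2 ⬝ᵥ v 3 = 0 ∧ f 3 ⬝ᵥ v 2 = 0)) :
    (Proportional (v 0) (v 2) ∧ Proportional (f 0) (f 3) ∧ Proportional (v 1) (v 3)) ∨
    (Proportional (f 0) (f 2) ∧ Proportional (v 0) (v 3) ∧ Proportional (f 1) (f 3)) := by
  have key : ∀ i j, f i ⬝ᵥ v j = 0 ∧ f j ⬝ᵥ v i = 0 →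
      Proportional (v i) (v j) ∨ Proportional (f i) (f j) := fun i j h =>
    parallel_or_parallel (hv i) (hv j) (hf i) (hf j) (hd i) h.1 h.2 (hd j)
  have hC : ∀ i j, Proportional (v i) (v j) → f i ⬝ᵥ v j = 0 ∧ f j ⬝ᵥ v i = 0 := fun i j h =>
    ⟨h.dot_eq_zero (hd i), h.symm.dot_eq_zero (hd j)⟩
  have hA : ∀ i j, Proportional (f i) (f j) → f i ⬝ᵥ v j = 0 ∧ f j ⬝ᵥ v i = 0 := fun i j h =>
    ⟨h.symm.dot_eq_zero' (hd j), h.dot_eq_zero' (hd i)⟩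
  rcases key 0 2 h02 with c02 | a02
  · have a03 : Proportional (f 0) (f 3) :=
      (key 0 3 h03).resolve_left fun c03 => h23 (hC 2 3 (c02.symm.trans c03))
    have c13 : Proportional (v 1) (v 3) :=
      (key 1 3 h13).resolve_right fun a13 => h01 (hA 0 1 (a03.trans a13.symm))
    exact Or.inl ⟨c02, a03, c13⟩
  · have c03 : Proportional (v 0) (v 3) :=
      (key 0 3 h03).resolve_right fun a03 => h23 (hA 2 3 (a02.symm.trans a03))
    have a13 : Proportional (f 1) (f 3) :=
      (key 1 3 h13).resolve_left fun c13 => h01 (hC 0 1 (c03.trans c13.symm))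
    exact Or.inr ⟨a02, c03, a13⟩

/-- In the first pattern of `proportional_of_path`, `0, 4` must share the centre and `1, 4` the
axis, since otherwise `3, 4` would commute. Then `f 0 ∥ f 3`, `v 1 ∥ v 3` and `f 1 ∥ f 4`, `v 0 ∥ v
4` make `0, 1` commute. The second pattern is dual. -/
theorem false_of_path_five {v f : ℕ → Fin 3 → F} (hv : ∀ i, v i ≠ 0) (hf : ∀ i, f i ≠ 0)
    (hd : ∀ i, f i ⬝ᵥ v i = 0)
    (hcomm : ∀ i j, i + 2 ≤ j → j ≤ 4 → f i ⬝ᵥ v j = 0 ∧ f j ⬝ᵥ v i = 0)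
    (hnot : ∀ i, i ≤ 3 → ¬ (f i ⬝ᵥ v (i + 1) = 0 ∧ f (i + 1) ⬝ᵥ v i = 0)) : False := by
  have key : ∀ i j, i + 2 ≤ j → j ≤ 4 → Proportional (v i) (v j) ∨ Proportional (f i) (f j) :=
    fun i j hij hj => by
      have h := hcomm i j hij hj
      exact parallel_or_parallel (hv i) (hv j) (hf i) (hf j) (hd i) h.1 h.2 (hd j)
  have hC : ∀ i j, Proportional (v i) (v j) → f i ⬝ᵥ v j = 0 ∧ f j ⬝ᵥ v i = 0 := fun i j h =>
    ⟨h.dot_eq_zero (hd i), h.symm.dot_eq_zero (hd j)⟩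
  have hA : ∀ i j, Proportional (f i) (f j) → f i ⬝ᵥ v j = 0 ∧ f j ⬝ᵥ v i = 0 := fun i j h =>
    ⟨h.symm.dot_eq_zero' (hd j), h.dot_eq_zero' (hd i)⟩
  rcases proportional_of_path hv hf hd (hcomm 0 2 (by omega) (by omega))
    (hcomm 0 3 (by omega) (by omega)) (hcomm 1 3 (by omega) (by omega)) (hnot 0 (by omega))
    (hnot 2 (by omega)) with ⟨c02, a03, c13⟩ | ⟨a02, c03, a13⟩
  · have c04 : Proportional (v 0) (v 4) := (key 0 4 (by omega) (by omega)).resolve_right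
      fun a04 => hnot 3 (by omega) (hA 3 4 (a03.symm.trans a04))
    have a14 : Proportional (f 1) (f 4) := (key 1 4 (by omega) (by omega)).resolve_left
      fun c14 => hnot 3 (by omega) (hC 3 4 (c13.symm.trans c14))
    exact hnot 0 (by omega) ⟨a03.symm.dot_eq_zero' (
      c13.symm.dot_eq_zero (hd 3)), a14.symm.dot_eq_zero' (c04.symm.dot_eq_zero (hd 4))⟩
  · have a04 : Proportional (f 0) (f 4) := (key 0 4 (by omega) (by omega)).resolve_left
      fun c04 => hnot 3 (by omega) (hC 3 4 (c03.symm.trans c04))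
    have c14 : Proportional (v 1) (v 4) := (key 1 4 (by omega) (by omega)).resolve_right
      fun a14 => hnot 3 (by omega) (hA 3 4 (a13.symm.trans a14))
    exact hnot 0 (by omega) ⟨c14.symm.dot_eq_zero (a04.symm.dot_eq_zero' (hd 4)),
      a13.symm.dot_eq_zero' (c03.symm.dot_eq_zero (hd 3))⟩

local notation "PSL" => ProjectiveSpecialLinearGroup (Fin 3) F

theorem IsRotationSystem.exists_mirrors {n : ℕ} {g : ℕ → ℕ → PSL} (h : IsRotationSystem n g)
    {m : ℕ} (hm : m < n) : ∃ v f : ℕ → Fin 3 → F,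
      ∀ i < n, (m + 2 ≤ i ∨ i + 2 ≤ m) → IsMirror (g m i) (v i) (f i) := by
  have : ∀ i, ∃ v f : Fin 3 → F, i < n → (m + 2 ≤ i ∨ i + 2 ≤ m) → IsMirror (g m i) v f := by
    intro i
    by_cases hi : i < n ∧ (m + 2 ≤ i ∨ i + 2 ≤ m)
    · obtain ⟨v, f, hvf⟩ := exists_isMirror (h.mul_self hm hi.1 hi.2)
        (h.ne_one hm hi.1 (by omega))
      exact ⟨v, f, fun _ _ => hvf⟩
    · exact ⟨0, 0, fun h1 h2 => absurd ⟨h1, h2⟩ hi⟩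
  choose v f hvf using this
  exact ⟨v, f, hvf⟩

theorem not_isRotationSystem_of_seven_le {n : ℕ} (hn : 7 ≤ n) (g : ℕ → ℕ → PSL) :
    ¬ IsRotationSystem n g := by
  intro h
  by_cases h2 : (2 : F) = 0
  · obtain ⟨v, f, hvf⟩ := h.exists_mirrors (m := n - 1) (by omega)
    have hm : ∀ i ≤ 4, IsMirror (g (n - 1) i) (v i) (f i) := fun i hi =>
      hvf i (by omega) (by omega)
    -- Indices are truncated at `4`, because the lemma wants sequences defined on all of `ℕ`.
    refine false_of_path_five (v := fun i => v (min i 4)) (f := fun i => f (min i 4))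
      (fun i => (hm _ (by omega)).ne_vec) (fun i => (hm _ (by omega)).ne_covec)
      (fun i => (hm _ (by omega)).dot.trans h2) (fun i j hij hj => ?_) (fun i hi hc => ?_)
    · rw [min_eq_left (by omega : i ≤ 4), min_eq_left hj]
      exact ((hm i (by omega)).comm_iff (hm j hj) (h.star_ne (by omega) (by omega) (by omega)
        (by omega) (by omega))).1 (h.star_comm (by omega) (by omega) (by omega) (by omega)
        (by omega) (by omega))
    · rw [min_eq_left (by omega : i ≤ 4), min_eq_left (by omega : i + 1 ≤ 4)] at hc
      exact h.star_not_comm (by omega) (by omega) (by omega)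
        (((hm i (by omega)).comm_iff (hm (i + 1) (by omega)) (h.star_ne (by omega) (by omega)
          (by omega) (by omega) (by omega))).2 hc)
  -- Outside characteristic two: `g 0 2`, `g 0 4`, `g 0 6` commute pairwise, hence also with the
  -- product `g 2 4` of the first two, which `sep` distinguishes from all three.
  · have hmir : ∀ i j, i < n → j < n → i + 2 ≤ j → ∃ v f : Fin 3 → F, IsMirror (g i j) v f :=
      fun i j hi hj hij => exists_isMirror (h.mul_self hi hj (by omega))
        (h.ne_one hi hj (by omega))
    obtain ⟨v, f, hvf⟩ := h.exists_mirrors (m := 0) (by omega)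
    obtain ⟨w, k, hwk⟩ := hmir 2 4 (by omega) (by omega) (by omega)
    have m2 := hvf 2 (by omega) (by omega)
    have m4 := hvf 4 (by omega) (by omega)
    have m6 := hvf 6 (by omega) (by omega)
    have e24 : g 2 4 = g 0 2 * g 0 4 :=
      (h.star_mul (by omega) (by omega) (by omega) (by omega)).symm
    have c24 := h.star_comm (m := 0) (i := 2) (j := 4) (by omega) (by omega) (by omega) (by omega)
      (by omega) (by omega)
    have c26 := h.star_comm (m := 0) (i := 2) (j := 6) (by omega) (by omega) (by omega) (by omega)
      (by omega) (by omega)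
    have c46 := h.star_comm (m := 0) (i := 4) (j := 6) (by omega) (by omega) (by omega) (by omega)
      (by omega) (by omega)
    have n24 := h.star_ne (m := 0) (i := 2) (j := 4) (by omega) (by omega) (by omega) (by omega)
      (by omega)
    have n26 := h.star_ne (m := 0) (i := 2) (j := 6) (by omega) (by omega) (by omega) (by omega)
      (by omega)
    have n46 := h.star_ne (m := 0) (i := 4) (j := 6) (by omega) (by omega) (by omega) (by omega)
      (by omega)
    have ne : ∀ j < n, j ≠ 0 → g 0 j ≠ g 2 4 := fun j hj hj0 =>
      h.sep 0 j 2 4 (by omega) hj (by omega) (by omega) (by omega) (by omega) (by omega)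
    have r24 := (m2.comm_iff m4 n24).1 c24
    have r26 := (m2.comm_iff m6 n26).1 c26
    have r46 := (m4.comm_iff m6 n46).1 c46
    have r2 := (m2.comm_iff hwk (ne 2 (by omega) (by omega))).1
      (by rw [e24, mul_assoc, ← c24])
    have r4 := (m4.comm_iff hwk (ne 4 (by omega) (by omega))).1
      (by rw [e24, ← mul_assoc, ← c24])
    have r6 := (m6.comm_iff hwk (ne 6 (by omega) (by omega))).1
      (by rw [e24, ← mul_assoc, ← c26, mul_assoc, ← c46, mul_assoc])
    refine not_four_orthogonal h2 ![v 2, v 4, v 6, w] ![f 2, f 4, f 6, k] ?_ ?_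
    · intro i
      fin_cases i
      · exact m2.dot
      · exact m4.dot
      · exact m6.dot
      · exact hwk.dot
    · intro i j hij
      fin_cases i <;> fin_cases j <;>
        first
        | exact absurd rfl hij
        | exact r24.1
        | exact r24.2
        | exact r26.1
        | exact r26.2
        | exact r46.1
        | exact r46.2
        | exact r2.1
        | exact r2.2
        | exact r4.1
        | exact r4.2
        | exact r6.1
        | exact r6.2

end CharTwo

/-! ### Rank six in characteristic two -/

section CharTwoRankSix

open Matrix

variable {F : Type*} [Field F]

local notation "SL" => SpecialLinearGroup (Fin 3) F
local notation "PSL" => ProjectiveSpecialLinearGroup (Fin 3) F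

theorem exists_smul_of_mk_comm {x y : SL} (h : (x : PSL) * y = y * x) :
    ∃ r : F, r ^ 3 = 1 ∧ (x : Matrix (Fin 3) (Fin 3) F) * (y : Matrix (Fin 3) (Fin 3) F) =
      r • ((y : Matrix (Fin 3) (Fin 3) F) * (x : Matrix (Fin 3) (Fin 3) F)) := by
  have hz : (y * x)⁻¹ * (x * y) ∈ Subgroup.center (SpecialLinearGroup (Fin 3) F) :=
    QuotientGroup.eq.1 (by rw [QuotientGroup.mk_mul, QuotientGroup.mk_mul, h])
  obtain ⟨r, hr, hz⟩ := Matrix.SpecialLinearGroup.mem_center_iff.1 hz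
  refine ⟨r, by rwa [Fintype.card_fin] at hr, ?_⟩
  have : x * y = (y * x) * ((y * x)⁻¹ * (x * y)) := by group
  have h2 := congrArg (fun A : SL => (A : Matrix (Fin 3) (Fin 3) F)) this
  simp only [Matrix.SpecialLinearGroup.coe_mul] at h2
  rw [Matrix.SpecialLinearGroup.coe_mul, Matrix.SpecialLinearGroup.coe_mul] at hz
  rw [h2, ← hz, scalar_apply, ← smul_one_eq_diagonal, Matrix.mul_smul, mul_one]

/-- The relation says that `x` is conjugate to `r • x`. -/
theorem trace_eq_mul_trace {x y : SL} {r : F}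
    (h : (x : Matrix (Fin 3) (Fin 3) F) * (y : Matrix (Fin 3) (Fin 3) F) =
      r • ((y : Matrix (Fin 3) (Fin 3) F) * (x : Matrix (Fin 3) (Fin 3) F))) :
    (x : Matrix (Fin 3) (Fin 3) F).trace = r * (x : Matrix (Fin 3) (Fin 3) F).trace := by
  have hy : (y * (y⁻¹ : SL) : Matrix (Fin 3) (Fin 3) F) = 1 := by
    rw [← Matrix.SpecialLinearGroup.coe_mul, mul_inv_cancel, Matrix.SpecialLinearGroup.coe_one]
  have hy' : ((y⁻¹ : SL) * y : Matrix (Fin 3) (Fin 3) F) = 1 := by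
    rw [← Matrix.SpecialLinearGroup.coe_mul, inv_mul_cancel, Matrix.SpecialLinearGroup.coe_one]
  conv_lhs => rw [← mul_one (x : Matrix (Fin 3) (Fin 3) F), ← hy, ← mul_assoc, h, smul_mul,
    trace_smul, trace_mul_comm, ← mul_assoc, hy', one_mul, smul_eq_mul]

/-- If the two sides were nonzero, `w` would be proportional to `a`, and `b ⬝ᵥ w` a multiple of `b
⬝ᵥ a = 0`. -/
theorem dotProduct_eq_zero_of_smul_vecMulVec {a b w k : Fin 3 → F} (ha : a ≠ 0) (hb : b ≠ 0)
    (hw : w ≠ 0) (hk : k ≠ 0) (hba : b ⬝ᵥ a = 0)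
    (h : (b ⬝ᵥ w) • vecMulVec a k = (k ⬝ᵥ a) • vecMulVec w b) : b ⬝ᵥ w = 0 ∧ k ⬝ᵥ a = 0 := by
  have key : ∀ i j, (b ⬝ᵥ w) * (a i * k j) = (k ⬝ᵥ a) * (w i * b j) := fun i j => by
    simpa [vecMulVec_apply] using congrFun (congrFun h i) j
  obtain ⟨i, hi⟩ := Function.ne_iff.1 ha
  obtain ⟨j, hj⟩ := Function.ne_iff.1 hk
  obtain ⟨i', hi'⟩ := Function.ne_iff.1 hw
  obtain ⟨j', hj'⟩ := Function.ne_iff.1 hb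
  simp only [Pi.zero_apply] at hi hj hi' hj'
  have h1 : b ⬝ᵥ w = 0 := by
    by_contra hc
    have h0 : ∀ l, (k ⬝ᵥ a) * ((b ⬝ᵥ w) * b l) = 0 := by
      intro l
      have e0 := key 0 l
      have e1 := key 1 l
      have e2 := key 2 l
      simp only [dotProduct, Fin.sum_univ_three] at *
      linear_combination (-b 0) * e0 - b 1 * e1 - b 2 * e2 +
        (b 0 * w 0 + b 1 * w 1 + b 2 * w 2) * k l * hba
    have h3 : k ⬝ᵥ a = 0 := by
      rcases mul_eq_zero.1 (h0 j') with h | h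
      · exact h
      · exact absurd h (mul_ne_zero hc hj')
    have := key i j
    rw [h3, zero_mul] at this
    exact mul_ne_zero hc (mul_ne_zero hi hj) this
  refine ⟨h1, ?_⟩
  have := key i' j'
  rw [h1, zero_mul] at this
  exact (mul_eq_zero.1 this.symm).resolve_right (mul_ne_zero hi' hj')

/-- If a product `h₀ h₄` of involutions commutes with `a ⊗ b`, where `h₀` fixes `a` and `b` up to
sign, then the mirror of `h₄` is orthogonal to `a` and `b`. -/
theorem dotProduct_eq_zero_of_comm_vecMulVec {h₀ : Matrix (Fin 3) (Fin 3) F}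
    {a b w k : Fin 3 → F} (ha : a ≠ 0) (hb : b ≠ 0)
    (hw : w ≠ 0) (hk : k ≠ 0) (hba : b ⬝ᵥ a = 0) (hh : h₀ * h₀ = 1)
    (h1 : h₀ * vecMulVec a b = -vecMulVec a b) (h2 : vecMulVec a b * h₀ = -vecMulVec a b)
    (h : h₀ * (vecMulVec w k - 1) * vecMulVec a b = vecMulVec a b * (h₀ * (vecMulVec w k - 1))) :
    b ⬝ᵥ w = 0 ∧ k ⬝ᵥ a = 0 := by
  refine dotProduct_eq_zero_of_smul_vecMulVec ha hb hw hk hba ?_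
  have h3 := congrArg (h₀ * ·) h
  simp only [← mul_assoc] at h3
  rw [hh, one_mul, h1, neg_mul, h2, neg_neg, sub_mul, mul_sub, vecMulVec_mul_vecMulVec,
    vecMulVec_mul_vecMulVec, vecMulVec_smul, vecMulVec_smul, one_mul, mul_one] at h3
  exact (sub_left_injective h3).symm

/-- The transvections `g 5 i`, `i ≤ 3`, follow one of the patterns of `proportional_of_path`. For
the lift `x` of `g 0 1`, `(x - 1) ^ 2` is then a nonzero multiple of a rank one matrix, which
commutes with the lift of `g 5 4`; moreover `g 0 2` is a transvection commuting with `g 0 4`.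
Together this makes `g 0 4` commute with `g 0 5`, against `star_not_comm`. -/
theorem not_isRotationSystem_six_of_two_eq_zero (h2 : (2 : F) = 0) (g : ℕ → ℕ → PSL) :
    ¬ IsRotationSystem 6 g := by
  intro h
  have hneg : (1 : Matrix (Fin 3) (Fin 3) F) = -1 := by
    have : ((2 : F) • (1 : Matrix (Fin 3) (Fin 3) F)) = 0 := by rw [h2, zero_smul]
    rw [two_smul] at this
    exact eq_neg_of_add_eq_zero_left this
  obtain ⟨v, f, hvf⟩ := h.exists_mirrors (m := 5) (by omega)
  have hm : ∀ i ≤ 3, IsMirror (g 5 i) (v i) (f i) := fun i hi => hvf i (by omega) (by omega)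
  have hiff : ∀ i j, i ≤ 3 → j ≤ 3 → i ≠ j →
      (g 5 i * g 5 j = g 5 j * g 5 i ↔ f i ⬝ᵥ v j = 0 ∧ f j ⬝ᵥ v i = 0) := fun i j hi hj hij =>
    (hm i hi).comm_iff (hm j hj) (h.star_ne (by omega) (by omega) (by omega) (by omega) hij)
  have hcomm : ∀ i j, i + 2 ≤ j → j ≤ 3 → f i ⬝ᵥ v j = 0 ∧ f j ⬝ᵥ v i = 0 := fun i j hij hj =>
    (hiff i j (by omega) hj (by omega)).1 (h.star_comm (by omega) (by omega) (by omega) (by omega)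
      (by omega) (by omega))
  have hnot : ∀ i ≤ 2, ¬ (f i ⬝ᵥ v (i + 1) = 0 ∧ f (i + 1) ⬝ᵥ v i = 0) := fun i hi hc =>
    h.star_not_comm (by omega) (by omega) (by omega)
      ((hiff i (i + 1) (by omega) (by omega) (by omega)).2 hc)
  have hpath := proportional_of_path (v := fun i => v (min i 3)) (f := fun i => f (min i 3))
    (fun i => (hm _ (by omega)).ne_vec) (fun i => (hm _ (by omega)).ne_covec)
    (fun i => (hm _ (by omega)).dot.trans h2) (hcomm 0 2 le_rfl (by omega))
    (hcomm 0 3 (by omega) le_rfl) (hcomm 1 3 (by omega) le_rfl) (hnot 0 (by omega))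
    (hnot 2 (by omega))
  simp only [show min 0 3 = 0 from rfl, show min 1 3 = 1 from rfl, show min 2 3 = 2 from rfl,
    show min 3 3 = 3 from rfl] at hpath
  have m0 := hm 0 (by omega)
  have m1 := hm 1 (by omega)
  have m2 := hm 2 (by omega)
  have m3 := hm 3 (by omega)
  have d0 : f 0 ⬝ᵥ v 0 = 0 := m0.dot.trans h2
  have d1 : f 1 ⬝ᵥ v 1 = 0 := m1.dot.trans h2
  have d2 : f 2 ⬝ᵥ v 2 = 0 := m2.dot.trans h2
  have d3 : f 3 ⬝ᵥ v 3 = 0 := m3.dot.trans h2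
  obtain ⟨w, k, m4⟩ := exists_isMirror (h.mul_self (i := 0) (j := 4) (by omega) (by omega)
    (by omega)) (h.ne_one (by omega) (by omega) (by omega))
  have h05 : g 5 0 = g 0 5 := h.symm' (by omega) (by omega) (by omega)
  -- `g 0 4` does not commute with `g 0 5`
  have n04 : ¬ (f 0 ⬝ᵥ w = 0 ∧ k ⬝ᵥ v 0 = 0) := by
    intro hc
    have := (m0.comm_iff m4 (by
      rw [h05]
      exact h.star_ne (by omega) (by omega) (by omega) (by omega) (by omega))).2 hc
    rw [h05] at this
    exact h.star_not_comm (m := 0) (i := 4) (by omega) (by omega) (by omega) this.symm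
  -- `g 0 2 = g 5 0 * g 5 2` commutes with `g 0 4`
  have e02 : ((cubeLift (g 5 0) * cubeLift (g 5 2) : SL) : PSL) = g 0 2 := by
    rw [QuotientGroup.mk_mul, mk_cubeLift m0.mul_self, mk_cubeLift m2.mul_self]
    exact h.star_mul (by omega) (by omega) (by omega) (by omega)
  have c02 : ((cubeLift (g 5 0) * cubeLift (g 5 2) : SL) : Matrix (Fin 3) (Fin 3) F) =
      -vecMulVec (v 0) (f 0) - vecMulVec (v 2) (f 2) - 1 := by
    rw [Matrix.SpecialLinearGroup.coe_mul, m0.coe_lift, m2.coe_lift, mirror_mul_mirror,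
      (hcomm 0 2 le_rfl (by omega)).1, zero_smul, zero_sub]
    conv_lhs => rw [hneg]
    abel
  have hu2 : ∀ a b : Fin 3 → F, a ≠ 0 ∨ b ≠ 0 → b ⬝ᵥ a = 0 →
      ((cubeLift (g 5 0) * cubeLift (g 5 2) : SL) : Matrix (Fin 3) (Fin 3) F) =
        vecMulVec a b - 1 → b ⬝ᵥ w = 0 ∧ k ⬝ᵥ a = 0 := by
    intro a b hab hba hc
    have hne : vecMulVec a b ≠ 0 := by
      intro h0
      rw [h0, zero_sub, ← hneg] at hc
      refine h.ne_one (i := 0) (j := 2) (by omega) (by omega) (by omega) ?_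
      rw [← e02, show cubeLift (g 5 0) * cubeLift (g 5 2) = 1 from Subtype.ext hc]
      rfl
    have ha : a ≠ 0 := by
      rintro rfl
      exact hne (by ext; simp [vecMulVec_apply])
    have hb : b ≠ 0 := by
      rintro rfl
      exact hne (by ext; simp [vecMulVec_apply])
    have mu := IsMirror.of_coe ha hb (hba.trans h2.symm) hc
    rw [e02] at mu
    exact (mu.comm_iff m4 (h.star_ne (by omega) (by omega) (by omega) (by omega) (by omega))).1
      (h.star_comm (by omega) (by omega) (by omega) (by omega) (by omega) (by omega))
  -- `g 0 1` commutes with `g 5 4`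
  set x : SL := cubeLift (g 5 0) * cubeLift (g 5 1) with hx
  set y : SL := cubeLift (g 5 0) * cubeLift (g 0 4) with hy
  have ex : (x : PSL) = g 0 1 := by
    rw [hx, QuotientGroup.mk_mul, mk_cubeLift m0.mul_self, mk_cubeLift m1.mul_self]
    exact h.star_mul (by omega) (by omega) (by omega) (by omega)
  have ey : (y : PSL) = g 5 4 := by
    rw [hy, QuotientGroup.mk_mul, mk_cubeLift m0.mul_self, mk_cubeLift m4.mul_self]
    exact h.mul 5 0 4 (by omega) (by omega) (by omega)
  have hxy : (x : PSL) * y = y * x := by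
    rw [ex, ey]
    have i1 : g 1 4 = g 4 1 := h.symm' (by omega) (by omega) (by omega)
    have i2 : g 0 5 = g 5 0 := h05.symm
    have a1 : g 0 1 = g 0 5 * g 5 1 := (h.mul 0 5 1 (by omega) (by omega) (by omega)).symm
    have a2 : g 5 1 = g 1 5 := h.symm' (by omega) (by omega) (by omega)
    have a3 : g 1 5 * g 5 4 = g 1 4 := h.mul 1 5 4 (by omega) (by omega) (by omega)
    have a4 : g 5 4 = g 5 0 * g 0 4 := (h.mul 5 0 4 (by omega) (by omega) (by omega)).symm
    have a5 : g 0 4 = g 4 0 := h.symm' (by omega) (by omega) (by omega)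
    have a6 : g 4 0 * g 0 1 = g 4 1 := h.mul 4 0 1 (by omega) (by omega) (by omega)
    -- Both `s_0` and `s_1` commute with `s_4` and `s_5`; the computation expresses this with even
    -- words only.
    calc g 0 1 * g 5 4 = g 0 5 * (g 1 5 * g 5 4) := by rw [a1, a2, mul_assoc]
      _ = g 5 0 * (g 0 4 * g 0 1) := by rw [a3, i2, i1, a5, a6]
      _ = g 5 4 * g 0 1 := by rw [a4, mul_assoc]
  obtain ⟨r, -, hr⟩ := exists_smul_of_mk_comm hxy
  have cx : (x : Matrix (Fin 3) (Fin 3) F) = (f 0 ⬝ᵥ v 1) • vecMulVec (v 0) (f 1) -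
      vecMulVec (v 0) (f 0) - vecMulVec (v 1) (f 1) + 1 := by
    rw [hx, Matrix.SpecialLinearGroup.coe_mul, m0.coe_lift, m1.coe_lift, mirror_mul_mirror]
  have cy : (y : Matrix (Fin 3) (Fin 3) F) =
      (vecMulVec (v 0) (f 0) - 1) * (vecMulVec w k - 1) := by
    rw [hy, Matrix.SpecialLinearGroup.coe_mul, m0.coe_lift, m4.coe_lift]
  have hprod : (f 0 ⬝ᵥ v 1) * (f 1 ⬝ᵥ v 0) = 0 := by
    rcases hpath with ⟨c02, a03, c13⟩ | ⟨a02, c03, a13⟩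
    · rw [a03.symm.dot_eq_zero' (c13.symm.dot_eq_zero d3), zero_mul]
    · rw [a13.symm.dot_eq_zero' (c03.symm.dot_eq_zero d3), mul_zero]
  -- The product of `f 0 ⬝ᵥ v 1` and `f 1 ⬝ᵥ v 0` vanishes, so `x` has trace `3 = 1`, which leaves
  -- no room for a nontrivial scalar.
  have hr1 : r = 1 := by
    have ht := trace_eq_mul_trace hr
    have htx : (x : Matrix (Fin 3) (Fin 3) F).trace = 1 := by
      rw [cx, trace_add, trace_sub, trace_sub, trace_smul, trace_vecMulVec, trace_vecMulVec,
        trace_vecMulVec, trace_one, dotProduct_comm _ (f 1), dotProduct_comm _ (f 0),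
        dotProduct_comm _ (f 1), smul_eq_mul, hprod, d0, d1, Fintype.card_fin]
      push_cast
      linear_combination h2
    rw [htx, mul_one] at ht
    exact ht.symm
  rw [hr1, one_smul] at hr
  have hN : ∀ E : Matrix (Fin 3) (Fin 3) F, ∀ c : F, c ≠ 0 →
      ((x : Matrix (Fin 3) (Fin 3) F) - 1) * ((x : Matrix (Fin 3) (Fin 3) F) - 1) = c • E →
      (y : Matrix (Fin 3) (Fin 3) F) * E = E * y := by
    intro E c hc hE
    have h1 : (y : Matrix (Fin 3) (Fin 3) F) * (x - 1) = (x - 1) * y := by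
      rw [mul_sub, sub_mul, hr, one_mul, mul_one]
    have h3 : c • ((y : Matrix (Fin 3) (Fin 3) F) * E) = c • (E * y) := by
      rw [← Matrix.mul_smul, ← smul_mul, ← hE, ← mul_assoc, h1, mul_assoc, h1, mul_assoc]
    exact smul_right_injective _ hc h3
  have hsq : (vecMulVec (v 0) (f 0) - 1) * (vecMulVec (v 0) (f 0) - 1) = 1 :=
    mirror_mul_self m0.dot
  rcases hpath with ⟨c02', a03, c13⟩ | ⟨a02, c03, a13⟩
  · have h01 : f 0 ⬝ᵥ v 1 = 0 := a03.symm.dot_eq_zero' (c13.symm.dot_eq_zero d3)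
    have h10 : f 1 ⬝ᵥ v 0 ≠ 0 := fun h10 => hnot 0 (by omega) ⟨h01, h10⟩
    have hE := hN (vecMulVec (v 1) (f 0)) (f 1 ⬝ᵥ v 0) h10 (by
      rw [cx, h01, zero_smul, zero_sub, add_sub_cancel_right]
      simp only [sub_mul, mul_sub, neg_mul, mul_neg, vecMulVec_mul_vecMulVec, vecMulVec_smul, d0,
        d1, h01, zero_smul, vecMulVec_zero]
      abel)
    rw [cy] at hE
    have r04 := dotProduct_eq_zero_of_comm_vecMulVec m1.ne_vec m0.ne_covec m4.ne_vec
      m4.ne_covec h01 hsq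
      (by rw [sub_mul, vecMulVec_mul_vecMulVec, vecMulVec_smul, h01, zero_smul, one_mul, zero_sub])
      (by rw [mul_sub, vecMulVec_mul_vecMulVec, vecMulVec_smul, d0, zero_smul, mul_one, zero_sub])
      hE
    -- `g 5 0` and `g 5 2` share their centre, so the product `g 0 2` is a transvection with the
    -- same centre and a combination of the two axes as its axis.
    obtain ⟨c, hc, hv2⟩ := c02'
    have ru := hu2 (v 0) (-(f 0 + c • f 2)) (Or.inl m0.ne_vec)
      (by
        rw [neg_dotProduct, add_dotProduct, smul_dotProduct, d0,
          (hcomm 0 2 le_rfl (by omega)).2, smul_zero, add_zero, neg_zero])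
      (by
        rw [c02]
        congr 1
        ext i j
        simp [vecMulVec_apply, hv2]
        ring)
    exact n04 ⟨r04.1, ru.2⟩
  · have h10 : f 1 ⬝ᵥ v 0 = 0 := a13.symm.dot_eq_zero' (c03.symm.dot_eq_zero d3)
    have h01 : f 0 ⬝ᵥ v 1 ≠ 0 := fun h01 => hnot 0 (by omega) ⟨h01, h10⟩
    have hE := hN (vecMulVec (v 0) (f 1)) (f 0 ⬝ᵥ v 1) h01 (by
      rw [cx, add_sub_cancel_right]
      simp only [sub_mul, mul_sub, smul_mul, Matrix.mul_smul, vecMulVec_mul_vecMulVec,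
        vecMulVec_smul,
        d0, d1, h10, zero_smul, smul_zero, vecMulVec_zero]
      abel)
    rw [cy] at hE
    have r04 := dotProduct_eq_zero_of_comm_vecMulVec m0.ne_vec m1.ne_covec m4.ne_vec
      m4.ne_covec h10 hsq
      (by rw [sub_mul, vecMulVec_mul_vecMulVec, vecMulVec_smul, d0, zero_smul, one_mul, zero_sub])
      (by rw [mul_sub, vecMulVec_mul_vecMulVec, vecMulVec_smul, h10, zero_smul, mul_one, zero_sub])
      hE
    obtain ⟨c, hc, hf2⟩ := a02
    have ru := hu2 (-(v 0 + c • v 2)) (f 0) (Or.inr m0.ne_covec)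
      (by
        rw [dotProduct_neg, dotProduct_add, dotProduct_smul, d0,
          (hcomm 0 2 le_rfl (by omega)).1, smul_zero, add_zero, neg_zero])
      (by
        rw [c02]
        congr 1
        ext i j
        simp [vecMulVec_apply, hf2]
        ring)
    exact n04 ⟨ru.1, r04.2⟩

end CharTwoRankSix

/-! ### Inverting part of a normalised abelian group -/

section TranslationGroup

open IsRotationSystem in
/-- In a rotation system of rank `6`, the elements `g 0 1` and `g 0 4` cannot both be products of
an element of the subgroup avoiding the indices `1` and `4` and an element of an abelian group
normalised by that subgroup. -/
theorem IsRotationSystem.false_of_translations {Γ : Type*} [Group Γ] {g : ℕ → ℕ → Γ}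
    (h : IsRotationSystem 6 g) (T : Subgroup Γ) (hT : ∀ s ∈ T, ∀ t ∈ T, s * t = t * s)
    (hnorm : ∀ d ∈ rotationSubgroup g {k | k < 6 ∧ k ≠ 1 ∧ k ≠ 4}, ∀ t ∈ T, d * t * d⁻¹ ∈ T)
    (hTD : ∀ t ∈ T, t ∈ rotationSubgroup g {k | k < 6 ∧ k ≠ 1 ∧ k ≠ 4} → t = 1)
    (h1 : ∃ d ∈ rotationSubgroup g {k | k < 6 ∧ k ≠ 1 ∧ k ≠ 4}, ∃ u ∈ T,
      g 0 1 = d * u ∧ d * u = u * d ∧ d * d = 1)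
    (h4 : ∃ d ∈ rotationSubgroup g {k | k < 6 ∧ k ≠ 1 ∧ k ≠ 4}, ∃ u ∈ T, g 0 4 = d * u) :
    False := by
  set D := rotationSubgroup g {k | k < 6 ∧ k ≠ 1 ∧ k ≠ 4} with hD
  have hmono : ∀ {S S' : Set ℕ}, (∀ k ∈ S, k ∈ S') → rotationSubgroup g S ≤ rotationSubgroup g S' :=
    fun hS => Subgroup.closure_mono fun _ ⟨i, hi, j, hj, e⟩ => ⟨i, hS i hi, j, hS j hj, e⟩
  have hDx : D ≤ rotationSubgroup g {k | k < 6 ∧ k ≠ 4} := hmono fun k hk => ⟨hk.1, hk.2.2⟩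
  have hDy : D ≤ rotationSubgroup g {k | k < 6 ∧ k ≠ 1} := hmono fun k hk => ⟨hk.1, hk.2.1⟩
  set X := T ⊓ rotationSubgroup g {k | k < 6 ∧ k ≠ 4} with hX
  set Y := T ⊓ rotationSubgroup g {k | k < 6 ∧ k ≠ 1} with hY
  have hXn : ∀ d ∈ D, ∀ t ∈ X, d * t * d⁻¹ ∈ X := fun d hd t ht =>
    ⟨hnorm d hd t ht.1, Subgroup.mul_mem _ (Subgroup.mul_mem _ (hDx hd) ht.2)
      (Subgroup.inv_mem _ (hDx hd))⟩
  have hYn : ∀ d ∈ D, ∀ t ∈ Y, d * t * d⁻¹ ∈ Y := fun d hd t ht =>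
    ⟨hnorm d hd t ht.1, Subgroup.mul_mem _ (Subgroup.mul_mem _ (hDy hd) ht.2)
      (Subgroup.inv_mem _ (hDy hd))⟩
  have hXn' : ∀ d ∈ D, ∀ t ∈ X, d⁻¹ * t * d ∈ X := fun d hd t ht => by
    simpa using hXn d⁻¹ (inv_mem hd) t ht
  have hYn' : ∀ d ∈ D, ∀ t ∈ Y, d⁻¹ * t * d ∈ Y := fun d hd t ht => by
    simpa using hYn d⁻¹ (inv_mem hd) t ht
  -- The pairs of the correspondence `d s t ↦ d s⁻¹ t`, which inverts `X` and fixes `D` and `Y`. It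
  -- is multiplicative because `T` is abelian and `D` normalises `X` and `Y`.
  let Δ : Subgroup (Γ × Γ) :=
    { carrier := {p | ∃ d ∈ D, ∃ s ∈ X, ∃ t ∈ Y, p = (d * s * t, d * s⁻¹ * t)}
      one_mem' := ⟨1, one_mem _, 1, one_mem _, 1, one_mem _, by
        rw [inv_one, mul_one, mul_one]
        rfl⟩
      mul_mem' := by
        rintro _ _ ⟨d, hd, s, hs, t, ht, rfl⟩ ⟨d', hd', s', hs', t', ht', rfl⟩
        refine ⟨d * d', mul_mem hd hd', d'⁻¹ * s * d' * s', mul_mem (hXn' d' hd' s hs) hs',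
          d'⁻¹ * t * d' * t', mul_mem (hYn' d' hd' t ht) ht', Prod.ext ?_ ?_⟩
        · have e := hT s' hs'.1 _ (hYn' d' hd' t ht).1
          calc d * s * t * (d' * s' * t') =
              d * d' * (d'⁻¹ * s * d') * ((d'⁻¹ * t * d') * s') * t' := by group
            _ = d * d' * (d'⁻¹ * s * d') * (s' * (d'⁻¹ * t * d')) * t' := by rw [e]
            _ = _ := by group
        · have e := hT s'⁻¹ (inv_mem hs'.1) _ (hYn' d' hd' t ht).1
          have e' := hT s'⁻¹ (inv_mem hs'.1) _ (inv_mem (hXn' d' hd' s hs).1)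
          calc d * s⁻¹ * t * (d' * s'⁻¹ * t') =
              d * d' * (d'⁻¹ * s * d')⁻¹ * ((d'⁻¹ * t * d') * s'⁻¹) * t' := by group
            _ = d * d' * ((d'⁻¹ * s * d')⁻¹ * s'⁻¹) * (d'⁻¹ * t * d') * t' := by
              rw [← e]
              group
            _ = d * d' * (s'⁻¹ * (d'⁻¹ * s * d')⁻¹) * (d'⁻¹ * t * d') * t' := by rw [e']
            _ = _ := by group
      inv_mem' := by
        rintro _ ⟨d, hd, s, hs, t, ht, rfl⟩
        refine ⟨d⁻¹, inv_mem hd, d * s⁻¹ * d⁻¹, hXn d hd _ (inv_mem hs),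
          d * t⁻¹ * d⁻¹, hYn d hd _ (inv_mem ht), Prod.ext ?_ ?_⟩
        · have e := hT s⁻¹ (inv_mem hs.1) t⁻¹ (inv_mem ht.1)
          calc (d * s * t)⁻¹ = (t⁻¹ * s⁻¹) * d⁻¹ := by group
            _ = (s⁻¹ * t⁻¹) * d⁻¹ := by rw [e]
            _ = _ := by group
        · have e := hT s hs.1 t⁻¹ (inv_mem ht.1)
          calc (d * s⁻¹ * t)⁻¹ = (t⁻¹ * s) * d⁻¹ := by group
            _ = (s * t⁻¹) * d⁻¹ := by rw [e]
            _ = _ := by group }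
  have hmem : ∀ i j, i < 6 → j < 6 → i ≠ 1 → i ≠ 4 → j ≠ 1 → j ≠ 4 → g i j ∈ D :=
    fun i j hi hj h1 h2 h3 h4 => Subgroup.subset_closure ⟨i, ⟨hi, h1, h2⟩, j, ⟨hj, h3, h4⟩, rfl⟩
  -- Every `g 0 i` is inverted: `g 0 1 = d * u` has the inverse `d * u⁻¹`, and the other nontrivial
  -- ones are involutions in `D` or `D * Y`.
  obtain ⟨z, ⟨d, hd, s, hs, t, ht, hz⟩, hz1⟩ := h.chiral Δ fun i hi => by
    by_cases hi1 : i = 1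
    · subst hi1
      obtain ⟨d, hd, u, hu, e1, e2, e3⟩ := h1
      have hux : u ∈ rotationSubgroup g {k | k < 6 ∧ k ≠ 4} := by
        have : u = d⁻¹ * g 0 1 := by rw [e1, inv_mul_cancel_left]
        rw [this]
        exact mul_mem (inv_mem (hDx hd)) (Subgroup.subset_closure
          ⟨0, ⟨by omega, by omega⟩, 1, ⟨by omega, by omega⟩, rfl⟩)
      refine ⟨d, hd, u, ⟨hu, hux⟩, 1, one_mem _, Prod.ext ?_ ?_⟩
      · rw [mul_one, e1]
      · have hd1 : d⁻¹ = d := inv_eq_of_mul_eq_one_left e3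
        change g 1 0 = d * u⁻¹ * 1
        rw [mul_one, ← h.inv (i := 0) (j := 1) (by omega) (by omega), e1, e2, mul_inv_rev, hd1]
    by_cases hi4 : i = 4
    · subst hi4
      obtain ⟨d, hd, u, hu, e1⟩ := h4
      have huy : u ∈ rotationSubgroup g {k | k < 6 ∧ k ≠ 1} := by
        have : u = d⁻¹ * g 0 4 := by rw [e1, inv_mul_cancel_left]
        rw [this]
        exact mul_mem (inv_mem (hDy hd)) (Subgroup.subset_closure
          ⟨0, ⟨by omega, by omega⟩, 4, ⟨by omega, by omega⟩, rfl⟩)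
      refine ⟨d, hd, 1, one_mem _, u, ⟨hu, huy⟩, Prod.ext ?_ ?_⟩
      · rw [mul_one, e1]
      · rw [inv_one, mul_one, ← e1]
        exact h.symm' (by omega) (by omega) (by omega)
    refine ⟨g 0 i, hmem 0 i (by omega) hi (by omega) (by omega) hi1 hi4, 1, one_mem _, 1,
      one_mem _, Prod.ext ?_ ?_⟩
    · rw [mul_one, mul_one]
    · rw [inv_one, mul_one, mul_one]
      by_cases hi0 : i = 0
      · rw [hi0]
      · exact h.symm' hi (by omega) (by omega)
  apply hz1
  have e1 : 1 = d * s * t := congrArg Prod.fst hz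
  have e2 : z = d * s⁻¹ * t := congrArg Prod.snd hz
  -- The product `s * t` lies in `T` and in `D`, so it is trivial. Then `s = t⁻¹` lies in `X` and in
  -- `Y`, hence in `D` by the intersection property, and is trivial as well.
  have hst : s * t = d⁻¹ := by
    rw [eq_inv_iff_mul_eq_one, ← mul_eq_one_comm, ← mul_assoc, ← e1]
  have hst1 : s * t = 1 := hTD _ (mul_mem hs.1 ht.1) (hst ▸ inv_mem hd)
  have hsy : s ∈ rotationSubgroup g {k | k < 6 ∧ k ≠ 1} := by
    rw [eq_inv_of_mul_eq_one_left hst1]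
    exact inv_mem ht.2
  have hs1 : s = 1 := hTD s hs.1 (h.inter 1 4 (by omega) (by omega) s hsy hs.2)
  have ht1 : t = 1 := by rwa [hs1, one_mul] at hst1
  have hd1 : d = 1 := by rw [hs1, ht1, mul_one, mul_one] at e1; exact e1.symm
  rw [e2, hd1, hs1, ht1]
  simp

end TranslationGroup

/-! ### Contragredient automorphisms and duality -/

section Contragredient

open Matrix

variable {F : Type*} [Field F]

local notation "SL" => SpecialLinearGroup (Fin 3) F
local notation "PSL" => ProjectiveSpecialLinearGroup (Fin 3) F

/-- The automorphism of `SL(3, F)` sending a matrix to the inverse of its adjoint with respect to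
the bilinear form with matrix `diagonal d`. -/
def contragredient (d : Fin 3 → Fˣ) : SL →* SL where
  toFun A := ⟨diagonal (fun i => ((d i)⁻¹ : Fˣ).1) * ((A⁻¹ : SL) : Matrix (Fin 3) (Fin 3) F)ᵀ *
    diagonal (fun i => (d i).1), by
      rw [det_mul, det_mul, det_transpose, Matrix.SpecialLinearGroup.det_coe, mul_one, ← det_mul,
        diagonal_mul_diagonal]
      simp⟩
  map_one' := by
    apply Subtype.ext
    simp [diagonal_mul_diagonal]
  map_mul' A B := by
    apply Subtype.ext
    have hd : diagonal (fun i => (d i).1) * diagonal (fun i => ((d i)⁻¹ : Fˣ).1) =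
        (1 : Matrix (Fin 3) (Fin 3) F) := by
      rw [diagonal_mul_diagonal]
      simp
    change diagonal _ * (((A * B)⁻¹ : SL) : Matrix (Fin 3) (Fin 3) F)ᵀ * diagonal _ =
      diagonal _ * ((A⁻¹ : SL) : Matrix (Fin 3) (Fin 3) F)ᵀ * diagonal _ *
        (diagonal _ * ((B⁻¹ : SL) : Matrix (Fin 3) (Fin 3) F)ᵀ * diagonal _)
    rw [_root_.mul_inv_rev, Matrix.SpecialLinearGroup.coe_mul, transpose_mul]
    simp only [mul_assoc]
    rw [← mul_assoc (diagonal fun i => (d i).1) (diagonal _), hd, one_mul]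

theorem coe_contragredient (d : Fin 3 → Fˣ) (A : SL) :
    (contragredient d A : Matrix (Fin 3) (Fin 3) F) =
      diagonal (fun i => ((d i)⁻¹ : Fˣ).1) * ((A⁻¹ : SL) : Matrix (Fin 3) (Fin 3) F)ᵀ *
        diagonal (fun i => (d i).1) := rfl

theorem coe_contragredient_apply (d : Fin 3 → Fˣ) (A : SL) (i j : Fin 3) :
    (contragredient d A : Matrix (Fin 3) (Fin 3) F) i j =
      ((d i)⁻¹ : Fˣ).1 * ((A⁻¹ : SL) : Matrix (Fin 3) (Fin 3) F) j i * (d j).1 := by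
  rw [coe_contragredient, mul_diagonal, diagonal_mul, transpose_apply]

theorem contragredient_contragredient (d : Fin 3 → Fˣ) (A : SL) :
    contragredient d (contragredient d A) = A := by
  apply Subtype.ext
  ext i j
  change (contragredient d (contragredient d A) : Matrix (Fin 3) (Fin 3) F) i j = _
  rw [coe_contragredient_apply, ← map_inv, coe_contragredient_apply, inv_inv]
  have h1 : ((d i)⁻¹ : Fˣ).1 * (d i).1 = 1 := Units.inv_mul _
  have h2 : ((d j)⁻¹ : Fˣ).1 * (d j).1 = 1 := Units.inv_mul _
  change _ = (A : Matrix (Fin 3) (Fin 3) F) i j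
  linear_combination (A : Matrix (Fin 3) (Fin 3) F) i j * (h1 + ((d i)⁻¹ : Fˣ).1 * (d i).1 * h2)

theorem contragredient_mem_center {d : Fin 3 → Fˣ} {A : SL}
    (hA : A ∈ Subgroup.center (SpecialLinearGroup (Fin 3) F)) :
    contragredient d A ∈ Subgroup.center (SpecialLinearGroup (Fin 3) F) := by
  rw [Subgroup.mem_center_iff] at hA ⊢
  intro B
  rw [← contragredient_contragredient d B, ← map_mul, ← map_mul, hA]

/-- A self-adjoint matrix is inverted by the contragredient. -/
theorem contragredient_eq_inv {d : Fin 3 → Fˣ} {A : SL}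
    (hA : ∀ i j, (d i).1 * (A : Matrix (Fin 3) (Fin 3) F) i j =
      (d j).1 * (A : Matrix (Fin 3) (Fin 3) F) j i) : contragredient d A = A⁻¹ := by
  have : contragredient d A⁻¹ = A := by
    apply Subtype.ext
    ext i j
    change (contragredient d A⁻¹ : Matrix (Fin 3) (Fin 3) F) i j = (A : Matrix _ _ F) i j
    rw [coe_contragredient_apply, inv_inv]
    have h1 : ((d i)⁻¹ : Fˣ).1 * (d i).1 = 1 := Units.inv_mul _
    linear_combination (A : Matrix (Fin 3) (Fin 3) F) i j * h1 - ((d i)⁻¹ : Fˣ).1 * hA i j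
  rw [map_inv] at this
  rw [← inv_inv (contragredient d A), this]

/-- The automorphism of `PSL(3, F)` induced by the inverse transpose. -/
def inverseTranspose : PSL →* PSL :=
  QuotientGroup.map _ _ (contragredient fun _ => 1) fun _ hA => contragredient_mem_center hA

theorem inverseTranspose_injective : Function.Injective (inverseTranspose (F := F)) := by
  intro γ δ h
  induction γ using QuotientGroup.induction_on with | _ A
  induction δ using QuotientGroup.induction_on with | _ B
  have h' : contragredient (fun _ => (1 : Fˣ)) (A⁻¹ * B) ∈
      Subgroup.center (SpecialLinearGroup (Fin 3) F) := by
    rw [map_mul, map_inv]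
    exact QuotientGroup.eq.1 h
  have := contragredient_mem_center (d := fun _ => (1 : Fˣ)) h'
  rw [contragredient_contragredient] at this
  exact QuotientGroup.eq.2 this

/-- Centre and axis trade places; this duality carries the upper triangular case over to the lower
triangular one. -/
theorem isMirror_inverseTranspose {γ : PSL} {v f : Fin 3 → F} (h : IsMirror γ v f) :
    IsMirror (inverseTranspose γ) f v := by
  have e : inverseTranspose γ = (contragredient (fun _ => (1 : Fˣ)) (cubeLift γ) : SL) := by
    conv_lhs => rw [← mk_cubeLift h.mul_self]
    rfl
  rw [e]
  refine IsMirror.of_coe h.ne_covec h.ne_vec (by rw [dotProduct_comm, h.dot]) ?_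
  ext i j
  rw [coe_contragredient_apply, inv_eq_of_mul_eq_one_left (cubeLift_mul_self h.mul_self),
    h.coe_lift]
  simp only [Matrix.sub_apply, vecMulVec_apply, one_apply, inv_one, Units.val_one, one_mul,
    mul_one]
  rw [mul_comm (f i)]
  simp only [eq_comm]

theorem IsMirror.conj {γ : PSL} {v f : Fin 3 → F} (h : IsMirror γ v f) (p : SL) :
    IsMirror ((p : PSL)⁻¹ * γ * (p : PSL)) (((p⁻¹ : SL) : Matrix (Fin 3) (Fin 3) F) *ᵥ v)
      (f ᵥ* (p : Matrix (Fin 3) (Fin 3) F)) := by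
  have hp : (p : Matrix (Fin 3) (Fin 3) F) * ((p⁻¹ : SL) : Matrix (Fin 3) (Fin 3) F) = 1 := by
    rw [← Matrix.SpecialLinearGroup.coe_mul, mul_inv_cancel, Matrix.SpecialLinearGroup.coe_one]
  have hp' : ((p⁻¹ : SL) : Matrix (Fin 3) (Fin 3) F) * (p : Matrix (Fin 3) (Fin 3) F) = 1 := by
    rw [← Matrix.SpecialLinearGroup.coe_mul, inv_mul_cancel, Matrix.SpecialLinearGroup.coe_one]
  have e : (p : PSL)⁻¹ * γ * (p : PSL) = ((p⁻¹ * cubeLift γ * p : SL) : PSL) := by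
    rw [QuotientGroup.mk_mul, QuotientGroup.mk_mul, QuotientGroup.mk_inv, mk_cubeLift h.mul_self]
  rw [e]
  refine IsMirror.of_coe (fun h0 => h.ne_vec ?_) (fun h0 => h.ne_covec ?_) ?_ ?_
  · rw [← one_mulVec v, ← hp, ← mulVec_mulVec, h0, mulVec_zero]
  · rw [← vecMul_one f, ← hp, ← vecMul_vecMul, h0, zero_vecMul]
  · rw [← dotProduct_mulVec, mulVec_mulVec, hp, one_mulVec, h.dot]
  · rw [Matrix.SpecialLinearGroup.coe_mul, Matrix.SpecialLinearGroup.coe_mul, h.coe_lift, mul_sub,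
      sub_mul, mul_one, hp', mul_vecMulVec, vecMulVec_mul]

end Contragredient

/-! ### Block matrices and translations -/

section LowerTriangular

open Matrix

variable {F : Type*} [Field F]

local notation "SL" => SpecialLinearGroup (Fin 3) F
local notation "PSL" => ProjectiveSpecialLinearGroup (Fin 3) F

/-- The matrix of `SL(3, F)` adding multiples of the first coordinate to the other ones. -/
def translation (p q : F) : SL := ⟨!![1, 0, 0; p, 1, 0; q, 0, 1], by simp [det_fin_three]⟩

theorem coe_translation (p q : F) :
    (translation p q : Matrix (Fin 3) (Fin 3) F) = !![1, 0, 0; p, 1, 0; q, 0, 1] := rfl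

theorem translation_mul (p q p' q' : F) :
    translation p q * translation p' q' = translation (p + p') (q + q') := by
  apply Subtype.ext
  rw [Matrix.SpecialLinearGroup.coe_mul, coe_translation, coe_translation]
  change _ = !![1, 0, 0; p + p', 1, 0; q + q', 0, 1]
  ext i j
  fin_cases i <;> fin_cases j <;> simp [Matrix.mul_apply, Fin.sum_univ_three]

theorem translation_zero : translation (0 : F) 0 = 1 := by
  apply Subtype.ext
  change !![1, 0, 0; 0, 1, 0; 0, 0, 1] = (1 : Matrix (Fin 3) (Fin 3) F)
  exact one_fin_three.symm

/-- The group of all translations. -/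
def translationGroup (F : Type*) [Field F] : Subgroup (SpecialLinearGroup (Fin 3) F) where
  carrier := {A | ∃ p q, A = translation p q}
  one_mem' := ⟨0, 0, translation_zero.symm⟩
  mul_mem' := by
    rintro _ _ ⟨p, q, rfl⟩ ⟨p', q', rfl⟩
    exact ⟨_, _, translation_mul p q p' q'⟩
  inv_mem' := by
    rintro _ ⟨p, q, rfl⟩
    refine ⟨-p, -q, inv_eq_of_mul_eq_one_left ?_⟩
    rw [translation_mul, neg_add_cancel, neg_add_cancel, translation_zero]

/-- The stabiliser of the first coordinate axis and the complementary coordinate plane. -/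
def blockGroup (F : Type*) [Field F] : Subgroup (SpecialLinearGroup (Fin 3) F) where
  carrier := {A | (A : Matrix (Fin 3) (Fin 3) F) 0 1 = 0 ∧ (A : Matrix (Fin 3) (Fin 3) F) 0 2 = 0 ∧
    (A : Matrix (Fin 3) (Fin 3) F) 1 0 = 0 ∧ (A : Matrix (Fin 3) (Fin 3) F) 2 0 = 0}
  one_mem' := by simp
  mul_mem' := by
    rintro A B ⟨a1, a2, a3, a4⟩ ⟨b1, b2, b3, b4⟩
    simp only [Set.mem_ofPred_eq, Matrix.SpecialLinearGroup.coe_mul, Matrix.mul_apply,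
      Fin.sum_univ_three]
    simp [a1, a2, a3, a4, b1, b2, b3, b4]
  inv_mem' := by
    rintro A ⟨a1, a2, a3, a4⟩
    simp only [Set.mem_ofPred_eq, Matrix.SpecialLinearGroup.coe_inv, adjugate_fin_three]
    simp [a1, a2, a3, a4]

theorem mem_blockGroup {A : SL} : A ∈ blockGroup F ↔
    (A : Matrix (Fin 3) (Fin 3) F) 0 1 = 0 ∧ (A : Matrix (Fin 3) (Fin 3) F) 0 2 = 0 ∧
    (A : Matrix (Fin 3) (Fin 3) F) 1 0 = 0 ∧ (A : Matrix (Fin 3) (Fin 3) F) 2 0 = 0 := Iff.rfl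

theorem conj_mem_translationGroup {A B : SL} (hA : A ∈ translationGroup F)
    (hB : B ∈ blockGroup F) : B * A * B⁻¹ ∈ translationGroup F := by
  obtain ⟨p, q, rfl⟩ := hA
  obtain ⟨b1, b2, b3, b4⟩ := hB
  have hdet := Matrix.SpecialLinearGroup.det_coe B
  rw [det_fin_three, b1, b2, b3, b4] at hdet
  set b : Matrix (Fin 3) (Fin 3) F := (B : Matrix (Fin 3) (Fin 3) F) with hb
  have h0 : b 0 0 ≠ 0 := by
    intro h0
    rw [h0] at hdet
    simp at hdet
  refine ⟨(b 1 1 * p + b 1 2 * q) / b 0 0, (b 2 1 * p + b 2 2 * q) / b 0 0, ?_⟩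
  rw [mul_inv_eq_iff_eq_mul]
  apply Subtype.ext
  rw [Matrix.SpecialLinearGroup.coe_mul, Matrix.SpecialLinearGroup.coe_mul, coe_translation,
    coe_translation, ← hb]
  ext i j
  fin_cases i <;> fin_cases j <;>
    simp [Matrix.mul_apply, Fin.sum_univ_three, b1, b2, b3, b4, h0]

/-- The two matrices differ by a scalar, so the entries `p`, `q` of the translation are, up to a
nonzero factor, entries of `B` that vanish. -/
theorem eq_one_of_mk_mem {A B : SL} (hA : A ∈ translationGroup F) (hB : B ∈ blockGroup F)
    (h : (B : PSL) = A) : A = 1 := by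
  obtain ⟨p, q, rfl⟩ := hA
  obtain ⟨b1, b2, b3, b4⟩ := hB
  have hz := QuotientGroup.eq.1 h.symm
  obtain ⟨r, hr, hz⟩ := Matrix.SpecialLinearGroup.mem_center_iff.1 hz
  rw [Fintype.card_fin] at hr
  have hr0 : r ≠ 0 := by
    rintro rfl
    simp at hr
  have hB : B = translation p q * ((translation p q)⁻¹ * B) := by group
  rw [hB, Matrix.SpecialLinearGroup.coe_mul, ← hz, coe_translation] at b3 b4
  have hp : p = 0 := by simpa [Matrix.mul_apply, Fin.sum_univ_three, hr0] using b3
  have hq : q = 0 := by simpa [Matrix.mul_apply, Fin.sum_univ_three, hr0] using b4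
  rw [hp, hq, translation_zero]

theorem exists_mul_of_add_eq_zero {a b c d : F} (h : a ≠ 0 ∨ b ≠ 0) (he : a * c + b * d = 0) :
    ∃ t, c = t * b ∧ d = -(t * a) := by
  by_cases hb : b = 0
  · have ha : a ≠ 0 := h.resolve_right (not_not.2 hb)
    refine ⟨-(d / a), ?_, by field_simp⟩
    rw [hb, zero_mul, add_zero] at he
    rw [hb, mul_zero]
    exact (mul_eq_zero.1 he).resolve_left ha
  · refine ⟨c / b, by field_simp, ?_⟩
    field_simp
    linear_combination he

theorem IsMirror.mk_eq {γ : PSL} {v f : Fin 3 → F} (h : IsMirror γ v f) :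
    ((cubeLift γ : SL) : PSL) = γ := mk_cubeLift h.mul_self

/-- The matrix of the mirror of a vector and a covector. -/
theorem mirror_eq_of (v f : Fin 3 → F) : vecMulVec v f - 1 =
    !![v 0 * f 0 - 1, v 0 * f 1, v 0 * f 2; v 1 * f 0, v 1 * f 1 - 1, v 1 * f 2;
      v 2 * f 0, v 2 * f 1, v 2 * f 2 - 1] := by
  ext i j
  fin_cases i <;> fin_cases j <;> simp [vecMulVec_apply]

/-- The involution `g 2 5` if `g 0 5` and `g 0 2` are diagonal. -/
theorem IsRotationSystem.isMirror_two_five {g : ℕ → ℕ → PSL} (h : IsRotationSystem 6 g)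
    (m05 : IsMirror (g 0 5) ![1, 0, 0] ![2, 0, 0]) (m02 : IsMirror (g 0 2) ![0, 1, 0] ![0, 2, 0])
    (h2 : (2 : F) ≠ 0) : IsMirror (g 2 5) ![0, 0, 1] ![0, 0, 2] := by
  have e : g 2 5 = ((cubeLift (g 0 2) * cubeLift (g 0 5) : SL) : PSL) := by
    rw [QuotientGroup.mk_mul, m02.mk_eq, m05.mk_eq]
    exact (h.star_mul (by omega) (by omega) (by omega) (by omega)).symm
  rw [e]
  refine IsMirror.of_coe (fun h0 => ?_) (fun h0 => ?_) ?_ ?_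
  · simpa using congrFun h0 2
  · exact h2 (by simpa using congrFun h0 2)
  · simp [dotProduct, Fin.sum_univ_three]
  · rw [Matrix.SpecialLinearGroup.coe_mul, m02.coe_lift, m05.coe_lift, mirror_eq_of,
      mirror_eq_of, mirror_eq_of]
    ext i j
    fin_cases i <;> fin_cases j <;> simp [Matrix.mul_apply, Fin.sum_univ_three] <;> norm_num

/-- The case that all the elements of a rotation system of rank `6` preserve the plane spanned by
the second and third coordinate axes. -/
theorem IsRotationSystem.false_of_lower {g : ℕ → ℕ → PSL} (h : IsRotationSystem 6 g)
    (h2 : (2 : F) ≠ 0) {v f w k u l : Fin 3 → F}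
    (m05 : IsMirror (g 0 5) ![1, 0, 0] ![2, 0, 0]) (m02 : IsMirror (g 0 2) ![0, 1, 0] ![0, 2, 0])
    (m35 : IsMirror (g 3 5) v f) (m15 : IsMirror (g 1 5) w k) (m04 : IsMirror (g 0 4) u l)
    (hv0 : v 0 = 0) (hf0 : f 0 = 0) (hu1 : u 1 = 0) (hl1 : l 1 = 0) (hkv : k ⬝ᵥ v = 0)
    (hfw : f ⬝ᵥ w = 0) (hz1 : w 0 * k 1 = 0) (hz2 : w 0 * k 2 = 0) (hz3 : u 0 * l 2 = 0) :
    False := by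
  have m25 := h.isMirror_two_five m05 m02 h2
  set D := rotationSubgroup g {k | k < 6 ∧ k ≠ 1 ∧ k ≠ 4} with hD
  have hmem : ∀ i j, i < 6 → j < 6 → i ≠ 1 → i ≠ 4 → j ≠ 1 → j ≠ 4 → g i j ∈ D :=
    fun i j hi hj h1 h2 h3 h4 => Subgroup.subset_closure ⟨i, ⟨hi, h1, h2⟩, j, ⟨hj, h3, h4⟩, rfl⟩
  have hblock : ∀ {γ : PSL} {a b : Fin 3 → F}, IsMirror γ a b → a 0 * b 1 = 0 → a 0 * b 2 = 0 →
      a 1 * b 0 = 0 → a 2 * b 0 = 0 → γ ∈ (blockGroup F).map (QuotientGroup.mk' _) := by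
    intro γ a b hm h1 h2 h3 h4
    refine ⟨cubeLift γ, ?_, hm.mk_eq⟩
    change cubeLift γ ∈ blockGroup F
    rw [mem_blockGroup, hm.coe_lift, mirror_eq_of]
    exact ⟨h1, h2, h3, h4⟩
  have hDB : D ≤ (blockGroup F).map (QuotientGroup.mk' _) := by
    have b02 := hblock m02 (by simp) (by simp) (by simp) (by simp)
    have b05 := hblock m05 (by simp) (by simp) (by simp) (by simp)
    have b35 := hblock m35 (by simp [hv0]) (by simp [hv0]) (by simp [hf0]) (by simp [hf0])
    have b0 : ∀ i, i < 6 → i ≠ 1 → i ≠ 4 → g 0 i ∈ (blockGroup F).map (QuotientGroup.mk' _) := by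
      intro i hi h1 h4
      obtain rfl | rfl | rfl | rfl : i = 0 ∨ i = 2 ∨ i = 3 ∨ i = 5 := by omega
      · rw [h.self (by omega)]
        exact one_mem _
      · exact b02
      · rw [← h.mul 0 5 3 (by omega) (by omega) (by omega),
          h.symm' (i := 5) (j := 3) (by omega) (by omega) (by omega)]
        exact mul_mem b05 b35
      · exact b05
    rw [hD, rotationSubgroup, Subgroup.closure_le]
    rintro _ ⟨i, hi, j, hj, rfl⟩
    rw [← h.mul i 0 j hi.1 (by omega) hj.1, ← h.inv (by omega) hi.1]
    exact mul_mem (inv_mem (b0 i hi.1 hi.2.1 hi.2.2)) (b0 j hj.1 hj.2.1 hj.2.2)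
  have hvf := m35.dot
  have hkw := m15.dot
  have hlu := m04.dot
  simp only [dotProduct, Fin.sum_univ_three, hv0, hf0, hu1, hl1, mul_zero, zero_mul, zero_add,
    add_zero] at hvf hkw hlu hkv hfw
  -- The lifts of `g 0 1` and `g 0 4` have no off-diagonal entry in the first row, so each splits
  -- into a block part and a translation; the block part has to be found inside `D`.
  refine h.false_of_translations ((translationGroup F).map (QuotientGroup.mk' _)) ?_ ?_ ?_ ?_ ?_
  · rintro _ ⟨_, ⟨p, q, rfl⟩, rfl⟩ _ ⟨_, ⟨p', q', rfl⟩, rfl⟩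
    rw [← map_mul, ← map_mul, translation_mul, translation_mul, add_comm p, add_comm q]
  · rintro _ hd _ ⟨A, hA, rfl⟩
    obtain ⟨B, hB, rfl⟩ := hDB hd
    exact ⟨B * A * B⁻¹, conj_mem_translationGroup hA hB, by simp only [map_mul, map_inv]⟩
  · rintro _ ⟨A, hA, rfl⟩ hd
    obtain ⟨B, hB, e⟩ := hDB hd
    rw [eq_one_of_mk_mem hA hB e, map_one]
  · have e01 : g 0 1 = ((cubeLift (g 0 5) * cubeLift (g 1 5) : SL) : PSL) := by
      rw [QuotientGroup.mk_mul, m05.mk_eq, m15.mk_eq,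
        h.symm' (i := 1) (j := 5) (by omega) (by omega) (by omega),
        h.mul 0 5 1 (by omega) (by omega) (by omega)]
    have ex : ((cubeLift (g 0 5) * cubeLift (g 1 5) : SL) : Matrix (Fin 3) (Fin 3) F) =
        !![w 0 * k 0 - 1, 0, 0; -(w 1 * k 0), 1 - w 1 * k 1, -(w 1 * k 2);
          -(w 2 * k 0), -(w 2 * k 1), 1 - w 2 * k 2] := by
      rw [Matrix.SpecialLinearGroup.coe_mul, m05.coe_lift, m15.coe_lift, mirror_eq_of,
        mirror_eq_of]
      ext i j
      fin_cases i <;> fin_cases j <;>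
        simp [Matrix.mul_apply, Fin.sum_univ_three, hz1, hz2]
      norm_num
    -- If `w 0 = 0`, the mirrors of `g 1 5` and `g 3 5` are complementary on the plane of the last
    -- two coordinates, so `g 0 1` acts there like `g 3 5`. Otherwise `k` vanishes on that plane and
    -- `g 0 1` is a translation.
    by_cases hw0 : w 0 = 0
    · refine ⟨g 3 5, hmem 3 5 (by omega) (by omega) (by omega) (by omega) (by omega) (by omega),
        _, ⟨translation (w 1 * k 0) (w 2 * k 0), ⟨_, _, rfl⟩, rfl⟩, ?_, ?_, ?_⟩
      · rw [e01, ← m35.mk_eq]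
        change _ = (((cubeLift (g 3 5) * translation (w 1 * k 0) (w 2 * k 0) : SL)) : PSL)
        congr 1
        apply Subtype.ext
        rw [ex, Matrix.SpecialLinearGroup.coe_mul, m35.coe_lift, mirror_eq_of, coe_translation]
        have hfne : f 2 ≠ 0 ∨ f 1 ≠ 0 := by
          by_contra! hc
          rw [hc.1, hc.2] at hvf
          exact h2 (by linear_combination -hvf)
        have hvne : v 2 ≠ 0 ∨ v 1 ≠ 0 := by
          by_contra! hc
          rw [hc.1, hc.2] at hvf
          exact h2 (by linear_combination -hvf)
        obtain ⟨t, ht1, ht2⟩ := exists_mul_of_add_eq_zero hfne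
          (show f 2 * w 2 + f 1 * w 1 = 0 by linear_combination hfw)
        obtain ⟨s, hs1, hs2⟩ := exists_mul_of_add_eq_zero hvne
          (show v 2 * k 2 + v 1 * k 1 = 0 by linear_combination hkv)
        have hts : t * s = 1 := by
          rw [hw0, ht1, ht2, hs1, hs2] at hkw
          apply mul_left_cancel₀ h2
          linear_combination hkw - t * s * hvf
        ext i j
        fin_cases i <;> fin_cases j <;>
          simp [Matrix.mul_apply, Fin.sum_univ_three, hv0, hf0, hw0]
        · rw [ht1, ht2]; ring
        · rw [ht2, hs2]; linear_combination (-(f 2 * v 2)) * hts - hvf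
        · rw [ht2, hs1]; linear_combination (f 2 * v 1) * hts
        · rw [ht1, ht2]; ring
        · rw [ht1, hs2]; linear_combination (f 1 * v 2) * hts
        · rw [ht1, hs1]; linear_combination (-(f 1 * v 1)) * hts - hvf
      · conv_lhs => rw [← m35.mk_eq]
        conv_rhs => rw [← m35.mk_eq]
        change ((cubeLift (g 3 5) * translation (w 1 * k 0) (w 2 * k 0) : SL) : PSL) =
          ((translation (w 1 * k 0) (w 2 * k 0) * cubeLift (g 3 5) : SL) : PSL)
        congr 1
        apply Subtype.ext
        rw [Matrix.SpecialLinearGroup.coe_mul, Matrix.SpecialLinearGroup.coe_mul, m35.coe_lift,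
          mirror_eq_of, coe_translation]
        ext i j
        fin_cases i <;> fin_cases j <;>
          simp [Matrix.mul_apply, Fin.sum_univ_three, hv0, hf0]
        · linear_combination v 1 * k 0 * hfw
        · linear_combination v 2 * k 0 * hfw
      · exact m35.mul_self
    · have hk1 : k 1 = 0 := (mul_eq_zero.1 hz1).resolve_left hw0
      have hk2 : k 2 = 0 := (mul_eq_zero.1 hz2).resolve_left hw0
      refine ⟨1, one_mem _, _, ⟨translation (-(w 1 * k 0)) (-(w 2 * k 0)), ⟨_, _, rfl⟩, rfl⟩, ?_,
        by simp, by simp⟩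
      rw [one_mul, e01]
      change _ = ((translation _ _ : SL) : PSL)
      congr 1
      apply Subtype.ext
      rw [ex, coe_translation]
      ext i j
      fin_cases i <;> fin_cases j <;> simp [hk1, hk2]
      rw [hk1, hk2] at hkw
      linear_combination hkw
  · have e04 : g 0 4 = ((cubeLift (g 0 4) : SL) : PSL) := m04.mk_eq.symm
    by_cases hu0 : u 0 = 0
    · refine ⟨g 2 5, hmem 2 5 (by omega) (by omega) (by omega) (by omega) (by omega) (by omega),
        _, ⟨translation 0 (u 2 * l 0), ⟨_, _, rfl⟩, rfl⟩, ?_⟩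
      rw [e04, ← m25.mk_eq]
      change _ = ((cubeLift (g 2 5) * translation 0 (u 2 * l 0) : SL) : PSL)
      congr 1
      apply Subtype.ext
      rw [Matrix.SpecialLinearGroup.coe_mul, m04.coe_lift, m25.coe_lift, mirror_eq_of,
        mirror_eq_of, coe_translation]
      rw [hu0] at hlu
      ext i j
      fin_cases i <;> fin_cases j <;>
        simp [Matrix.mul_apply, Fin.sum_univ_three, hu0, hu1, hl1]
      · ring
      · linear_combination hlu
    · have hl2 : l 2 = 0 := (mul_eq_zero.1 hz3).resolve_left hu0
      refine ⟨g 0 5, hmem 0 5 (by omega) (by omega) (by omega) (by omega) (by omega) (by omega),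
        _, ⟨translation 0 (-(u 2 * l 0)), ⟨_, _, rfl⟩, rfl⟩, ?_⟩
      rw [e04, ← m05.mk_eq]
      change _ = ((cubeLift (g 0 5) * translation 0 (-(u 2 * l 0)) : SL) : PSL)
      congr 1
      apply Subtype.ext
      rw [Matrix.SpecialLinearGroup.coe_mul, m04.coe_lift, m05.coe_lift, mirror_eq_of,
        mirror_eq_of, coe_translation]
      rw [hl2] at hlu
      ext i j
      fin_cases i <;> fin_cases j <;>
        simp [Matrix.mul_apply, Fin.sum_univ_three, hl2, hu1, hl1]
      linear_combination hlu

end LowerTriangular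

/-! ### Rank six outside characteristic two: the commutation equation -/

section OddCharacteristicRankSix

open Matrix

variable {F : Type*} [Field F]

local notation "SL" => SpecialLinearGroup (Fin 3) F
local notation "PSL" => ProjectiveSpecialLinearGroup (Fin 3) F

/-- A rotation system all of whose elements `g 0 i` are self-adjoint with respect to a common
diagonal form is not chiral. -/
theorem IsRotationSystem.false_of_self_adjoint {n : ℕ} {g : ℕ → ℕ → PSL}
    (h : IsRotationSystem n g) (hn : 0 < n) (d : Fin 3 → Fˣ)
    (hd : ∀ i < n, ∃ A : SL, (A : PSL) = g 0 i ∧ ∀ a b,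
      (d a : F) * (A : Matrix (Fin 3) (Fin 3) F) a b =
        d b * (A : Matrix (Fin 3) (Fin 3) F) b a) : False := by
  obtain ⟨z, ⟨A, hA⟩, hz⟩ := h.chiral (((QuotientGroup.mk' _).prod
      ((QuotientGroup.mk' (Subgroup.center SL)).comp (contragredient d))).range) fun i hi => by
    obtain ⟨A, hA, hadj⟩ := hd i hi
    refine ⟨A, Prod.ext hA ?_⟩
    change ((contragredient d A : SL) : PSL) = g i 0
    rw [contragredient_eq_inv hadj, QuotientGroup.mk_inv, hA, h.inv hn hi]
  have h1 : (A : PSL) = 1 := congrArg Prod.fst hA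
  have h2 : ((contragredient d A : SL) : PSL) = z := congrArg Prod.snd hA
  rw [QuotientGroup.eq_one_iff] at h1
  exact hz (h2.symm.trans ((QuotientGroup.eq_one_iff _).2 (contragredient_mem_center h1)))

theorem entries_of_comm {x₀₀ x₀₁ x₀₂ x₁₀ x₁₁ x₁₂ x₂₀ x₂₁ x₂₂ η p s r : F}
    (h : !![x₀₀, x₀₁, x₀₂; x₁₀, x₁₁, x₁₂; x₂₀, x₂₁, x₂₂] * !![η, 0, p; 0, 1, 0; s, 0, η] =
      r • (!![η, 0, p; 0, 1, 0; s, 0, η] * !![x₀₀, x₀₁, x₀₂; x₁₀, x₁₁, x₁₂; x₂₀, x₂₁, x₂₂])) :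
    (x₀₀ * η + x₀₂ * s = r * (η * x₀₀ + p * x₂₀) ∧ x₀₁ = r * (η * x₀₁ + p * x₂₁) ∧
      x₀₀ * p + x₀₂ * η = r * (η * x₀₂ + p * x₂₂)) ∧
    (x₁₀ * η + x₁₂ * s = r * x₁₀ ∧ x₁₁ = r * x₁₁ ∧ x₁₀ * p + x₁₂ * η = r * x₁₂) ∧
    (x₂₀ * η + x₂₂ * s = r * (s * x₀₀ + η * x₂₀) ∧ x₂₁ = r * (s * x₀₁ + η * x₂₁) ∧
      x₂₀ * p + x₂₂ * η = r * (s * x₀₂ + η * x₂₂)) := by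
  have e := fun i j => congrFun (congrFun h i) j
  simp only [Matrix.smul_apply, Matrix.mul_apply, Fin.sum_univ_three, smul_eq_mul] at e
  refine ⟨⟨?_, ?_, ?_⟩, ⟨?_, ?_, ?_⟩, ⟨?_, ?_, ?_⟩⟩
  · simpa using e 0 0
  · simpa using e 0 1
  · simpa using e 0 2
  · simpa using e 1 0
  · simpa using e 1 1
  · simpa using e 1 2
  · simpa using e 2 0
  · simpa using e 2 1
  · simpa using e 2 2

/-- The solutions of the equation `x y = y x` for the shape of lifts of `g 0 1` and `g 5 4`. -/
theorem lower_or_upper_of_comm (h2 : (2 : F) ≠ 0) {v₁ v₂ f₁ f₂ w₀ k₀ τ σ η p s : F}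
    (hvf : f₁ * v₁ + f₂ * v₂ = 2) (hwk : k₀ * w₀ + 2 * (τ * σ) = 2)
    (hps : p ≠ 0 ∨ s ≠ 0)
    (hN1 : ¬ (w₀ * σ = 0 ∧ τ * k₀ = 0)) (hN3 : ¬ (v₁ * f₂ = 0 ∧ v₂ * f₁ = 0))
    (h : !![w₀ * k₀ - 1, w₀ * (σ * v₂), -(w₀ * (σ * v₁));
        -(τ * f₂ * k₀), 1 - τ * f₂ * (σ * v₂), τ * f₂ * (σ * v₁);
        τ * f₁ * k₀, τ * f₁ * (σ * v₂), 1 - τ * f₁ * (σ * v₁)] *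
          !![η, 0, p; 0, 1, 0; s, 0, η] =
      !![η, 0, p; 0, 1, 0; s, 0, η] *
        !![w₀ * k₀ - 1, w₀ * (σ * v₂), -(w₀ * (σ * v₁));
          -(τ * f₂ * k₀), 1 - τ * f₂ * (σ * v₂), τ * f₂ * (σ * v₁);
          τ * f₁ * k₀, τ * f₁ * (σ * v₂), 1 - τ * f₁ * (σ * v₁)]) :
    (w₀ * σ = 0 ∧ p = 0) ∨ (τ * k₀ = 0 ∧ s = 0) := by
  obtain ⟨⟨e00, e01, e02⟩, ⟨e10, e11, e12⟩, ⟨e20, e21, e22⟩⟩ :=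
    entries_of_comm (h.trans (one_smul F _).symm)
  have hv : v₁ ≠ 0 ∨ v₂ ≠ 0 := by
    by_contra! hc
    exact hN3 ⟨by rw [hc.1, zero_mul], by rw [hc.2, zero_mul]⟩
  have hf : f₁ ≠ 0 ∨ f₂ ≠ 0 := by
    by_contra! hc
    exact hN3 ⟨by rw [hc.2, mul_zero], by rw [hc.1, mul_zero]⟩
  -- This is entry `(0, 2)` or `(2, 0)`, divided by whichever of `p`, `s` is nonzero.
  have h0 : τ * σ * (f₂ * v₂) = 0 := by
    rcases hps with hp | hs
    · refine (mul_eq_zero.1 ?_).resolve_left hp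
      linear_combination -e02 + p * hwk + p * (τ * σ) * hvf
    · refine (mul_eq_zero.1 ?_).resolve_left hs
      linear_combination e20 + s * hwk + s * (τ * σ) * hvf
  -- If `τ * σ = 0`, then `k₀ * w₀ = 2` and single entries decide. Otherwise `f₁ * v₁ = 2` and
  -- exactly one of `f₂`, `v₂` vanishes; the middle column or row then yields `η = 1` and the two
  -- claimed zeros.
  by_cases hτσ : τ * σ = 0
  · have hk : k₀ ≠ 0 := by
      rintro rfl
      exact h2 (by linear_combination -hwk + 2 * hτσ)
    have hw : w₀ ≠ 0 := by
      rintro rfl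
      exact h2 (by linear_combination -hwk + 2 * hτσ)
    rcases mul_eq_zero.1 hτσ with rfl | rfl
    · right
      have hσ : w₀ * σ ≠ 0 := fun hσ => hN1 ⟨hσ, zero_mul _⟩
      refine ⟨zero_mul _, ?_⟩
      rcases hv with hv | hv
      · refine (mul_eq_zero.1 ?_).resolve_left (mul_ne_zero hσ hv)
        linear_combination -e00
      · refine (mul_eq_zero.1 ?_).resolve_left (mul_ne_zero hσ hv)
        linear_combination -e21
    · left
      have hτ : τ * k₀ ≠ 0 := fun hτ => hN1 ⟨mul_zero _, hτ⟩
      refine ⟨mul_zero _, ?_⟩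
      rcases hf with hf | hf
      · refine (mul_eq_zero.1 ?_).resolve_left (mul_ne_zero hτ hf)
        linear_combination e22
      · refine (mul_eq_zero.1 ?_).resolve_left (mul_ne_zero hτ hf)
        linear_combination -e12
  · have hfv : f₂ * v₂ = 0 := (mul_eq_zero.1 h0).resolve_left hτσ
    have hfv1 : f₁ * v₁ = 2 := by linear_combination hvf - hfv
    have hσ : σ ≠ 0 := right_ne_zero_of_mul hτσ
    have hτ : τ ≠ 0 := left_ne_zero_of_mul hτσ
    have hf1 : f₁ ≠ 0 := left_ne_zero_of_mul (hfv1.trans_ne h2)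
    have hv1 : v₁ ≠ 0 := right_ne_zero_of_mul (hfv1.trans_ne h2)
    rcases mul_eq_zero.1 hfv with rfl | rfl
    · left
      have hv2 : v₂ ≠ 0 := by
        rintro rfl
        exact hN3 ⟨mul_zero _, zero_mul _⟩
      have a1 : w₀ * (1 - η) = p * (τ * f₁) := by
        apply mul_left_cancel₀ (mul_ne_zero hσ hv2)
        linear_combination e01
      have a2 : τ * f₁ * (1 - η) = s * w₀ := by
        apply mul_left_cancel₀ (mul_ne_zero hσ hv2)
        linear_combination e21
      have hη : 1 - η = 0 := by
        refine (mul_eq_zero.1 ?_).resolve_left h2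
        linear_combination -e00 + σ * v₁ * a2 + k₀ * a1 + (1 - η) * (-hwk - τ * σ * hfv1)
      rw [hη, mul_zero] at a1 a2
      have hp : p = 0 := (mul_eq_zero.1 a1.symm).resolve_right (mul_ne_zero hτ hf1)
      have hw : w₀ = 0 := (mul_eq_zero.1 a2.symm).resolve_left (hps.resolve_left (not_not.2 hp))
      exact ⟨by rw [hw, zero_mul], hp⟩
    · right
      have hf2 : f₂ ≠ 0 := by
        rintro rfl
        exact hN3 ⟨mul_zero _, zero_mul _⟩
      have a1 : k₀ * (1 - η) = -(σ * v₁ * s) := by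
        apply mul_left_cancel₀ (mul_ne_zero hτ hf2)
        linear_combination e10
      have a2 : k₀ * p = -(σ * v₁ * (1 - η)) := by
        apply mul_left_cancel₀ (mul_ne_zero hτ hf2)
        linear_combination -e12
      have hη : 1 - η = 0 := by
        refine (mul_eq_zero.1 ?_).resolve_left h2
        linear_combination e00 + w₀ * a1 + τ * f₁ * a2 + (1 - η) * (-hwk - τ * σ * hfv1)
      rw [hη, mul_zero] at a1 a2
      have hs : s = 0 :=
        (mul_eq_zero.1 (neg_eq_zero.1 a1.symm)).resolve_left (mul_ne_zero hσ hv1)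
      have hk : k₀ = 0 := (mul_eq_zero.1 (a2.trans neg_zero)).resolve_right
        (hps.resolve_right (not_not.2 hs))
      exact ⟨by rw [hk, mul_zero], hs⟩

end OddCharacteristicRankSix

/-! ### Rank six outside characteristic two, in diagonal coordinates -/

section OddCharacteristicRankSixNormalized

open Matrix

variable {F : Type*} [Field F]

local notation "SL" => SpecialLinearGroup (Fin 3) F
local notation "PSL" => ProjectiveSpecialLinearGroup (Fin 3) F

theorem IsMirror.smul {γ : PSL} {v f : Fin 3 → F} (h : IsMirror γ v f) {c : F} (hc : c ≠ 0) :
    IsMirror γ (c • v) (c⁻¹ • f) := by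
  refine ⟨smul_ne_zero hc h.ne_vec, smul_ne_zero (inv_ne_zero hc) h.ne_covec, ?_, ?_, h.mul_self⟩
  · rw [smul_dotProduct, dotProduct_smul, smul_smul, inv_mul_cancel₀ hc, one_smul, h.dot]
  · rw [vecMulVec_smul, smul_vecMulVec, smul_smul, inv_mul_cancel₀ hc, one_smul, h.coe_lift]

/-- There is no rotation system of rank `6` for which `g 0 5` and `g 0 2` are diagonal. -/
theorem IsRotationSystem.false_of_diagonal {g : ℕ → ℕ → PSL} (h : IsRotationSystem 6 g)
    (h2 : (2 : F) ≠ 0) (m05 : IsMirror (g 0 5) ![1, 0, 0] ![2, 0, 0])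
    (m02 : IsMirror (g 0 2) ![0, 1, 0] ![0, 2, 0]) : False := by
  have m25 := h.isMirror_two_five m05 m02 h2
  have hmir : ∀ i j, i < 6 → j < 6 → i + 2 ≤ j → ∃ v f : Fin 3 → F, IsMirror (g i j) v f :=
    fun i j hi hj hij => exists_isMirror (h.mul_self hi hj (by omega))
      (h.ne_one hi hj (by omega))
  obtain ⟨v, f, m35⟩ := hmir 3 5 (by omega) (by omega) (by omega)
  obtain ⟨w, k, m15⟩ := hmir 1 5 (by omega) (by omega) (by omega)
  obtain ⟨u, l, m04⟩ := hmir 0 4 (by omega) (by omega) (by omega)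
  have s5 : ∀ i, i ≤ 3 → g i 5 = g 5 i := fun i hi =>
    h.symm' (by omega) (by omega) (by omega)
  have n5 : ∀ i j, i ≤ 3 → j ≤ 3 → i ≠ j → g i 5 ≠ g j 5 := fun i j hi hj hij => by
    rw [s5 i hi, s5 j hj]
    exact h.star_ne (by omega) (by omega) (by omega) (by omega) hij
  have c5 : ∀ i j, i ≤ 3 → j ≤ 3 → i + 2 ≤ j → g i 5 * g j 5 = g j 5 * g i 5 :=
    fun i j hi hj hij => by
      rw [s5 i hi, s5 j hj]
      exact h.star_comm (by omega) (by omega) (by omega) (by omega) (by omega) (by omega)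
  have nc5 : ∀ i, i ≤ 2 → g i 5 * g (i + 1) 5 ≠ g (i + 1) 5 * g i 5 := fun i hi => by
    rw [s5 i (by omega), s5 (i + 1) (by omega)]
    exact h.star_not_comm (by omega) (by omega) (by omega)
  have o35 := (m05.comm_iff m35 (n5 0 3 (by omega) le_rfl (by omega))).1
    (c5 0 3 (by omega) le_rfl (by omega))
  have o15 := (m15.comm_iff m35 (n5 1 3 (by omega) le_rfl (by omega))).1
    (c5 1 3 (by omega) le_rfl (by omega))
  have o04 := (m02.comm_iff m04 (h.star_ne (by omega) (by omega) (by omega) (by omega)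
    (by omega))).1 (h.star_comm (by omega) (by omega) (by omega) (by omega) (by omega) (by omega))
  have hv0 : v 0 = 0 := by simpa [dotProduct, Fin.sum_univ_three, h2] using o35.1
  have hf0 : f 0 = 0 := by simpa [dotProduct, Fin.sum_univ_three] using o35.2
  have hu1 : u 1 = 0 := by simpa [dotProduct, Fin.sum_univ_three, h2] using o04.1
  have hl1 : l 1 = 0 := by simpa [dotProduct, Fin.sum_univ_three] using o04.2
  have hvf := m35.dot
  have hkw := m15.dot
  have hlu := m04.dot
  have hkv := o15.1
  have hfw := o15.2
  simp only [dotProduct, Fin.sum_univ_three, hv0, hf0, hu1, hl1, mul_zero, zero_mul, zero_add,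
    add_zero] at hvf hkw hlu hkv hfw
  have hfne : f 2 ≠ 0 ∨ f 1 ≠ 0 := by
    by_contra! hc
    rw [hc.1, hc.2] at hvf
    exact h2 (by linear_combination -hvf)
  have hvne : v 2 ≠ 0 ∨ v 1 ≠ 0 := by
    by_contra! hc
    rw [hc.1, hc.2] at hvf
    exact h2 (by linear_combination -hvf)
  -- `g 1 5` commutes with `g 3 5`, so the plane parts of `w` and `k` are multiples of `(f 2, -f 1)`
  -- and `(v 2, -v 1)`; negating the inputs produces these signs.
  obtain ⟨τ, hw2, hw1⟩ := exists_mul_of_add_eq_zero hfne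
    (show f 2 * -w 2 + f 1 * -w 1 = 0 by linear_combination -hfw)
  obtain ⟨σ, hk2, hk1⟩ := exists_mul_of_add_eq_zero hvne
    (show v 2 * -k 2 + v 1 * -k 1 = 0 by linear_combination -hkv)
  replace hw2 : w 2 = -(τ * f 1) := by linear_combination -hw2
  replace hk2 : k 2 = -(σ * v 1) := by linear_combination -hk2
  replace hw1 : w 1 = τ * f 2 := by linear_combination -hw1
  replace hk1 : k 1 = σ * v 2 := by linear_combination -hk1
  have hwk : k 0 * w 0 + 2 * (τ * σ) = 2 := by
    rw [hw2, hk2, hw1, hk1] at hkw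
    linear_combination hkw - τ * σ * hvf
  -- nondegeneracy
  have ncomm : ∀ {γ δ : PSL} {a b c d : Fin 3 → F}, IsMirror γ a b → IsMirror δ c d →
      γ * δ ≠ δ * γ → (vecMulVec a b - 1) * (vecMulVec c d - 1) ≠
        (vecMulVec c d - 1) * (vecMulVec a b - 1) := by
    intro γ δ a b c d hγ hδ hne he
    apply hne
    rw [← hγ.mk_eq, ← hδ.mk_eq, ← QuotientGroup.mk_mul, ← QuotientGroup.mk_mul]
    congr 1
    apply Subtype.ext
    rw [Matrix.SpecialLinearGroup.coe_mul, Matrix.SpecialLinearGroup.coe_mul, hγ.coe_lift,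
      hδ.coe_lift, he]
  have hN1 : ¬ (w 0 * σ = 0 ∧ τ * k 0 = 0) := by
    rintro ⟨ha, hb⟩
    refine ncomm m05 m15 (nc5 0 (by omega)) ?_
    rw [mirror_eq_of, mirror_eq_of, hw1, hw2, hk1, hk2]
    have e1 : w 0 * (σ * v 2) = 0 := by rw [← mul_assoc, ha, zero_mul]
    have e2 : w 0 * -(σ * v 1) = 0 := by rw [mul_neg, ← mul_assoc, ha, zero_mul, neg_zero]
    have e3 : τ * f 2 * k 0 = 0 := by rw [mul_right_comm, hb, zero_mul]
    have e4 : -(τ * f 1) * k 0 = 0 := by rw [neg_mul, mul_right_comm, hb, zero_mul, neg_zero]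
    rw [e1, e2, e3, e4]
    ext i j
    fin_cases i <;> fin_cases j <;> simp [Matrix.mul_apply, Fin.sum_univ_three]; ring
  have hN2 : u 0 * l 2 ≠ 0 ∨ -(u 2 * l 0) ≠ 0 := by
    by_contra! hc
    refine ncomm m04 m05 (h.star_not_comm (by omega) (by omega) (by omega)) ?_
    rw [mirror_eq_of, mirror_eq_of, hu1, hl1, hc.1, neg_eq_zero.1 hc.2]
    ext i j
    fin_cases i <;> fin_cases j <;> simp [Matrix.mul_apply, Fin.sum_univ_three]; ring
  have hN3 : ¬ (v 1 * f 2 = 0 ∧ v 2 * f 1 = 0) := by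
    rintro ⟨ha, hb⟩
    refine ncomm m25 m35 (nc5 2 (by omega)) ?_
    rw [mirror_eq_of, mirror_eq_of, hv0, hf0, ha, hb]
    ext i j
    fin_cases i <;> fin_cases j <;> simp [Matrix.mul_apply, Fin.sum_univ_three]; ring
  -- the relation between `g 0 1` and `g 5 4`
  set x : SL := cubeLift (g 0 5) * cubeLift (g 1 5) with hx
  set y : SL := cubeLift (g 0 5) * cubeLift (g 0 4) with hy
  have ex : (x : PSL) = g 0 1 := by
    rw [hx, QuotientGroup.mk_mul, m05.mk_eq, m15.mk_eq, s5 1 (by omega)]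
    exact h.mul 0 5 1 (by omega) (by omega) (by omega)
  have ey : (y : PSL) = g 5 4 := by
    rw [hy, QuotientGroup.mk_mul, m05.mk_eq, m04.mk_eq, s5 0 (by omega)]
    exact h.mul 5 0 4 (by omega) (by omega) (by omega)
  have hxy : (x : PSL) * y = y * x := by
    rw [ex, ey]
    have i1 : g 1 4 = g 4 1 := h.symm' (by omega) (by omega) (by omega)
    have a1 : g 0 1 = g 0 5 * g 5 1 := (h.mul 0 5 1 (by omega) (by omega) (by omega)).symm
    have a3 : g 1 5 * g 5 4 = g 1 4 := h.mul 1 5 4 (by omega) (by omega) (by omega)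
    have a4 : g 5 4 = g 5 0 * g 0 4 := (h.mul 5 0 4 (by omega) (by omega) (by omega)).symm
    have a5 : g 0 4 = g 4 0 := h.symm' (by omega) (by omega) (by omega)
    have a6 : g 4 0 * g 0 1 = g 4 1 := h.mul 4 0 1 (by omega) (by omega) (by omega)
    calc g 0 1 * g 5 4 = g 0 5 * (g 1 5 * g 5 4) := by rw [a1, ← s5 1 (by omega), mul_assoc]
      _ = g 5 0 * (g 0 4 * g 0 1) := by rw [a3, s5 0 (by omega), i1, a5, a6]
      _ = g 5 4 * g 0 1 := by rw [a4, mul_assoc]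
  obtain ⟨r, hr3, hr⟩ := exists_smul_of_mk_comm hxy
  have cx : (x : Matrix (Fin 3) (Fin 3) F) =
      !![w 0 * k 0 - 1, w 0 * (σ * v 2), -(w 0 * (σ * v 1));
        -(τ * f 2 * k 0), 1 - τ * f 2 * (σ * v 2), τ * f 2 * (σ * v 1);
        τ * f 1 * k 0, τ * f 1 * (σ * v 2), 1 - τ * f 1 * (σ * v 1)] := by
    rw [hx, Matrix.SpecialLinearGroup.coe_mul, m05.coe_lift, m15.coe_lift, mirror_eq_of,
      mirror_eq_of, hw1, hw2, hk1, hk2]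
    ext i j
    fin_cases i <;> fin_cases j <;> simp [Matrix.mul_apply, Fin.sum_univ_three] <;> ring
  have cy : (y : Matrix (Fin 3) (Fin 3) F) =
      !![u 0 * l 0 - 1, 0, u 0 * l 2; 0, 1, 0; -(u 2 * l 0), 0, u 0 * l 0 - 1] := by
    rw [hy, Matrix.SpecialLinearGroup.coe_mul, m05.coe_lift, m04.coe_lift, mirror_eq_of,
      mirror_eq_of, hu1, hl1]
    ext i j
    fin_cases i <;> fin_cases j <;> simp [Matrix.mul_apply, Fin.sum_univ_three] <;>
      first
      | ring1
      | linear_combination -hlu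
  have htx := trace_eq_mul_trace hr
  -- Reading the relation backwards replaces `r` by `r⁻¹ = r ^ 2`.
  have hty : (y : Matrix (Fin 3) (Fin 3) F).trace = r ^ 2 * (y : Matrix (Fin 3) (Fin 3) F).trace :=
    trace_eq_mul_trace (x := y) (y := x) (r := r ^ 2) (by
      rw [hr, smul_smul, ← pow_succ, hr3, one_smul])
  rw [cx, cy] at hr
  by_cases hr1 : r = 1
  · rw [hr1, one_smul] at hr
    rcases lower_or_upper_of_comm h2 hvf hwk hN2 hN1 hN3 hr with ⟨ha, hb⟩ | ⟨ha, hb⟩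
    · exact h.false_of_lower h2 m05 m02 m35 m15 m04 hv0 hf0 hu1 hl1 o15.1 o15.2
        (by rw [hk1, ← mul_assoc, ha, zero_mul]) (by rw [hk2, mul_neg, ← mul_assoc, ha, zero_mul,
          neg_zero]) hb
    -- In the upper triangular case the inverse transpose is applied; rescaling restores the normal
    -- form of the two diagonal mirrors.
    · have scale : ∀ {γ : PSL} {a b c d : Fin 3 → F}, IsMirror γ a b → c = (2 : F)⁻¹ • a →
          d = (2 : F) • b → IsMirror γ c d := by
        rintro γ a b c d hm rfl rfl
        simpa using hm.smul (inv_ne_zero h2)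
      refine (h.map inverseTranspose inverseTranspose_injective).false_of_lower h2
        (scale (isMirror_inverseTranspose m05) ?_ ?_) (scale (isMirror_inverseTranspose m02) ?_ ?_)
        (isMirror_inverseTranspose m35) (isMirror_inverseTranspose m15)
        (isMirror_inverseTranspose m04) hf0 hv0 hl1 hu1 (by rw [dotProduct_comm, o15.2])
        (by rw [dotProduct_comm, o15.1]) ?_ ?_ ?_
      · ext i; fin_cases i <;> simp [h2]
      · ext i; fin_cases i <;> simp
      · ext i; fin_cases i <;> simp [h2]
      · ext i; fin_cases i <;> simp
      · rw [hw1]; linear_combination f 2 * ha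
      · rw [hw2]; linear_combination -f 1 * ha
      · linear_combination -hb
  -- For a nontrivial cube root of unity `r` both traces vanish, so `τ * σ = 3/4` and `u 0 * l 0 =
  -- 1/2`. Characteristic three does not occur, as there `r ^ 3 = 1` forces `r = 1`.
  · obtain ⟨⟨e00, -, -⟩, ⟨-, e11, -⟩, ⟨-, -, e22⟩⟩ := entries_of_comm hr
    have hr1' : 1 - r ≠ 0 := sub_ne_zero.2 (Ne.symm hr1)
    have h3 : (3 : F) ≠ 0 := by
      intro h3
      have : (1 - r) ^ 3 = 0 := by linear_combination -hr3 + (r ^ 2 - r) * h3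
      exact hr1' (pow_eq_zero_iff (by norm_num) |>.1 this)
    have tx : 3 - 4 * (τ * σ) = 0 := by
      refine (mul_eq_zero.1 ?_).resolve_left hr1'
      rw [cx, trace_fin_three] at htx
      simp at htx
      linear_combination htx + (1 - r) * (-hwk + τ * σ * hvf)
    have ty : 2 * (u 0 * l 0) - 1 = 0 := by
      refine (mul_eq_zero.1 ?_).resolve_left (mul_ne_zero hr1' (show (1 : F) + r ≠ 0 from ?_))
      · rw [cy, trace_fin_three] at hty
        simp at hty
        linear_combination hty
      · intro hc
        refine h2 ?_
        linear_combination (-1 : F) * hr3 + (r ^ 2 - r + 1) * hc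
    have e11' : τ * σ * (f 2 * v 2) = 1 := by
      have : (1 - r) * (1 - τ * σ * (f 2 * v 2)) = 0 := by linear_combination e11
      have := (mul_eq_zero.1 this).resolve_left hr1'
      linear_combination -this
    have key : w 0 * (σ * v 1) * (u 2 * l 0) + u 0 * l 2 * (τ * f 1 * k 0) = 0 := by
      refine (mul_eq_zero.1 ?_).resolve_left hr1'
      linear_combination e00 + e22 -
        (1 - r) * (u 0 * l 0 - 1) * (hwk + e11' - τ * σ * hvf + tx)
    have hτσ : τ * σ ≠ 0 := left_ne_zero_of_mul (e11'.trans_ne one_ne_zero)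
    have hfv2 : f 2 * v 2 ≠ 0 := right_ne_zero_of_mul (e11'.trans_ne one_ne_zero)
    have hfv1 : f 1 * v 1 ≠ 0 := by
      intro h0
      have : τ * σ * 2 = 1 := by linear_combination e11' - τ * σ * hvf + τ * σ * h0
      exact one_ne_zero (α := F) (by linear_combination tx + 2 * this)
    have hul : (u 0 * l 2) * (u 2 * l 0) ≠ 0 := by
      intro h0
      apply h3
      linear_combination 4 * h0 + (2 * (u 0 * l 0) - 3) * ty - 4 * (u 0 * l 0) * hlu
    have hv1 : v 1 ≠ 0 := right_ne_zero_of_mul hfv1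
    have hf1 : f 1 ≠ 0 := left_ne_zero_of_mul hfv1
    have hv2 : v 2 ≠ 0 := right_ne_zero_of_mul hfv2
    have hf2 : f 2 ≠ 0 := left_ne_zero_of_mul hfv2
    have hp : u 0 * l 2 ≠ 0 := left_ne_zero_of_mul hul
    have hs : u 2 * l 0 ≠ 0 := right_ne_zero_of_mul hul
    -- The ratio of the first and third weights makes `g 0 4` self-adjoint, that of the second and
    -- third `g 0 3`; for `g 0 1` the remaining condition is `key`.
    refine h.false_of_self_adjoint (by omega)
      ![Units.mk0 (v 1 * f 2 * (u 2 * l 0)) (mul_ne_zero (mul_ne_zero hv1 hf2) hs),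
        Units.mk0 (v 2 * f 1 * (u 0 * l 2)) (mul_ne_zero (mul_ne_zero hv2 hf1) hp),
        Units.mk0 (v 1 * f 2 * (u 0 * l 2)) (mul_ne_zero (mul_ne_zero hv1 hf2) hp)] ?_
    intro i hi
    obtain rfl | rfl | rfl | rfl | rfl | rfl : i = 0 ∨ i = 1 ∨ i = 2 ∨ i = 3 ∨ i = 4 ∨ i = 5 := by
      omega
    · refine ⟨1, (h.self (by omega)).symm, fun a b => ?_⟩
      fin_cases a <;> fin_cases b <;> simp
    · refine ⟨x, ex, fun a b => ?_⟩
      rw [cx]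
      fin_cases a <;> fin_cases b <;>
        simp only [Fin.zero_eta, Fin.mk_one, Fin.reduceFinMk, of_apply, cons_val, Units.val_mk0]
      · linear_combination f 2 * v 2 * key
      · linear_combination -(v 1 * f 2) * key
      · linear_combination -(f 2 * v 2) * key
      · ring
      · linear_combination v 1 * f 2 * key
      · ring
    · refine ⟨cubeLift (g 0 2), m02.mk_eq, fun a b => ?_⟩
      rw [m02.coe_lift, mirror_eq_of]
      fin_cases a <;> fin_cases b <;> simp
    · refine ⟨cubeLift (g 0 5) * cubeLift (g 3 5), ?_, fun a b => ?_⟩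
      · rw [QuotientGroup.mk_mul, m05.mk_eq, m35.mk_eq, s5 3 le_rfl]
        exact h.mul 0 5 3 (by omega) (by omega) (by omega)
      · rw [Matrix.SpecialLinearGroup.coe_mul, m05.coe_lift, m35.coe_lift, mirror_eq_of,
          mirror_eq_of, hv0, hf0]
        fin_cases a <;> fin_cases b <;>
          simp only [Fin.zero_eta, Fin.mk_one, Fin.reduceFinMk, Matrix.mul_apply,
            Fin.sum_univ_three,
            of_apply, cons_val, Units.val_mk0] <;>
          ring
    · refine ⟨cubeLift (g 0 4), m04.mk_eq, fun a b => ?_⟩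
      rw [m04.coe_lift, mirror_eq_of, hu1, hl1]
      fin_cases a <;> fin_cases b <;>
        simp only [Fin.zero_eta, Fin.mk_one, Fin.reduceFinMk, of_apply, cons_val, Units.val_mk0]
      all_goals ring
    · refine ⟨cubeLift (g 0 5), m05.mk_eq, fun a b => ?_⟩
      rw [m05.coe_lift, mirror_eq_of]
      fin_cases a <;> fin_cases b <;> simp

end OddCharacteristicRankSixNormalized

/-! ### Rank six: reduction to diagonal coordinates -/

section RankSix

open Matrix

variable {F : Type*} [Field F]

local notation "SL" => SpecialLinearGroup (Fin 3) F
local notation "PSL" => ProjectiveSpecialLinearGroup (Fin 3) F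

/-- Three pairwise orthogonal reflections in dimension three are simultaneously diagonalisable. -/
theorem exists_conj_isMirror (h2 : (2 : F) ≠ 0) {α β γ : PSL} {a b c f k l : Fin 3 → F}
    (ma : IsMirror α a f) (mb : IsMirror β b k) (mc : IsMirror γ c l)
    (hab : f ⬝ᵥ b = 0 ∧ k ⬝ᵥ a = 0) (hac : f ⬝ᵥ c = 0 ∧ l ⬝ᵥ a = 0)
    (hbc : k ⬝ᵥ c = 0 ∧ l ⬝ᵥ b = 0) :
    ∃ p : PSL, IsMirror (p⁻¹ * α * p) ![1, 0, 0] ![2, 0, 0] ∧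
      IsMirror (p⁻¹ * β * p) ![0, 1, 0] ![0, 2, 0] := by
  have hM : (of ![a, b, c])ᵀ.det ≠ 0 := by
    -- The covectors form twice the dual basis of `a, b, c`, so these vectors are independent.
    have : of ![f, k, l] * (of ![a, b, c])ᵀ = (2 : F) • 1 := by
      ext i j
      rw [Matrix.mul_apply']
      change ![f, k, l] i ⬝ᵥ ![a, b, c] j = _
      fin_cases i <;> fin_cases j <;>
        simp [ma.dot, mb.dot, mc.dot, hab.1, hab.2, hac.1, hac.2, hbc.1, hbc.2]
    have hd := congrArg det this
    rw [det_mul, det_smul, det_one, Fintype.card_fin, mul_one] at hd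
    exact right_ne_zero_of_mul (hd.trans_ne (pow_ne_zero 3 h2))
  set d := (of ![a, b, c])ᵀ.det with hd
  -- One column is rescaled so that the change of basis lies in `SL(3, F)`.
  have hdet : (of ![d⁻¹ • a, b, c])ᵀ.det = 1 := by
    rw [det_transpose, det_fin_three] at hd ⊢
    simp at hd ⊢
    field_simp
    linear_combination -hd
  have ma' := ma.smul (inv_ne_zero hM)
  rw [inv_inv] at ma'
  set p : SL := ⟨(of ![d⁻¹ • a, b, c])ᵀ, hdet⟩ with hp
  have hpinv : ∀ x y : Fin 3 → F, (p : Matrix (Fin 3) (Fin 3) F) *ᵥ x = y →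
      ((p⁻¹ : SL) : Matrix (Fin 3) (Fin 3) F) *ᵥ y = x := by
    rintro x _ rfl
    rw [mulVec_mulVec, ← Matrix.SpecialLinearGroup.coe_mul, inv_mul_cancel,
      Matrix.SpecialLinearGroup.coe_one, one_mulVec]
  have hvec : ∀ x : Fin 3 → F, x ᵥ* (p : Matrix (Fin 3) (Fin 3) F) =
      ![x ⬝ᵥ d⁻¹ • a, x ⬝ᵥ b, x ⬝ᵥ c] := by
    intro x
    ext i
    fin_cases i <;> rfl
  refine ⟨p, ?_, ?_⟩
  · have := ma'.conj p
    rw [hvec, hpinv ![1, 0, 0], ma'.dot, smul_dotProduct, smul_dotProduct, hab.1, hac.1] at this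
    · simpa using this
    · ext i
      fin_cases i <;> simp [hp, mulVec, dotProduct, Fin.sum_univ_three]
  · have := mb.conj p
    rw [hvec, hpinv ![0, 1, 0], mb.dot, dotProduct_smul, hab.2, hbc.1] at this
    · simpa using this
    · ext i
      fin_cases i <;> simp [hp, mulVec, dotProduct, Fin.sum_univ_three]

/-- Outside characteristic two, `g 0 5`, `g 0 2` and their product `g 2 5` are distinct commuting
involutions, hence orthogonal reflections that one conjugation makes diagonal. -/
theorem not_isRotationSystem_six (g : ℕ → ℕ → PSL) : ¬ IsRotationSystem 6 g := by
  by_cases h2 : (2 : F) = 0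
  · exact not_isRotationSystem_six_of_two_eq_zero h2 g
  intro h
  have hmir : ∀ i j, i < 6 → j < 6 → i + 2 ≤ j → ∃ v f : Fin 3 → F, IsMirror (g i j) v f :=
    fun i j hi hj hij => exists_isMirror (h.mul_self hi hj (by omega))
      (h.ne_one hi hj (by omega))
  obtain ⟨a, f, ma⟩ := hmir 0 5 (by omega) (by omega) (by omega)
  obtain ⟨b, k, mb⟩ := hmir 0 2 (by omega) (by omega) (by omega)
  obtain ⟨c, l, mc⟩ := hmir 2 5 (by omega) (by omega) (by omega)
  have e : g 2 5 = g 0 2 * g 0 5 :=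
    (h.star_mul (by omega) (by omega) (by omega) (by omega)).symm
  have hcomm : g 0 2 * g 0 5 = g 0 5 * g 0 2 :=
    h.star_comm (by omega) (by omega) (by omega) (by omega) (by omega) (by omega)
  have hne : ∀ j < 6, j ≠ 0 → g 0 j ≠ g 2 5 := fun j hj hj0 =>
    h.sep 0 j 2 5 (by omega) hj (by omega) (by omega) (by omega) (by omega) (by omega)
  obtain ⟨p, hp1, hp2⟩ := exists_conj_isMirror h2 ma mb mc
    ((ma.comm_iff mb (h.star_ne (by omega) (by omega) (by omega) (by omega) (by omega))).1
      hcomm.symm)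
    ((ma.comm_iff mc (hne 5 (by omega) (by omega))).1 (by rw [e, ← mul_assoc, ← hcomm]))
    ((mb.comm_iff mc (hne 2 (by omega) (by omega))).1 (by rw [e, mul_assoc, ← hcomm]))
  refine (h.map (MulAut.conj p⁻¹).toMonoidHom (MulAut.conj p⁻¹).injective).false_of_diagonal h2
    ?_ ?_
  · simpa using hp1
  · simpa using hp2

end RankSix

/-! ### Embedding `PSU(3, q)` in `PSL(3, q ^ 2)` -/

section SpecialUnitary

open Matrix

variable {K : Type*} [Field K] [StarRing K]

/-- The inclusion of the special unitary group in the special linear group. -/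
def specialUnitaryToSpecialLinear :
    specialUnitaryGroup (Fin 3) K →* SpecialLinearGroup (Fin 3) K where
  toFun A := ⟨A, (mem_specialUnitaryGroup_iff.1 A.2).2⟩
  map_one' := rfl
  map_mul' _ _ := rfl

/-- Commuting with `diagonal ![a, star a, 1]`, whose entries are distinct, makes the matrix
diagonal; commuting with a cyclic permutation matrix makes it scalar. -/
theorem exists_scalar_of_mem_center {a : K} (ha : a * star a = 1) (ha2 : a * a ≠ 1)
    {A : specialUnitaryGroup (Fin 3) K} (hA : A ∈ Subgroup.center (specialUnitaryGroup (Fin 3) K)) :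
    ∃ c : K, (A : Matrix (Fin 3) (Fin 3) K) = scalar (Fin 3) c := by
  have ha1 : a ≠ 1 := by
    rintro rfl
    exact ha2 (one_mul 1)
  have ha' : star a * a = 1 := by rw [mul_comm, ha]
  have hD : diagonal ![a, star a, 1] ∈ specialUnitaryGroup (Fin 3) K := by
    rw [mem_specialUnitaryGroup_iff, mem_unitaryGroup_iff, star_eq_conjTranspose,
      diagonal_conjTranspose, diagonal_mul_diagonal, det_diagonal, Fin.prod_univ_three]
    refine ⟨?_, by simpa using ha⟩
    rw [← diagonal_one]
    congr 1
    ext i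
    fin_cases i <;> simp [ha, ha']
  have hC : !![0, 1, 0; 0, 0, 1; 1, 0, 0] ∈ specialUnitaryGroup (Fin 3) K := by
    rw [mem_specialUnitaryGroup_iff, mem_unitaryGroup_iff, star_eq_conjTranspose, det_fin_three]
    refine ⟨?_, by simp⟩
    ext i j
    fin_cases i <;> fin_cases j <;> simp [Matrix.mul_apply, Fin.sum_univ_three, conjTranspose_apply]
  have e1 := fun i j => congrFun (congrFun
    (congrArg Subtype.val (Subgroup.mem_center_iff.1 hA ⟨_, hD⟩)) i) j
  have e2 := fun i j => congrFun (congrFun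
    (congrArg Subtype.val (Subgroup.mem_center_iff.1 hA ⟨_, hC⟩)) i) j
  have coe : ∀ X Y : specialUnitaryGroup (Fin 3) K,
      (X * Y).val = (X.val * Y.val : Matrix (Fin 3) (Fin 3) K) := fun _ _ => rfl
  simp only [coe, diagonal_mul, mul_diagonal] at e1
  have hne : ∀ i j, i ≠ j → (A : Matrix (Fin 3) (Fin 3) K) i j = 0 := by
    intro i j hij
    have h : (![a, star a, 1] i - ![a, star a, 1] j) * (A : Matrix (Fin 3) (Fin 3) K) i j = 0 := by
      linear_combination e1 i j
    refine (mul_eq_zero.1 h).resolve_left fun h0 => ?_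
    have hs : a ≠ star a := fun hs => ha2 (by nth_rw 2 [hs]; exact ha)
    have hs1 : star a ≠ 1 := fun hs => ha1 (by simpa [hs] using ha)
    rw [sub_eq_zero] at h0
    fin_cases i <;> fin_cases j
    · exact hij rfl
    · exact hs h0
    · exact ha1 h0
    · exact hs h0.symm
    · exact hij rfl
    · exact hs1 h0
    · exact ha1 h0.symm
    · exact hs1 h0.symm
    · exact hij rfl
  simp only [coe, Matrix.mul_apply, Fin.sum_univ_three] at e2
  have e01 := e2 0 1
  have e12 := e2 1 2
  simp at e01 e12
  refine ⟨(A : Matrix (Fin 3) (Fin 3) K) 0 0, ?_⟩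
  rw [scalar_apply]
  ext i j
  by_cases hij : i = j
  · subst hij
    rw [diagonal_apply_eq]
    fin_cases i
    · rfl
    · exact e01
    · exact e12.trans e01
  · rw [hne i j hij, diagonal_apply_ne _ hij]

/-- Central unitary matrices are scalar, hence central in `SL`, so the inclusion descends.
Conversely, a unitary matrix central in `SL` commutes with all unitary ones, so the kernel is
trivial. -/
theorem exists_injective_of_star_mul_self {a : K} (ha : a * star a = 1) (ha2 : a * a ≠ 1) :
    ∃ ι : ProjectiveSpecialUnitaryGroup (Fin 3) K →* ProjectiveSpecialLinearGroup (Fin 3) K,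
      Function.Injective ι := by
  have hle : Subgroup.center (specialUnitaryGroup (Fin 3) K) ≤
      (Subgroup.center (SpecialLinearGroup (Fin 3) K)).comap specialUnitaryToSpecialLinear := by
    intro A hA
    obtain ⟨c, hc⟩ := exists_scalar_of_mem_center ha ha2 hA
    refine Matrix.SpecialLinearGroup.mem_center_iff.2 ⟨c, ?_, hc.symm⟩
    have hdet := (mem_specialUnitaryGroup_iff.1 A.2).2
    rwa [hc, scalar_apply, det_diagonal, Finset.prod_const, Finset.card_univ] at hdet
  refine ⟨QuotientGroup.map _ _ specialUnitaryToSpecialLinear hle,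
    (injective_iff_map_eq_one _).2 fun x hx => ?_⟩
  induction x using QuotientGroup.induction_on with | _ A
  have hA : specialUnitaryToSpecialLinear A ∈ Subgroup.center (SpecialLinearGroup (Fin 3) K) :=
    (QuotientGroup.eq_one_iff _).1 hx
  refine (QuotientGroup.eq_one_iff _).2 (Subgroup.mem_center_iff.2 fun B => Subtype.ext ?_)
  have := Subgroup.mem_center_iff.1 hA (specialUnitaryToSpecialLinear B)
  exact congrArg (fun C : SpecialLinearGroup (Fin 3) K => (C : Matrix (Fin 3) (Fin 3) K)) this

/-- The power `q - 1` of a generator of `Kˣ` serves: it has order `q + 1 > 2`. -/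
theorem exists_star_mul_self {q : ℕ} (hq : 2 ≤ q) (hK : Nat.card K = q ^ 2)
    (hstar : ∀ x : K, star x = x ^ q) : ∃ a : K, a * star a = 1 ∧ a * a ≠ 1 := by
  have : Finite K := Nat.finite_of_card_ne_zero (by rw [hK]; positivity)
  obtain ⟨ζ, hζ⟩ := IsCyclic.exists_ofOrder_eq_natCard (α := Kˣ)
  obtain ⟨m, rfl⟩ : ∃ m, q = m + 1 := ⟨q - 1, by omega⟩
  have hcard : (m + 1) ^ 2 - 1 = m * (m + 2) := by
    rw [show (m + 1) ^ 2 = m * (m + 2) + 1 by ring, Nat.add_sub_cancel]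
  rw [Nat.card_units, hK, hcard] at hζ
  have h1 : (ζ ^ m) * (ζ ^ m) ^ (m + 1) = 1 := by
    rw [← pow_succ', ← pow_mul, ← hζ, pow_orderOf_eq_one]
  have h2 : (ζ ^ m) * (ζ ^ m) ≠ 1 := by
    rw [← pow_add]
    intro h
    have hle := Nat.le_of_dvd (by omega) (orderOf_dvd_of_pow_eq_one h)
    rw [hζ] at hle
    nlinarith
  refine ⟨((ζ ^ m : Kˣ) : K), ?_, fun h => h2 (Units.ext h)⟩
  rw [hstar, ← Units.val_pow_eq_pow_val, ← Units.val_mul, h1, Units.val_one]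

end SpecialUnitary

/-! ### Conclusion -/

/-- Stating the obstruction for embeddings, over any field, treats `PSL(3, q)`, its subgroups and
`PSU(3, q)` alike. -/
theorem IsChiralPolytope.not_injective {P : Type*} [PartialOrder P] [BoundedOrder P] {n : ℕ}
    (hP : IsChiralPolytope P n) (hn : 6 ≤ n) {F : Type*} [Field F]
    (ι : (P ≃o P) →* Matrix.ProjectiveSpecialLinearGroup (Fin 3) F) :
    ¬ Function.Injective ι := by
  intro hι
  obtain ⟨g, hg⟩ := hP.exists_rotationSystem (by omega)
  have h := hg.map ι hι
  rcases hn.eq_or_lt with rfl | hn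
  · exact not_isRotationSystem_six _ h
  · exact not_isRotationSystem_of_seven_le hn _ h

theorem theorem1p3 (q : ℕ) (hq : IsPrimePow q)
    (F : Type*) [Field F] (hF : Nat.card F = q)
    (K : Type*) [Field K] [StarRing K] (hK : Nat.card K = q ^ 2)
    (hstar : ∀ x : K, star x = x ^ q)
    (P : Type*) [PartialOrder P] [BoundedOrder P] :
    (∀ n : ℕ, 5 < n → IsChiralPolytope P n →
      IsEmpty ((P ≃o P) ≃* Matrix.ProjectiveSpecialLinearGroup (Fin 3) F) ∧
      IsEmpty ((P ≃o P) ≃* ProjectiveSpecialUnitaryGroup (Fin 3) K)) ∧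
    (IsChiralPolytope P 6 →
      ∀ H : Subgroup (Matrix.ProjectiveSpecialLinearGroup (Fin 3) F),
        IsEmpty ((P ≃o P) ≃* H)) := by
  refine ⟨fun n hn hP => ⟨⟨fun e => ?_⟩, ⟨fun e => ?_⟩⟩, fun hP H => ⟨fun e => ?_⟩⟩
  · exact hP.not_injective hn e.toMonoidHom e.injective
  · obtain ⟨a, ha, ha2⟩ := exists_star_mul_self hq.two_le hK hstar
    obtain ⟨ι, hι⟩ := exists_injective_of_star_mul_self ha ha2
    exact hP.not_injective hn (ι.comp e.toMonoidHom) (hι.comp e.injective)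
  · exact hP.not_injective le_rfl (H.subtype.comp e.toMonoidHom)
      (H.subtype_injective.comp e.injective)
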